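/- Proposition 3.3. Let $M$ be a compact connected complex manifold of complex dimension $n\ge 2$, and let $\alpha$ be a smooth Hermitian metric on $M$ (identified with its fundamental form $\alpha=\sqrt{-1}\,\alpha_{i\bar j}\,dz_i\wedge d\bar z_j$), with Hodge star operator $*$. Suppose that the astheno-Ricci curvature of $\alpha$ is non-positive, i.e. the real $(1,1)$-form $*\big(\sqrt{-1}\,\partial\bar\partial(\alpha^{n-2})\big)$ is negative semidefinite at every point of $M$. Let $A,H,K\in\mathbb R$ and $\delta>0$. Then there is a constant $C$, depending only on $A$, $H$, $\delta$, $K$ and $(M,\alpha)$, with the following property. Let $\omega_0$ be a smooth Hermitian metric on $M$ with $\delta\alpha\le\omega_0\le K\alpha$, let $h\in C^\infty(M,\mathbb R)$ with $\|h\|_{C^0}\le H$, let $b\in\mathbb R$, and let $\varphi\in C^\infty(M,\mathbb R)$ be a solution of the form-type Calabi–Yau equation, i.e. there is a Hermitian metric $\hat\omega$ on $M$ with $$\hat\omega^{n}=e^{h+b}\alpha^{n},\qquad \hat\omega^{n-1}=\omega_0^{n-1}+\sqrt{-1}\,\partial\bar\partial(\varphi\,\alpha^{n-2}) ,$$ normalized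 by $\int_M e^{\varphi}\,\alpha^n=A$ and with $\sup_M\varphi\le 1$. Then $$\inf_M\varphi\ge -C .$$ -/

import Mathlib

open MeasureTheory
open scoped Manifold ContDiff ExteriorAlgebra ComplexOrder

noncomputable section

namespace FormTypeCY

/-! ### Complex-valued exterior forms on `ℂⁿ` -/

/-- Index set of the coframe `dz₁, …, dzₙ, dz̄₁, …, dz̄ₙ` (in this order). -/
abbrev CoIdx (n : ℕ) : Type := Fin n ⊕ₗ Fin n

/-- Complexified covectors `∑ aᵢ dzᵢ + ∑ bⱼ dz̄ⱼ` at a point of a coordinate domain in `ℂⁿ`. -/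
abbrev CoVec (n : ℕ) : Type := CoIdx n → ℂ

/-- The algebra `⨁ₖ Λᵏ(T*⊗ℂ)` of complex-valued exterior forms at a point, in holomorphic
coordinates. The product is the wedge product. -/
abbrev Form (n : ℕ) : Type := ExteriorAlgebra ℂ (CoVec n)

/-- The covector `dzᵢ`. -/
def dz {n : ℕ} (i : Fin n) : Form n :=
  ExteriorAlgebra.ι ℂ (Pi.single (Sum.inlₗ i) 1 : CoVec n)

/-- The covector `dz̄ᵢ`. -/
def dzbar {n : ℕ} (i : Fin n) : Form n :=
  ExteriorAlgebra.ι ℂ (Pi.single (Sum.inrₗ i) 1 : CoVec n)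

/-- The basis `dz_I ∧ dz̄_J` of the algebra of forms. -/
def formBasis (n : ℕ) : Module.Basis (Finset (CoIdx n)) ℂ (Form n) :=
  (Pi.basisFun ℂ (CoIdx n)).ExteriorAlgebra

/-- The `(1,1)`-form `√-1 ∑ gᵢⱼ dzᵢ ∧ dz̄ⱼ`. -/
def fundForm {n : ℕ} (g : Matrix (Fin n) (Fin n) ℂ) : Form n :=
  ∑ i, ∑ j, (Complex.I * g i j) • (dz i * dzbar j)

/-! ### The operators `∂` and `∂̄` -/

/-- `∂f/∂z_k = ½ (∂f/∂x_k - √-1 ∂f/∂y_k)`. -/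
def wirtinger {n : ℕ} (k : Fin n) (f : (Fin n → ℂ) → ℂ) (z : Fin n → ℂ) : ℂ :=
  (1 / 2) * (fderiv ℝ f z (Pi.single k 1) - Complex.I * fderiv ℝ f z (Pi.single k Complex.I))

/-- `∂f/∂z̄_k = ½ (∂f/∂x_k + √-1 ∂f/∂y_k)`. -/
def wirtingerBar {n : ℕ} (k : Fin n) (f : (Fin n → ℂ) → ℂ) (z : Fin n → ℂ) : ℂ :=
  (1 / 2) * (fderiv ℝ f z (Pi.single k 1) + Complex.I * fderiv ℝ f z (Pi.single k Complex.I))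

/-- Apply an operator on functions to every coefficient (in the basis `dz_I ∧ dz̄_J`) of a
differential form. -/
def coeffwise {n : ℕ} (D : ((Fin n → ℂ) → ℂ) → (Fin n → ℂ) → ℂ) (η : (Fin n → ℂ) → Form n)
    (z : Fin n → ℂ) : Form n :=
  ∑ S, D (fun w => (formBasis n).repr (η w) S) z • formBasis n S

/-- `∂η = ∑ₖ dz_k ∧ ∂η/∂z_k`. -/
def del {n : ℕ} (η : (Fin n → ℂ) → Form n) (z : Fin n → ℂ) : Form n :=
  ∑ k, dz k * coeffwise (wirtinger k) η z

/-- `∂̄η = ∑ₖ dz̄_k ∧ ∂η/∂z̄_k`. -/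
def delBar {n : ℕ} (η : (Fin n → ℂ) → Form n) (z : Fin n → ℂ) : Form n :=
  ∑ k, dzbar k * coeffwise (wirtingerBar k) η z

/-- `√-1 ∂∂̄η`. -/
def iDelDelBar {n : ℕ} (η : (Fin n → ℂ) → Form n) (z : Fin n → ℂ) : Form n :=
  Complex.I • del (delBar η) z

/-! ### The Hodge star operator -/

/-- The complex-bilinear extension to covectors of the metric with fundamental form
`√-1 gᵢⱼ dzᵢ ∧ dz̄ⱼ`: `⟨dzᵢ, dz̄ⱼ⟩ = ⟨dz̄ⱼ, dzᵢ⟩ = g^{i j̄}`, where `∑ⱼ g^{i j̄} g_{k j̄} = δᵢₖ`, and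
`⟨dzᵢ, dzⱼ⟩ = ⟨dz̄ᵢ, dz̄ⱼ⟩ = 0`. -/
def coMetric {n : ℕ} (g : Matrix (Fin n) (Fin n) ℂ) : CoVec n →ₗ[ℂ] Module.Dual ℂ (CoVec n) :=
  Matrix.toBilin' (Matrix.of fun a b : CoIdx n =>
    match ofLex a, ofLex b with
    | Sum.inl i, Sum.inr j => g⁻¹ j i
    | Sum.inr j, Sum.inl i => g⁻¹ j i
    | _, _ => 0)

/-- The induced complex-bilinear pairing on `k`-forms,
`⟨u₁ ∧ ⋯ ∧ u_k, v₁ ∧ ⋯ ∧ v_k⟩ = det ⟨u_a, v_b⟩`. -/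
def formInner {n : ℕ} (g : Matrix (Fin n) (Fin n) ℂ) (k : ℕ) (ψ η : ⋀[ℂ]^k (CoVec n)) : ℂ :=
  exteriorPower.pairingDual ℂ (CoVec n) k (exteriorPower.map k (coMetric g) ψ) η

/-- The volume form `αⁿ / n!`. -/
def volForm {n : ℕ} (g : Matrix (Fin n) (Fin n) ℂ) : Form n :=
  ((n.factorial : ℂ)⁻¹) • fundForm g ^ n

/-- `β = *η` for the (complex-linear) Hodge star of the metric `g` on `k`-forms: `β` is the
`(2n-k)`-form such that `ψ ∧ β = ⟨ψ, η⟩ αⁿ/n!` for all `k`-forms `ψ`. -/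
def IsHodgeStar {n : ℕ} (g : Matrix (Fin n) (Fin n) ℂ) (k : ℕ) (η β : Form n) : Prop :=
  β ∈ ⋀[ℂ]^(2 * n - k) (CoVec n) ∧ ∃ hη : η ∈ ⋀[ℂ]^k (CoVec n),
    ∀ ψ : ⋀[ℂ]^k (CoVec n), (ψ : Form n) * β = formInner g k ψ ⟨η, hη⟩ • volForm g

/-! ### Hermitian metrics on a complex manifold -/

/-- The Jacobian matrix `∂w_a/∂z_i` of a holomorphic map `z ↦ w`. -/
def jacobian {n : ℕ} (τ : (Fin n → ℂ) → (Fin n → ℂ)) (z : Fin n → ℂ) :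
    Matrix (Fin n) (Fin n) ℂ :=
  Matrix.of fun a i => fderiv ℂ τ z (Pi.single i 1) a

variable {n : ℕ} {M : Type*} [TopologicalSpace M] [ChartedSpace (Fin n → ℂ) M]

variable (n M) in
/-- A smooth Hermitian metric on `M`, given in each holomorphic chart `e` of the atlas by its
matrix `g_{i j̄}` at the points of `e.target`. The last field is the transformation law
`g_{i j̄} = ∑ (∂w_a/∂z_i) g'_{a b̄} conj (∂w_b/∂z_j)`. -/
structure HermitianMetric where
  coeff : OpenPartialHomeomorph M (Fin n → ℂ) → (Fin n → ℂ) → Matrix (Fin n) (Fin n) ℂ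
  posDef : ∀ e ∈ atlas (Fin n → ℂ) M, ∀ z ∈ e.target, (coeff e z).PosDef
  smooth : ∀ e ∈ atlas (Fin n → ℂ) M, ∀ i j, ContDiffOn ℝ ∞ (fun z => coeff e z i j) e.target
  transform : ∀ e ∈ atlas (Fin n → ℂ) M, ∀ e' ∈ atlas (Fin n → ℂ) M,
    ∀ z ∈ (e.symm.trans e').source,
      coeff e z = (jacobian (e.symm.trans e') z).transpose * coeff e' (e' (e.symm z)) *
        (jacobian (e.symm.trans e') z).map (starRingEnd ℂ)

/-- The fundamental form `√-1 g_{i j̄} dzᵢ ∧ dz̄ⱼ` of a Hermitian metric in the chart `e`. -/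
def HermitianMetric.form (α : HermitianMetric n M) (e : OpenPartialHomeomorph M (Fin n → ℂ))
    (z : Fin n → ℂ) : Form n :=
  fundForm (α.coeff e z)

/-- The measure `αⁿ` of the domain of a chart. In coordinates,
`αⁿ = n! det(g) ∏ √-1 dzᵢ ∧ dz̄ᵢ = 2ⁿ n! det(g) dx₁dy₁⋯dxₙdyₙ`. -/
def HermitianMetric.chartVolume [MeasurableSpace M] (α : HermitianMetric n M)
    (e : OpenPartialHomeomorph M (Fin n → ℂ)) : Measure M :=
  ((volume.restrict e.target).withDensity
    fun z => ENNReal.ofReal (2 ^ n * n.factorial * (α.coeff e z).det.re)).map e.symm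

/-- The measure `αⁿ` on `M`. The measures in the charts agree on overlaps; the least measure that
dominates all of them is the measure obtained by gluing them. -/
def HermitianMetric.vol [MeasurableSpace M] (α : HermitianMetric n M) : Measure M :=
  ⨆ e ∈ atlas (Fin n → ℂ) M, α.chartVolume e

/-- The astheno-Ricci curvature `* √-1 ∂∂̄(α^{n-2})` is non-positive: at every point it is
`√-1 B_{i j̄} dzᵢ ∧ dz̄ⱼ` with `B` Hermitian and negative semidefinite. -/
def HermitianMetric.AsthenoRicciNonpos (α : HermitianMetric n M) : Prop :=
  ∀ e ∈ atlas (Fin n → ℂ) M, ∀ z ∈ e.target, ∃ B : Matrix (Fin n) (Fin n) ℂ,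
    IsHodgeStar (α.coeff e z) (2 * n - 2) (iDelDelBar (fun w => α.form e w ^ (n - 2)) z)
      (fundForm B) ∧ (-B).PosSemidef

/-- `δ α ≤ ω₀ ≤ K α` on `M`. -/
def HermitianMetric.C0Bounds (α : HermitianMetric n M) (δ K : ℝ) (ω₀ : HermitianMetric n M) :
    Prop :=
  ∀ e ∈ atlas (Fin n → ℂ) M, ∀ z ∈ e.target,
    (ω₀.coeff e z - (δ : ℂ) • α.coeff e z).PosSemidef ∧
    ((K : ℂ) • α.coeff e z - ω₀.coeff e z).PosSemidef

/-- `φ` (with the constant `b`) solves the form-type Calabi-Yau equation: there is a Hermitian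
metric `ω'` with `ω'^{n-1} = ω₀^{n-1} + √-1 ∂∂̄(φ α^{n-2})` and `ω'ⁿ = e^{h+b} αⁿ`. In particular
the right-hand side of the first equation is a positive `(n-1,n-1)`-form. -/
def SolvesFormTypeCY (α ω₀ : HermitianMetric n M) (h : M → ℝ) (b : ℝ) (φ : M → ℝ) : Prop :=
  ∃ ω' : HermitianMetric n M, ∀ e ∈ atlas (Fin n → ℂ) M, ∀ z ∈ e.target,
    ω'.form e z ^ (n - 1) = ω₀.form e z ^ (n - 1) +
      iDelDelBar (fun w => (φ (e.symm w) : ℂ) • α.form e w ^ (n - 2)) z ∧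
    ω'.form e z ^ n = (Real.exp (h (e.symm z) + b) : ℂ) • α.form e z ^ n

end FormTypeCY

end

open FormTypeCY

/-! Wedge the equation for the (n-1)-st powers with the form of a constant positive semidefinite
matrix B and take the top coefficient. By the Leibniz rule (`topCoeff_equation`) this becomes a
scalar identity: ω'ⁿ⁻¹∧B equals ω₀ⁿ⁻¹∧B, plus the mixed discriminant of α, the complex Hessian of φ
and B, plus terms linear in ∂φ, plus φ times √-1∂∂̄(αⁿ⁻²)∧B. Mixed discriminants of positive
semidefinite matrices are nonnegative and hence monotone, so the identity behaves like an elliptic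
equation. The Hodge star hypothesis says that the factor of φ in the last term is nonpositive
(`topCoeff_mul_fundForm_nonpos_of_isHodgeStar`).

Three local estimates follow.

Maximum. Where φ is maximal and at least -T, the gradient vanishes and the Hessian is nonpositive,
so testing with B = α bounds the trace of the adjugate of ω', hence its determinant. As ω'ⁿ =
e^{h+b}αⁿ, this bounds b from above (`exists_const_bound`).

Gradient. Put w = log(2 - φ). Since ω'ⁿ⁻¹∧α ≥ 0, dividing the identity by e^w = 2 - φ gives Lw +
μ|∂w|² ≤ C, where L is second order and elliptic (`exists_log_inequality`). The division makes the
zeroth-order term bounded, whatever the size of φ. Integration against a squared cutoff bounds ∇w in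
L¹ of a smaller ball, and a Poincaré argument shows that a sublevel set and a much higher superlevel
set of w cannot both have large volume in that ball (`exists_level_bound`).

Minimum. Near a minimum point, paraboloids of small opening are slid up from below until they touch
φ. At the contact points φ ≤ 0, so the zeroth-order term is nonnegative by the curvature hypothesis;
the gradient is small and the Hessian almost nonnegative. Hence the adjugate of ω' is bounded below,
its determinant is bounded above because b is, and so the Hessian of φ is bounded
(`exists_contact_bound`). The map from contact points to vertices therefore has bounded Jacobian,
and it covers a ball of fixed radius. So {φ ≤ min φ + 1} has volume bounded below
(`exists_volume_sublevel_bound`), as in the Alexandrov–Bakelman–Pucci method.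

Conclusion. The normalization of ∫e^φ and φ ≤ 1 force φ ≥ -T on a set of definite volume, so w has a
large sublevel set in some coordinate ball. By connectedness this information passes through
overlapping balls, with worse constants, to the ball that contains the minimum point
(`exists_sublevel_bound_of_preconnected`). There w ≥ log(1 - min φ) on a set of definite volume, so
the level set estimate bounds log(1 - min φ). -/

noncomputable section

namespace FormTypeCY

variable {n : ℕ}

/-! ### Linear algebra of exterior forms -/

section Alternating

variable {R V W : Type*} [Field R] [AddCommGroup V] [Module R V] [AddCommGroup W] [Module R W]

/-- Linear functionals separate the points of `W`, which reduces the claim to scalar-valued maps. -/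
theorem alternatingMap_eq_det_smul {ι : Type*} [Fintype ι] [DecidableEq ι]
    (e : Module.Basis ι R V) (f : V [⋀^ι]→ₗ[R] W) (v : ι → V) : f v = e.det v • f e := by
  rw [← sub_eq_zero, ← Module.forall_dual_apply_eq_zero_iff R]
  intro ℓ
  have := congrArg (fun F => F v) ((ℓ.compAlternatingMap f).eq_smul_basis_det e)
  simp only [LinearMap.compAlternatingMap_apply, AlternatingMap.smul_apply, smul_eq_mul] at this
  rw [map_sub, map_smul, this, smul_eq_mul]
  ring

theorem alternatingMap_pi_eq_det_smul {ι : Type*} [Fintype ι] [DecidableEq ι]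
    (f : (ι → R) [⋀^ι]→ₗ[R] W) (v : ι → ι → R) :
    f v = (Matrix.of v).det • f (fun i => Pi.single i 1) := by
  rw [alternatingMap_eq_det_smul (Pi.basisFun R ι) f v]
  congr 1
  · rw [Pi.basisFun_det]; rfl
  · congr 1
    ext i
    simp

end Alternating

variable {n : ℕ}

/-- The interleaved family `x₀, y₀, x₁, y₁, …`. -/
def interleave {V : Type*} {k : ℕ} (x y : Fin k → V) (a : Fin (k * 2)) : V :=
  if a.modNat = 0 then x a.divNat else y a.divNat

/-- The wedge product `x₀ ∧ y₀ ∧ x₁ ∧ y₁ ∧ ⋯`. -/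
def pairProd {k : ℕ} (x y : Fin k → CoVec n) : Form n :=
  (List.ofFn fun i => ExteriorAlgebra.ι ℂ (x i) * ExteriorAlgebra.ι ℂ (y i)).prod

/-- Grouping a product of 2k covectors in pairs. This makes the alternating property available for
products of two-forms. -/
theorem pairProd_eq_ιMulti {k : ℕ} (x y : Fin k → CoVec n) :
    pairProd x y = ExteriorAlgebra.ιMulti ℂ (k * 2) (interleave x y) := by
  rw [ExteriorAlgebra.ιMulti_apply, List.ofFn_mul, List.prod_flatten, List.map_ofFn, pairProd]
  congr 2
  ext i
  simp only [Function.comp_apply, List.ofFn_succ, List.ofFn_zero, List.prod_cons, List.prod_nil,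
    mul_one, interleave]
  have h1 : ∀ h, (⟨(i : ℕ) * 2, h⟩ : Fin (k * 2)).modNat = 0 := fun h => by
    ext; simp [Fin.modNat]
  have h2 : ∀ h, (⟨(i : ℕ) * 2, h⟩ : Fin (k * 2)).divNat = i := fun h => by
    ext; simp [Fin.divNat]
  have h3 : ∀ h, (⟨(i : ℕ) * 2 + 1, h⟩ : Fin (k * 2)).modNat ≠ 0 := fun h hh => by
    have := congrArg Fin.val hh
    simp [Fin.modNat, Nat.add_mod] at this
  have h4 : ∀ h, (⟨(i : ℕ) * 2 + 1, h⟩ : Fin (k * 2)).divNat = i := fun h => by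
    ext; simp [Fin.divNat]; omega
  simp [h1, h2, h3, h4]

theorem pairProd_eq_zero_left {k : ℕ} (x y : Fin k → CoVec n) {i j : Fin k} (h : x i = x j)
    (hij : i ≠ j) : pairProd x y = 0 := by
  rw [pairProd_eq_ιMulti]
  have key : ∀ i : Fin k, ∃ a : Fin (k * 2), a.modNat = 0 ∧ a.divNat = i := fun i =>
    ⟨⟨i * 2, by omega⟩, by ext; simp [Fin.modNat], by ext; simp [Fin.divNat]⟩
  obtain ⟨a, ha, ha'⟩ := key i
  obtain ⟨b, hb, hb'⟩ := key j
  refine AlternatingMap.map_eq_zero_of_eq _ _ (i := a) (j := b) ?_ ?_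
  · simp [interleave, ha, ha', hb, hb', h]
  · rintro rfl; exact hij (ha'.symm.trans hb')

theorem pairProd_eq_zero_right {k : ℕ} (x y : Fin k → CoVec n) {i j : Fin k} (h : y i = y j)
    (hij : i ≠ j) : pairProd x y = 0 := by
  rw [pairProd_eq_ιMulti]
  have key : ∀ i : Fin k, ∃ a : Fin (k * 2), a.modNat = 1 ∧ a.divNat = i := fun i =>
    ⟨⟨i * 2 + 1, by omega⟩, by ext; simp [Fin.modNat, Nat.add_mod], by
      ext; simp [Fin.divNat]; omega⟩
  obtain ⟨a, ha, ha'⟩ := key i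
  obtain ⟨b, hb, hb'⟩ := key j
  refine AlternatingMap.map_eq_zero_of_eq _ _ (i := a) (j := b) ?_ ?_
  · simp [interleave, ha, ha', hb, hb', h]
  · rintro rfl; exact hij (ha'.symm.trans hb')

/-- The covector `∑ aᵢ dzᵢ`. -/
def hol : (Fin n → ℂ) →ₗ[ℂ] CoVec n where
  toFun a := fun s => Sum.elim a 0 (ofLex s)
  map_add' a b := by
    ext s; rcases h : ofLex s with i | i <;> simp [h]
  map_smul' c a := by
    ext s; rcases h : ofLex s with i | i <;> simp [h]

/-- The covector `∑ aᵢ dz̄ᵢ`. -/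
def anti : (Fin n → ℂ) →ₗ[ℂ] CoVec n where
  toFun a := fun s => Sum.elim 0 a (ofLex s)
  map_add' a b := by
    ext s; rcases h : ofLex s with i | i <;> simp [h]
  map_smul' c a := by
    ext s; rcases h : ofLex s with i | i <;> simp [h]

theorem ι_hol_single (i : Fin n) : ExteriorAlgebra.ι ℂ (hol (Pi.single i 1)) = dz i := by
  rw [dz]; congr 1
  funext s
  rcases hs : ofLex s with j | j
  · obtain rfl : s = Sum.inlₗ j := hs
    simp [hol, Pi.single_apply]
  · obtain rfl : s = Sum.inrₗ j := hs
    simp [hol]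

theorem ι_anti_single (i : Fin n) : ExteriorAlgebra.ι ℂ (anti (Pi.single i 1)) = dzbar i := by
  rw [dzbar]; congr 1
  funext s
  rcases hs : ofLex s with j | j
  · obtain rfl : s = Sum.inlₗ j := hs
    simp [anti]
  · obtain rfl : s = Sum.inrₗ j := hs
    simp [anti, Pi.single_apply]

theorem ι_hol (a : Fin n → ℂ) : ExteriorAlgebra.ι ℂ (hol a) = ∑ i, a i • dz i := by
  conv_lhs => rw [pi_eq_sum_univ' a]
  simp [map_sum, ι_hol_single]

theorem ι_anti (a : Fin n → ℂ) : ExteriorAlgebra.ι ℂ (anti a) = ∑ i, a i • dzbar i := by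
  conv_lhs => rw [pi_eq_sum_univ' a]
  simp [map_sum, ι_anti_single]

/-- `pairProd` as an alternating map of its first argument. -/
def pairProdLeft {k : ℕ} (y : Fin k → CoVec n) : (CoVec n) [⋀^Fin k]→ₗ[ℂ] Form n where
  toMultilinearMap := (MultilinearMap.mkPiAlgebraFin ℂ k (Form n)).compLinearMap
    fun i => LinearMap.mulRight ℂ (ExteriorAlgebra.ι ℂ (y i)) ∘ₗ ExteriorAlgebra.ι ℂ
  map_eq_zero_of_eq' x _ _ h hij := pairProd_eq_zero_left x y h hij

/-- `pairProd` as an alternating map of its second argument. -/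
def pairProdRight {k : ℕ} (x : Fin k → CoVec n) : (CoVec n) [⋀^Fin k]→ₗ[ℂ] Form n where
  toMultilinearMap := (MultilinearMap.mkPiAlgebraFin ℂ k (Form n)).compLinearMap
    fun i => LinearMap.mulLeft ℂ (ExteriorAlgebra.ι ℂ (x i)) ∘ₗ ExteriorAlgebra.ι ℂ
  map_eq_zero_of_eq' y _ _ h hij := pairProd_eq_zero_right x y h hij

/-- The product `dz₁ ∧ dz̄₁ ∧ ⋯ ∧ dzₙ ∧ dz̄ₙ`. -/
def stdPairs (n : ℕ) : Form n :=
  pairProd (fun i => hol (Pi.single i 1)) (fun i => anti (Pi.single i 1))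

/-- The standard volume form `√-1 dz₁ ∧ dz̄₁ ∧ ⋯ ∧ √-1 dzₙ ∧ dz̄ₙ`. -/
def stdVol (n : ℕ) : Form n := Complex.I ^ n • stdPairs n

/-- With one family fixed, the product is an alternating map of n vectors of ℂⁿ in the other, hence
a determinant. For b the conjugate of a the coefficient is |det a|², which is the source of all
positivity below. -/
theorem pairProd_hol_anti (a b : Fin n → Fin n → ℂ) :
    pairProd (fun i => hol (a i)) (fun i => anti (b i)) =
      ((Matrix.of a).det * (Matrix.of b).det) • stdPairs n := by
  have h1 : pairProd (fun i => hol (a i)) (fun i => anti (b i)) = (Matrix.of a).det •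
      pairProd (fun i => hol (Pi.single i 1)) (fun i => anti (b i)) :=
    alternatingMap_pi_eq_det_smul
      ((pairProdLeft (fun i => anti (b i))).compLinearMap hol) a
  have h2 : pairProd (fun i => hol (Pi.single i 1)) (fun i => anti (b i)) = (Matrix.of b).det •
      stdPairs n :=
    alternatingMap_pi_eq_det_smul
      ((pairProdRight (fun i => hol (Pi.single i 1))).compLinearMap anti) b
  rw [h1, h2, smul_smul]

/-- The index of `dzᵢ` and `dz̄ᵢ` in the interleaved coframe `dz₁, dz̄₁, dz₂, dz̄₂, …`. -/
def coIdxPos (n : ℕ) (s : CoIdx n) : Fin (n * 2) :=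
  match ofLex s with
  | Sum.inl i => ⟨i * 2, by omega⟩
  | Sum.inr i => ⟨i * 2 + 1, by omega⟩

/-- The interleaved enumeration `dz₁, dz̄₁, dz₂, dz̄₂, …` of the coframe. -/
def coIdxEquiv (n : ℕ) : Fin (n * 2) ≃ CoIdx n where
  toFun a := if a.modNat = 0 then Sum.inlₗ a.divNat else Sum.inrₗ a.divNat
  invFun := coIdxPos n
  left_inv a := by
    rcases Nat.mod_two_eq_zero_or_one a with h0 | h0
    · have : a.modNat = 0 := by ext; simpa [Fin.modNat] using h0
      ext; simp [this, Fin.divNat, coIdxPos]; omega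
    · have : a.modNat ≠ 0 := fun hh => by
        have := congrArg Fin.val hh
        simp [Fin.modNat] at this
        omega
      ext; simp [this, Fin.divNat, coIdxPos]; omega
  right_inv s := by
    rcases hs : ofLex s with i | i
    · obtain rfl : s = Sum.inlₗ i := hs
      simp [Fin.modNat, Fin.divNat, coIdxPos]
    · obtain rfl : s = Sum.inrₗ i := hs
      have : (⟨(i : ℕ) * 2 + 1, by omega⟩ : Fin (n * 2)).modNat ≠ 0 := fun hh => by
        have := congrArg Fin.val hh
        simp [Fin.modNat, Nat.add_mod] at this
      simp only [coIdxPos, ofLex_toLex, this, if_false]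
      congr 1
      ext; simp [Fin.divNat]; omega

/-- The determinant of the interleaved basis, extended by zero to the other degrees, lifts to a
functional on the exterior algebra whose value here is 1. -/
theorem stdPairs_ne_zero (n : ℕ) : stdPairs n ≠ 0 := by
  intro h
  let b := (Pi.basisFun ℂ (CoIdx n)).reindex (coIdxEquiv n).symm
  have h1 : interleave (fun i : Fin n => (hol (Pi.single i 1) : CoVec n))
      (fun i => anti (Pi.single i 1)) = b := by
    funext a s
    by_cases ha : a.modNat = 0
    · rcases hs : ofLex s with j | j
      · obtain rfl : s = Sum.inlₗ j := hs
        simp [interleave, ha, b, coIdxEquiv, hol, Pi.single_apply]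
      · obtain rfl : s = Sum.inrₗ j := hs
        simp [interleave, ha, b, coIdxEquiv, hol]
    · rcases hs : ofLex s with j | j
      · obtain rfl : s = Sum.inlₗ j := hs
        simp [interleave, ha, b, coIdxEquiv, anti]
      · obtain rfl : s = Sum.inrₗ j := hs
        simp [interleave, ha, b, coIdxEquiv, anti, Pi.single_apply]
  rw [stdPairs, pairProd_eq_ιMulti, h1] at h
  let f : (i : ℕ) → (CoVec n) [⋀^Fin i]→ₗ[ℂ] ℂ := fun i =>
    if hi : i = n * 2 then b.det.domDomCongr (finCongr hi.symm) else 0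
  have h2 := congrArg (ExteriorAlgebra.liftAlternating f) h
  rw [ExteriorAlgebra.liftAlternating_apply_ιMulti, map_zero] at h2
  simp only [f, dif_pos] at h2
  have h3 : b.det b = 0 := h2
  rw [b.det_self] at h3
  exact one_ne_zero h3

theorem stdVol_ne_zero (n : ℕ) : stdVol n ≠ 0 :=
  smul_ne_zero (pow_ne_zero _ Complex.I_ne_zero) (stdPairs_ne_zero n)

theorem exists_topCoeff (n : ℕ) : ∃ c : Form n →ₗ[ℂ] ℂ, c (stdVol n) = 1 := by
  obtain ⟨f, hf⟩ : ∃ f : Module.Dual ℂ (Form n), f (stdVol n) ≠ 0 := by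
    by_contra! h
    exact stdVol_ne_zero n ((Module.forall_dual_apply_eq_zero_iff ℂ _).1 h)
  exact ⟨(f (stdVol n))⁻¹ • f, by simp [hf]⟩

/-- A linear functional that takes the value `1` at the standard volume form. -/
def topCoeff (n : ℕ) : Form n →ₗ[ℂ] ℂ := (exists_topCoeff n).choose

@[simp]
theorem topCoeff_stdVol : topCoeff n (stdVol n) = 1 := (exists_topCoeff n).choose_spec

/-! ### Powers of fundamental forms -/

theorem fundForm_eq_sum (g : Matrix (Fin n) (Fin n) ℂ) :
    fundForm g = ∑ i, Complex.I • (ExteriorAlgebra.ι ℂ (hol (Pi.single i 1)) *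
      ExteriorAlgebra.ι ℂ (anti (g i))) := by
  rw [fundForm]
  refine Finset.sum_congr rfl fun i _ => ?_
  rw [ι_hol_single, ι_anti, Finset.mul_sum, Finset.smul_sum]
  refine Finset.sum_congr rfl fun j _ => ?_
  rw [mul_smul_comm, smul_smul]

variable (n) in
/-- `fundForm` as a linear map. -/
def fundFormLin : Matrix (Fin n) (Fin n) ℂ →ₗ[ℂ] Form n where
  toFun := fundForm
  map_add' a b := by
    simp [fundForm, mul_add, add_smul, Finset.sum_add_distrib]
  map_smul' c a := by
    simp only [fundForm, Matrix.smul_apply, smul_eq_mul, RingHom.id_apply, Finset.smul_sum,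
      smul_smul]
    refine Finset.sum_congr rfl fun i _ => Finset.sum_congr rfl fun j _ => ?_
    congr 1; ring

@[simp]
theorem fundFormLin_apply (g : Matrix (Fin n) (Fin n) ℂ) : fundFormLin n g = fundForm g := rfl

theorem fundForm_add (a b : Matrix (Fin n) (Fin n) ℂ) :
    fundForm (a + b) = fundForm a + fundForm b := (fundFormLin n).map_add a b

theorem fundForm_smul (c : ℂ) (a : Matrix (Fin n) (Fin n) ℂ) :
    fundForm (c • a) = c • fundForm a := (fundFormLin n).map_smul c a

theorem fundForm_vecMulVec (a b : Fin n → ℂ) :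
    fundForm (Matrix.vecMulVec a b) =
      Complex.I • (ExteriorAlgebra.ι ℂ (hol a) * ExteriorAlgebra.ι ℂ (anti b)) := by
  rw [fundForm, ι_hol, ι_anti, Finset.sum_mul, Finset.smul_sum]
  refine Finset.sum_congr rfl fun i _ => ?_
  rw [Finset.mul_sum, Finset.smul_sum]
  refine Finset.sum_congr rfl fun j _ => ?_
  rw [smul_mul_smul_comm, smul_smul, Matrix.vecMulVec_apply]

variable (n) in
/-- The product `F(B₁) ⋯ F(Bₙ)` of fundamental forms, as a multilinear map. -/
def fundProd (k : ℕ) : MultilinearMap ℂ (fun _ : Fin k => Matrix (Fin n) (Fin n) ℂ) (Form n) :=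
  (MultilinearMap.mkPiAlgebraFin ℂ k (Form n)).compLinearMap fun _ => fundFormLin n

theorem fundProd_apply {k : ℕ} (B : Fin k → Matrix (Fin n) (Fin n) ℂ) :
    fundProd n k B = (List.ofFn fun i => fundForm (B i)).prod := rfl

theorem fundProd_const {k : ℕ} (B : Matrix (Fin n) (Fin n) ℂ) :
    fundProd n k (fun _ => B) = fundForm B ^ k := by
  rw [fundProd_apply, List.ofFn_const, List.prod_replicate]

theorem list_prod_ofFn_smul {k : ℕ} {A : Type*} [Ring A] [Algebra ℂ A] (c : ℂ) (x : Fin k → A) :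
    (List.ofFn fun i => c • x i).prod = c ^ k • (List.ofFn x).prod := by
  induction k with
  | zero => simp
  | succ k ih =>
    simp only [List.ofFn_succ, List.prod_cons]
    rw [ih, smul_mul_smul_comm, pow_succ']

/-- Multilinear expansion: each choice r of one rank-one summand per factor contributes a product of
two determinants. It serves both for computing powers (rows of a matrix) and for positivity (Gram
factors). -/
theorem fundProd_sum {κ : Type*} [Fintype κ] (a b : Fin n → κ → Fin n → ℂ) :
    fundProd n n (fun i => ∑ j, Matrix.vecMulVec (a i j) (b i j)) =
      (∑ r : Fin n → κ, (Matrix.of fun i => a i (r i)).det * (Matrix.of fun i => b i (r i)).det) •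
        stdVol n := by
  rw [MultilinearMap.map_sum, Finset.sum_smul]
  refine Finset.sum_congr rfl fun r _ => ?_
  rw [fundProd_apply]
  simp only [fundForm_vecMulVec]
  rw [list_prod_ofFn_smul]
  change _ • pairProd _ _ = _
  rw [pairProd_hol_anti (fun i => a i (r i)) (fun i => b i (r i)), stdVol, smul_comm]

theorem matrix_eq_sum_vecMulVec (B : Matrix (Fin n) (Fin n) ℂ) :
    B = ∑ j, Matrix.vecMulVec (Pi.single j 1) (B j) := by
  ext i k
  simp [Matrix.sum_apply, Matrix.vecMulVec_apply, Pi.single_apply]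

/-- In the expansion over rows only bijective choices survive; in each of them the sign of the
permutation occurs twice and cancels, which leaves n! copies of det g. -/
theorem fundForm_pow (g : Matrix (Fin n) (Fin n) ℂ) :
    fundForm g ^ n = ((n.factorial : ℂ) * g.det) • stdVol n := by
  rw [← fundProd_const]
  conv_lhs => rw [matrix_eq_sum_vecMulVec g]
  rw [fundProd_sum (fun _ j => Pi.single j 1) (fun _ j => g j)]
  congr 1
  have : ∀ r : Fin n → Fin n, (Matrix.of fun i => (Pi.single (r i) 1 : Fin n → ℂ)).det *
      (Matrix.of fun i => g (r i)).det = if Function.Bijective r then g.det else 0 := by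
    intro r
    by_cases hr : Function.Bijective r
    · rw [if_pos hr]
      have e1 : (Matrix.of fun i => (Pi.single (r i) 1 : Fin n → ℂ)) =
          (1 : Matrix (Fin n) (Fin n) ℂ).submatrix (Equiv.ofBijective r hr) id := by
        ext i j; simp [Matrix.one_apply, Pi.single_apply, eq_comm]
      have e2 : (Matrix.of fun i => g (r i)) = g.submatrix (Equiv.ofBijective r hr) id := by
        ext i j; rfl
      rw [e1, e2, Matrix.det_permute, Matrix.det_permute, Matrix.det_one, mul_one, ← mul_assoc,
        ← Int.cast_mul, ← Units.val_mul, Int.units_mul_self]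
      simp
    · rw [if_neg hr]
      have : ¬ Function.Injective r := fun h => hr (Finite.injective_iff_bijective.1 h)
      simp only [Function.Injective] at this
      push Not at this
      obtain ⟨i, j, h, hij⟩ := this
      rw [Matrix.det_zero_of_row_eq (M := Matrix.of fun i => (Pi.single (r i) 1 : Fin n → ℂ)) hij
        (by ext k; simp [h]), zero_mul]
  rw [Finset.sum_congr rfl fun r _ => this r, ← Finset.sum_filter, Finset.sum_const, nsmul_eq_mul]
  congr 2
  rw [← Fintype.card_subtype]
  have e : {r : Fin n → Fin n // Function.Bijective r} ≃ Equiv.Perm (Fin n) :=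
    { toFun := fun r => Equiv.ofBijective r.1 r.2
      invFun := fun p => ⟨p, p.bijective⟩
      left_inv := fun r => rfl
      right_inv := fun p => by ext; rfl }
  rw [Fintype.card_congr e, Fintype.card_perm, Fintype.card_fin]

theorem ι_mul_ι_comm (a b : CoVec n) : ExteriorAlgebra.ι ℂ a * ExteriorAlgebra.ι ℂ b =
    -(ExteriorAlgebra.ι ℂ b * ExteriorAlgebra.ι ℂ a) :=
  eq_neg_of_add_eq_zero_left (ExteriorAlgebra.ι_add_mul_swap a b)

theorem commute_pair_ι (a b c : CoVec n) :
    Commute (ExteriorAlgebra.ι ℂ a * ExteriorAlgebra.ι ℂ b) (ExteriorAlgebra.ι ℂ c) := by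
  change _ * _ = _ * _
  rw [mul_assoc, ι_mul_ι_comm b c, mul_neg, ← mul_assoc, ι_mul_ι_comm a c]
  simp [mul_assoc]

theorem commute_fundForm_ι (B : Matrix (Fin n) (Fin n) ℂ) (c : CoVec n) :
    Commute (fundForm B) (ExteriorAlgebra.ι ℂ c) := by
  rw [fundForm_eq_sum]
  exact Commute.sum_left _ _ _ fun i _ => (commute_pair_ι _ _ _).smul_left _

theorem commute_fundForm (A B : Matrix (Fin n) (Fin n) ℂ) :
    Commute (fundForm A) (fundForm B) := by
  rw [fundForm_eq_sum B]
  exact Commute.sum_right _ _ _ fun i _ =>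
    ((commute_fundForm_ι A _).mul_right (commute_fundForm_ι A _)).smul_right _

theorem topCoeff_fundForm_pow (g : Matrix (Fin n) (Fin n) ℂ) :
    topCoeff n (fundForm g ^ n) = (n.factorial : ℂ) * g.det := by
  rw [fundForm_pow, map_smul, topCoeff_stdVol, smul_eq_mul, mul_one]

theorem posSemidef_eq_sum_vecMulVec {B : Matrix (Fin n) (Fin n) ℂ} (hB : B.PosSemidef) :
    ∃ R : Fin n → Fin n → ℂ, B = ∑ j, Matrix.vecMulVec (star (R j)) (R j) := by
  obtain ⟨R, hR⟩ : ∃ R : Matrix (Fin n) (Fin n) ℂ, B = R.conjTranspose * R := by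
    open scoped MatrixOrder in
    exact CStarAlgebra.nonneg_iff_eq_star_mul_self.1 (Matrix.nonneg_iff_posSemidef.2 hB)
  refine ⟨fun j => R j, ?_⟩
  ext i k
  rw [hR]
  simp [Matrix.mul_apply, Matrix.sum_apply, Matrix.vecMulVec_apply]

/-- The mixed discriminant of positive semidefinite matrices is nonnegative. -/
theorem topCoeff_fundProd_nonneg {B : Fin n → Matrix (Fin n) (Fin n) ℂ}
    (hB : ∀ i, (B i).PosSemidef) : 0 ≤ topCoeff n (fundProd n n B) := by
  choose R hR using fun i => posSemidef_eq_sum_vecMulVec (hB i)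
  rw [funext hR, fundProd_sum (fun i j => star (R i j)) (fun i j => R i j), map_smul,
    topCoeff_stdVol, smul_eq_mul, mul_one]
  refine Finset.sum_nonneg fun r _ => ?_
  have : (Matrix.of fun i => star (R i (r i))).det =
      star (Matrix.of fun i => R i (r i)).det := by
    rw [← Matrix.det_conjTranspose, ← Matrix.det_transpose]
    rfl
  rw [this]
  exact star_mul_self_nonneg _

/-- Both sides come from the derivative of n! det(W + tB) at t = 0: the binomial expansion of the
n-th power gives n times the left side, and Jacobi's formula gives the trace against the adjugate.
-/
theorem topCoeff_fundForm_pow_mul {W : Matrix (Fin n) (Fin n) ℂ} (hW : IsUnit W.det)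
    (B : Matrix (Fin n) (Fin n) ℂ) (hn : 0 < n) :
    topCoeff n (fundForm W ^ (n - 1) * fundForm B) =
      ((n - 1).factorial : ℂ) * (W.adjugate * B).trace := by
  let a : ℕ → ℂ := fun m =>
    topCoeff n (fundForm B ^ m * fundForm W ^ (n - m)) * (n.choose m : ℂ)
  have h1 : ∀ t : ℂ, (n.factorial : ℂ) * (W + t • B).det =
      ∑ m ∈ Finset.range (n + 1), t ^ m * a m := by
    intro t
    rw [← topCoeff_fundForm_pow, add_comm, fundForm_add, fundForm_smul,
      ((commute_fundForm B W).smul_left t).add_pow, map_sum]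
    refine Finset.sum_congr rfl fun m _ => ?_
    rw [smul_pow, smul_mul_assoc, smul_mul_assoc, map_smul, smul_eq_mul, ← nsmul_eq_mul',
      map_nsmul, nsmul_eq_mul]
    simp only [a]
    ring
  have h2 : HasDerivAt (fun t : ℂ => ∑ m ∈ Finset.range (n + 1), t ^ m * a m) (a 1) 0 := by
    have : HasDerivAt (fun t : ℂ => ∑ m ∈ Finset.range (n + 1), t ^ m * a m)
        (∑ m ∈ Finset.range (n + 1), ((m : ℂ) * 0 ^ (m - 1)) * a m) 0 := by
      refine HasDerivAt.fun_sum fun m _ => ?_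
      exact (hasDerivAt_pow m (0 : ℂ)).mul_const _
    convert this using 1
    rw [Finset.sum_eq_single 1]
    · simp
    · intro m _ hm
      rcases m with _ | _ | m
      · simp
      · exact absurd rfl hm
      · simp
    · intro h; simp at h; omega
  have h3 : HasDerivAt (fun t : ℂ => (n.factorial : ℂ) * (W + t • B).det)
      ((n.factorial : ℂ) * (W.adjugate * B).trace) 0 := by
    refine HasDerivAt.const_mul _ ?_
    -- Jacobi's formula follows from det(1 + tX) = 1 + t tr X + t² p(t) with a polynomial p, applied
    -- to X = W⁻¹B.
    have e : ∀ t : ℂ, (W + t • B).det = W.det * (1 + (W⁻¹ * B).trace * t +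
        ((1 + (Polynomial.X : Polynomial ℂ) • (W⁻¹ * B).map Polynomial.C).det).divX.divX.eval t
          * t ^ 2) := by
      intro t
      rw [← Matrix.det_one_add_smul, ← Matrix.det_mul, mul_add, mul_one, mul_smul_comm,
        Matrix.mul_nonsing_inv_cancel_left _ _ hW]
    rw [funext e]
    have e2 : (W.adjugate * B).trace = W.det * (W⁻¹ * B).trace := by
      rw [Matrix.inv_def, Matrix.smul_mul, Matrix.trace_smul, smul_eq_mul, ← mul_assoc,
        Ring.mul_inverse_cancel _ hW, one_mul]
    rw [e2]
    refine HasDerivAt.const_mul _ ?_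
    set p := (1 + (Polynomial.X : Polynomial ℂ) • (W⁻¹ * B).map Polynomial.C).det.divX.divX
    have h5 : HasDerivAt (fun t : ℂ => p.eval t * t ^ 2) 0 0 := by
      simpa using (p.hasDerivAt (0 : ℂ)).fun_mul (hasDerivAt_pow 2 (0 : ℂ))
    have h4 := (((hasDerivAt_id (0 : ℂ)).const_mul (W⁻¹ * B).trace).const_add 1).fun_add h5
    simpa using h4
  have h5 := h2.unique ((funext h1) ▸ h3)
  have h6 : a 1 = n * topCoeff n (fundForm W ^ (n - 1) * fundForm B) := by
    simp only [a, pow_one, Nat.choose_one_right]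
    rw [((commute_fundForm W B).pow_left (n - 1)).eq]; ring
  rw [h6] at h5
  have h7 : (n.factorial : ℂ) = n * ((n - 1).factorial : ℂ) := by
    rw [← Nat.mul_factorial_pred (by omega), Nat.cast_mul]
  rw [h7, mul_assoc] at h5
  exact mul_left_cancel₀ (Nat.cast_ne_zero.2 (by omega)) h5

/-! ### Unitary frames and the Hodge star operator -/

theorem coMetric_hol_anti (g : Matrix (Fin n) (Fin n) ℂ) (a b : Fin n → ℂ) :
    coMetric g (hol a) (anti b) = b ⬝ᵥ g⁻¹.mulVec a := by
  rw [coMetric, Matrix.toBilin'_apply']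
  simp only [dotProduct, Matrix.mulVec, hol, anti, LinearMap.coe_mk, AddHom.coe_mk]
  rw [← Equiv.sum_comp toLex, Fintype.sum_sum_type]
  simp only [ofLex_toLex, Sum.elim_inl, Sum.elim_inr, Pi.zero_apply, zero_mul,
    Finset.sum_const_zero, add_zero]
  simp_rw [← Equiv.sum_comp (toLex (α := Fin n ⊕ Fin n)), Fintype.sum_sum_type]
  simp only [Matrix.of_apply, ofLex_toLex, Sum.elim_inl, Sum.elim_inr, Pi.zero_apply, mul_zero,
    Finset.sum_const_zero, zero_add, Finset.mul_sum]
  rw [Finset.sum_comm]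
  exact Finset.sum_congr rfl fun j _ => Finset.sum_congr rfl fun i _ => by ring

theorem coMetric_anti_hol (g : Matrix (Fin n) (Fin n) ℂ) (a b : Fin n → ℂ) :
    coMetric g (anti b) (hol a) = b ⬝ᵥ g⁻¹.mulVec a := by
  rw [coMetric, Matrix.toBilin'_apply']
  simp only [dotProduct, Matrix.mulVec, hol, anti, LinearMap.coe_mk, AddHom.coe_mk]
  rw [← Equiv.sum_comp toLex, Fintype.sum_sum_type]
  simp only [ofLex_toLex, Sum.elim_inl, Sum.elim_inr, Pi.zero_apply, zero_mul,
    Finset.sum_const_zero, zero_add]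
  simp_rw [← Equiv.sum_comp (toLex (α := Fin n ⊕ Fin n)), Fintype.sum_sum_type]
  simp [Matrix.of_apply]

theorem coMetric_hol_hol (g : Matrix (Fin n) (Fin n) ℂ) (a b : Fin n → ℂ) :
    coMetric g (hol a) (hol b) = 0 := by
  rw [coMetric, Matrix.toBilin'_apply']
  simp only [dotProduct, Matrix.mulVec, hol, LinearMap.coe_mk, AddHom.coe_mk]
  rw [← Equiv.sum_comp toLex, Fintype.sum_sum_type]
  simp_rw [← Equiv.sum_comp (toLex (α := Fin n ⊕ Fin n)), Fintype.sum_sum_type]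
  simp [Matrix.of_apply]

theorem coMetric_anti_anti (g : Matrix (Fin n) (Fin n) ℂ) (a b : Fin n → ℂ) :
    coMetric g (anti a) (anti b) = 0 := by
  rw [coMetric, Matrix.toBilin'_apply']
  simp only [dotProduct, Matrix.mulVec, anti, LinearMap.coe_mk, AddHom.coe_mk]
  rw [← Equiv.sum_comp toLex, Fintype.sum_sum_type]
  simp_rw [← Equiv.sum_comp (toLex (α := Fin n ⊕ Fin n)), Fintype.sum_sum_type]
  simp [Matrix.of_apply]

/-- Factor g⁻¹ = S*S, complete the normalized vector Sξ to an orthonormal basis of ℂᵐ⁺¹, and pull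
the basis back by S⁻¹. -/
theorem exists_unitary_frame {m : ℕ} {g : Matrix (Fin (m + 1)) (Fin (m + 1)) ℂ} (hg : g.PosDef)
    {ξ : Fin (m + 1) → ℂ} (hξ : ξ ≠ 0) :
    ∃ (E : Fin (m + 1) → Fin (m + 1) → ℂ) (ρ : ℝ), 0 < ρ ∧ ξ = (ρ : ℂ) • E 0 ∧
      ∀ k l, star (E l) ⬝ᵥ g⁻¹.mulVec (E k) = if l = k then 1 else 0 := by
  obtain ⟨S, hS⟩ : ∃ S : Matrix (Fin (m + 1)) (Fin (m + 1)) ℂ, g⁻¹ = S.conjTranspose * S := by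
    open scoped MatrixOrder in
    exact CStarAlgebra.nonneg_iff_eq_star_mul_self.1
      (Matrix.nonneg_iff_posSemidef.2 hg.inv.posSemidef)
  have hSdet : IsUnit S.det := by
    have := hg.inv.det_pos.ne'
    rw [hS, Matrix.det_mul] at this
    exact (right_ne_zero_of_mul this).isUnit
  have hSξ : WithLp.toLp 2 (S.mulVec ξ) ≠ 0 := by
    intro h
    apply hξ
    have h' : S.mulVec ξ = 0 := by simpa using h
    have := congrArg (S⁻¹.mulVec) h'
    simpa [Matrix.mulVec_mulVec, Matrix.nonsing_inv_mul _ hSdet] using this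
  set w : EuclideanSpace ℂ (Fin (m + 1)) := WithLp.toLp 2 (S.mulVec ξ) with hw
  have hwn : 0 < ‖w‖ := norm_pos_iff.2 hSξ
  obtain ⟨u, hu⟩ := Orthonormal.exists_orthonormalBasis_extension_of_card_eq (𝕜 := ℂ)
    (E := EuclideanSpace ℂ (Fin (m + 1))) (ι := Fin (m + 1)) (by simp)
    (v := fun _ => ((‖w‖ : ℂ)⁻¹) • w) (s := {0}) (by
      constructor
      · intro i
        simp [norm_smul, hwn.ne']
      · intro i j hij
        exact absurd (Subsingleton.elim i j) hij)
  have hu0 := hu 0 (by simp)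
  refine ⟨fun k => S⁻¹.mulVec (u k), ‖w‖, hwn, ?_, ?_⟩
  · simp only [hu0, hw, WithLp.ofLp_smul, Matrix.mulVec_smul, Matrix.mulVec_mulVec,
      Matrix.nonsing_inv_mul _ hSdet, Matrix.one_mulVec, smul_smul]
    rw [← hw, mul_inv_cancel₀ (by exact_mod_cast hwn.ne'), one_smul]
  · intro k l
    have h1 : star (S⁻¹.mulVec (u l)) ⬝ᵥ g⁻¹.mulVec (S⁻¹.mulVec (u k)) =
        star (u l : Fin (m + 1) → ℂ) ⬝ᵥ (u k : Fin (m + 1) → ℂ) := by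
      rw [hS, ← Matrix.mulVec_mulVec, Matrix.mulVec_mulVec (u k) S, Matrix.mul_nonsing_inv _ hSdet,
        Matrix.one_mulVec, Matrix.dotProduct_mulVec, ← Matrix.star_mulVec, Matrix.mulVec_mulVec,
        Matrix.mul_nonsing_inv _ hSdet, Matrix.one_mulVec]
    rw [h1, ← orthonormal_iff_ite.1 u.orthonormal l k, EuclideanSpace.inner_eq_star_dotProduct,
      dotProduct_comm]

/-- `E` is a frame of covectors of type `(1,0)` that is unitary for the metric `g`. -/
def IsUnitaryFrame (g : Matrix (Fin n) (Fin n) ℂ) (E : Fin n → Fin n → ℂ) : Prop :=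
  ∀ k l, star (E l) ⬝ᵥ g⁻¹.mulVec (E k) = if l = k then 1 else 0

namespace IsUnitaryFrame

variable {g : Matrix (Fin n) (Fin n) ℂ} {E : Fin n → Fin n → ℂ}

theorem mul_eq_one (hE : IsUnitaryFrame g E) :
    (Matrix.of fun l => star (E l)) * (g⁻¹ * (Matrix.of E).transpose) = 1 := by
  ext l k
  rw [Matrix.one_apply, ← hE k l]
  rfl

theorem det_mul_det (hE : IsUnitaryFrame g E) (hg : IsUnit g.det) :
    (Matrix.of E).det * (Matrix.of fun l => star (E l)).det = g.det := by
  have := congrArg Matrix.det hE.mul_eq_one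
  rw [Matrix.det_mul, Matrix.det_mul, Matrix.det_transpose, Matrix.det_one] at this
  have h2 : g.det * g⁻¹.det = 1 := by
    rw [← Matrix.det_mul, Matrix.mul_nonsing_inv _ hg, Matrix.det_one]
  have h3 : g⁻¹.det ≠ 0 := right_ne_zero_of_mul_eq_one h2
  apply mul_right_cancel₀ h3
  rw [h2, ← this]; ring

theorem hol_expand (hE : IsUnitaryFrame g E) (a : Fin n → ℂ) :
    a = ∑ k, (star (E k) ⬝ᵥ g⁻¹.mulVec a) • E k := by
  have h := hE.mul_eq_one
  rw [← Matrix.mul_assoc, mul_eq_one_comm] at h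
  have h2 := congrArg (fun Q => Matrix.mulVec Q a) h
  simp only [Matrix.one_mulVec, ← Matrix.mulVec_mulVec] at h2
  conv_lhs => rw [← h2]
  ext i
  simp [Matrix.mulVec, dotProduct, Finset.sum_apply, mul_comm]

theorem anti_expand (hE : IsUnitaryFrame g E) (b : Fin n → ℂ) :
    b = ∑ k, (b ⬝ᵥ g⁻¹.mulVec (E k)) • star (E k) := by
  have h := hE.mul_eq_one
  rw [mul_eq_one_comm] at h
  have h2 := congrArg (fun Q => Matrix.vecMul b Q) h
  simp only [Matrix.vecMul_one, ← Matrix.vecMul_vecMul] at h2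
  conv_lhs => rw [← h2]
  ext i
  simp only [Matrix.vecMul, dotProduct, Finset.sum_apply, Pi.smul_apply, smul_eq_mul,
    Matrix.of_apply, Matrix.transpose_apply, Matrix.mulVec]
  refine Finset.sum_congr rfl fun k _ => ?_
  congr 1
  simp_rw [Finset.sum_mul, Finset.mul_sum]
  rw [Finset.sum_comm]
  exact Finset.sum_congr rfl fun _ _ => Finset.sum_congr rfl fun _ _ => by ring

end IsUnitaryFrame

theorem sum_interleave {A V : Type*} [AddCommMonoid A] {k : ℕ} (x y : Fin k → V) (f : V → A) :
    ∑ a, f (interleave x y a) = ∑ i, (f (x i) + f (y i)) := by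
  have : ∀ a, f (interleave x y a) =
      (fun p : Fin k × Fin 2 => f (if p.2 = 0 then x p.1 else y p.1)) (finProdFinEquiv.symm a) :=
    fun a => rfl
  rw [Finset.sum_congr rfl fun a _ => this a,
    Equiv.sum_comp finProdFinEquiv.symm (fun p : Fin k × Fin 2 => f (if p.2 = 0 then x p.1 else y p.1)),
    Fintype.sum_prod_type]
  simp [Fin.sum_univ_two]

/-- Even elements are central in the exterior algebra, so pairs can be moved freely through any
form. -/
theorem commute_pair (a b : CoVec n) (η : Form n) :
    Commute (ExteriorAlgebra.ι ℂ a * ExteriorAlgebra.ι ℂ b) η := by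
  induction η using ExteriorAlgebra.induction with
  | algebraMap r => exact (Algebra.commutes r _).symm
  | ι c => exact commute_pair_ι a b c
  | mul x y hx hy => exact hx.mul_right hy
  | add x y hx hy => exact hx.add_right hy

theorem ι_mul_pairProd_eq_zero {k : ℕ} (x y : Fin k → CoVec n) (v : CoVec n)
    (hv : ∃ i, v = x i ∨ v = y i) : ExteriorAlgebra.ι ℂ v * pairProd x y = 0 := by
  obtain ⟨i, hi⟩ := hv
  have key : ∃ a : Fin (k * 2), interleave x y a = v := by
    rcases hi with rfl | rfl
    · refine ⟨finProdFinEquiv (i, 0), ?_⟩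
      have := finProdFinEquiv.symm_apply_apply (i, (0 : Fin 2))
      rw [finProdFinEquiv_symm_apply, Prod.mk.injEq] at this
      simp [interleave, this.1, this.2]
    · refine ⟨finProdFinEquiv (i, 1), ?_⟩
      have := finProdFinEquiv.symm_apply_apply (i, (1 : Fin 2))
      rw [finProdFinEquiv_symm_apply, Prod.mk.injEq] at this
      simp [interleave, this.1, this.2]
  obtain ⟨a, ha⟩ := key
  have h := ExteriorAlgebra.ιMulti_succ_apply (R := ℂ) (Fin.cons v (interleave x y) : _ → CoVec n)
  rw [pairProd_eq_ιMulti]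
  rw [Fin.cons_zero] at h
  have h0 : ExteriorAlgebra.ιMulti ℂ (k * 2 + 1) (Fin.cons v (interleave x y) : _ → CoVec n) = 0 :=
    AlternatingMap.map_eq_zero_of_eq _ _ (i := 0) (j := a.succ) (by simp [ha])
      (Fin.succ_ne_zero a).symm
  rw [h0] at h
  exact h.symm

theorem commute_pairProd_ι {k : ℕ} (x y : Fin k → CoVec n) (v : CoVec n) :
    Commute (pairProd x y) (ExteriorAlgebra.ι ℂ v) := by
  refine (Commute.list_prod_right _ _ fun p hp => ?_).symm
  obtain ⟨i, rfl⟩ := (List.mem_ofFn' _ _).1 hp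
  exact (commute_pair _ _ _).symm

theorem pairProd_swap {k : ℕ} (x y : Fin k → CoVec n) :
    pairProd y x = ((-1 : ℂ) ^ k) • pairProd x y := by
  rw [pairProd, pairProd, ← list_prod_ofFn_smul]
  congr 2
  ext i
  rw [ι_mul_ι_comm, neg_one_smul]

/-- The factor x∧y is central, so it can be moved next to each covector in turn. In effect one
computes modulo x and y. -/
theorem mul_ofFn_prod_congr {k : ℕ} (x y : CoVec n) (v p : Fin k → CoVec n)
    (h : ∀ a, ExteriorAlgebra.ι ℂ x * ExteriorAlgebra.ι ℂ y * ExteriorAlgebra.ι ℂ (v a) =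
      ExteriorAlgebra.ι ℂ x * ExteriorAlgebra.ι ℂ y * ExteriorAlgebra.ι ℂ (p a)) :
    ExteriorAlgebra.ι ℂ x * ExteriorAlgebra.ι ℂ y * ExteriorAlgebra.ιMulti ℂ k v =
      ExteriorAlgebra.ι ℂ x * ExteriorAlgebra.ι ℂ y * ExteriorAlgebra.ιMulti ℂ k p := by
  simp only [ExteriorAlgebra.ιMulti_apply]
  induction k with
  | zero => simp
  | succ k ih =>
    simp only [List.ofFn_succ, List.prod_cons]
    rw [← mul_assoc, h 0, (commute_pair x y _).eq, mul_assoc,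
      ih (fun a => v a.succ) (fun a => p a.succ) (fun a => h a.succ), ← mul_assoc,
      ← (commute_pair x y _).eq, mul_assoc]

theorem formInner_ιMulti (g : Matrix (Fin n) (Fin n) ℂ) {k : ℕ} (u v : Fin k → CoVec n) :
    formInner g k (exteriorPower.ιMulti ℂ k u) (exteriorPower.ιMulti ℂ k v) =
      (Matrix.of fun i j => coMetric g (u j) (v i)).det := by
  rw [formInner, exteriorPower.map_apply_ιMulti, exteriorPower.pairingDual_ιMulti_ιMulti]
  rfl

/-- In a unitary frame `e₀, …, e_m`, the pairing with `e₁ ∧ ē₁ ∧ ⋯ ∧ e_m ∧ ē_m` is the wedge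
product with `e₀ ∧ ē₀`, up to a factor. -/
theorem mul_eq_formInner_smul {m : ℕ} {g : Matrix (Fin (m + 1)) (Fin (m + 1)) ℂ}
    {E : Fin (m + 1) → Fin (m + 1) → ℂ} (hE : IsUnitaryFrame g E)
    (η : ⋀[ℂ]^(m * 2) (CoVec (m + 1))) :
    ExteriorAlgebra.ι ℂ (hol (E 0)) * ExteriorAlgebra.ι ℂ (anti (star (E 0))) *
        (η : Form (m + 1)) =
      formInner g (m * 2) (exteriorPower.ιMulti ℂ (m * 2)
        (interleave (fun i : Fin m => hol (E i.succ)) (fun i => anti (star (E i.succ))))) η •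
      (ExteriorAlgebra.ι ℂ (hol (E 0)) * ExteriorAlgebra.ι ℂ (anti (star (E 0))) *
        pairProd (fun i : Fin m => anti (star (E i.succ))) (fun i => hol (E i.succ))) := by
  set x : CoVec (m + 1) := hol (E 0)
  set y : CoVec (m + 1) := anti (star (E 0))
  set u : Fin (m * 2) → CoVec (m + 1) :=
    interleave (fun i : Fin m => hol (E i.succ)) (fun i => anti (star (E i.succ))) with hu
  set t : Fin (m * 2) → CoVec (m + 1) :=
    interleave (fun i : Fin m => anti (star (E i.succ))) (fun i => hol (E i.succ)) with ht
  -- The metric pairs each eᵢ with ēᵢ and nothing else, so the family dual to u = (eᵢ, ēᵢ) is t =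
  -- (ēᵢ, eᵢ), with the two members of each pair exchanged. The components along e₀ and ē₀ are lost
  -- after multiplication by e₀∧ē₀.
  have hexp : ∀ v : CoVec (m + 1), ∃ a b : ℂ,
      v = a • x + b • y + ∑ k, coMetric g (u k) v • t k := by
    intro v
    obtain ⟨p, q, rfl⟩ : ∃ p q, v = hol p + anti q := by
      refine ⟨fun i => v (Sum.inlₗ i), fun i => v (Sum.inrₗ i), ?_⟩
      funext s
      rcases hs : ofLex s with j | j
      · obtain rfl : s = Sum.inlₗ j := hs
        simp [hol, anti]
      · obtain rfl : s = Sum.inrₗ j := hs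
        simp [hol, anti]
    refine ⟨star (E 0) ⬝ᵥ g⁻¹.mulVec p, q ⬝ᵥ g⁻¹.mulVec (E 0), ?_⟩
    have h1 : ∑ k, coMetric g (u k) (hol p + anti q) • t k =
        ∑ i : Fin m, ((q ⬝ᵥ g⁻¹.mulVec (E i.succ)) • anti (star (E i.succ)) +
          (star (E i.succ) ⬝ᵥ g⁻¹.mulVec p) • hol (E i.succ)) := by
      have : ∀ k, coMetric g (u k) (hol p + anti q) • t k =
          (fun r : CoVec (m + 1) × CoVec (m + 1) => coMetric g r.1 (hol p + anti q) • r.2)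
            (interleave
              (fun i : Fin m => ((hol (E i.succ) : CoVec (m + 1)),
                (anti (star (E i.succ)) : CoVec (m + 1))))
              (fun i => (anti (star (E i.succ)), hol (E i.succ))) k) := by
        intro k
        by_cases hk : k.modNat = 0 <;> simp [u, t, interleave, hk]
      rw [Finset.sum_congr rfl fun k _ => this k]
      refine (sum_interleave _ _ (fun r : CoVec (m + 1) × CoVec (m + 1) =>
        coMetric g r.1 (hol p + anti q) • r.2)).trans ?_
      refine Finset.sum_congr rfl fun i _ => ?_
      simp [coMetric_hol_anti, coMetric_hol_hol, coMetric_anti_anti, coMetric_anti_hol]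
    rw [h1, Finset.sum_add_distrib]
    conv_lhs => rw [hE.hol_expand p, hE.anti_expand q]
    rw [map_sum, map_sum, Fin.sum_univ_succ, Fin.sum_univ_succ]
    simp only [map_smul]
    abel
  have hred : ∀ v : CoVec (m + 1),
      ExteriorAlgebra.ι ℂ x * ExteriorAlgebra.ι ℂ y * ExteriorAlgebra.ι ℂ v =
      ExteriorAlgebra.ι ℂ x * ExteriorAlgebra.ι ℂ y *
        ExteriorAlgebra.ι ℂ (∑ k, coMetric g (u k) v • t k) := by
    intro v
    obtain ⟨a, b, h⟩ := hexp v
    have hx : ExteriorAlgebra.ι ℂ x * ExteriorAlgebra.ι ℂ y * ExteriorAlgebra.ι ℂ x = 0 := by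
      rw [(commute_pair x y _).eq, ← mul_assoc, ExteriorAlgebra.ι_sq_zero, zero_mul]
    have hy : ExteriorAlgebra.ι ℂ x * ExteriorAlgebra.ι ℂ y * ExteriorAlgebra.ι ℂ y = 0 := by
      rw [mul_assoc, ExteriorAlgebra.ι_sq_zero, mul_zero]
    conv_lhs => rw [h]
    rw [map_add, map_add, mul_add, mul_add, map_smul, map_smul, mul_smul_comm, mul_smul_comm,
      hx, hy, smul_zero, smul_zero, zero_add, zero_add]
  let L1 : ⋀[ℂ]^(m * 2) (CoVec (m + 1)) →ₗ[ℂ] Form (m + 1) :=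
    LinearMap.mulLeft ℂ (ExteriorAlgebra.ι ℂ x * ExteriorAlgebra.ι ℂ y) ∘ₗ Submodule.subtype _
  let L2 : ⋀[ℂ]^(m * 2) (CoVec (m + 1)) →ₗ[ℂ] Form (m + 1) :=
    (exteriorPower.pairingDual ℂ _ _ (exteriorPower.map _ (coMetric g)
      (exteriorPower.ιMulti ℂ (m * 2) u))).smulRight
      (ExteriorAlgebra.ι ℂ x * ExteriorAlgebra.ι ℂ y *
        pairProd (fun i : Fin m => anti (star (E i.succ))) (fun i => hol (E i.succ)))
  suffices L1 = L2 from congrArg (fun L => L η) this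
  apply exteriorPower.linearMap_ext
  ext1 v
  change ExteriorAlgebra.ι ℂ x * ExteriorAlgebra.ι ℂ y * ExteriorAlgebra.ιMulti ℂ (m * 2) v =
    formInner g (m * 2) (exteriorPower.ιMulti ℂ (m * 2) u) (exteriorPower.ιMulti ℂ (m * 2) v) • _
  rw [formInner_ιMulti, mul_ofFn_prod_congr x y v (fun a => ∑ k, coMetric g (u k) (v a) • t k)
    fun a => hred (v a), pairProd_eq_ιMulti, ← mul_smul_comm]
  congr 1
  have := alternatingMap_pi_eq_det_smul ((ExteriorAlgebra.ιMulti ℂ (m * 2)).compLinearMap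
    (Fintype.linearCombination ℂ t)) (fun a k => coMetric g (u k) (v a))
  simp only [AlternatingMap.compLinearMap_apply, Function.comp_def,
    Fintype.linearCombination_apply] at this
  rw [this]
  congr 2
  funext i
  simp [Pi.single_apply, ht]

/-- The product over the indices i ≥ 1 annihilates every frame covector except e₀ and ē₀, so only
one diagonal entry of B in the frame survives: its value on the vector dual to e₀. -/
theorem pairProd_mul_fundForm {m : ℕ} {g : Matrix (Fin (m + 1)) (Fin (m + 1)) ℂ}
    {E : Fin (m + 1) → Fin (m + 1) → ℂ} (hE : IsUnitaryFrame g E) (hg : g.IsHermitian)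
    (B : Matrix (Fin (m + 1)) (Fin (m + 1)) ℂ) :
    pairProd (fun i : Fin m => hol (E i.succ)) (fun i => anti (star (E i.succ))) * fundForm B =
      (Complex.I * (star (g⁻¹.mulVec (E 0)) ⬝ᵥ B.mulVec (g⁻¹.mulVec (E 0)))) •
        pairProd (fun i => hol (E i)) (fun i => anti (star (E i))) := by
  set U := pairProd (fun i : Fin m => hol (E i.succ)) (fun i => anti (star (E i.succ)))
  have hfull : pairProd (fun i => hol (E i)) (fun i => anti (star (E i))) =
      ExteriorAlgebra.ι ℂ (hol (E 0)) * ExteriorAlgebra.ι ℂ (anti (star (E 0))) * U := by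
    simp [pairProd, U]
  have hUh : ∀ a : Fin (m + 1) → ℂ, U * ExteriorAlgebra.ι ℂ (hol a) =
      (star (E 0) ⬝ᵥ g⁻¹.mulVec a) • (U * ExteriorAlgebra.ι ℂ (hol (E 0))) := by
    intro a
    conv_lhs => rw [hE.hol_expand a]
    rw [map_sum, map_sum, Finset.mul_sum, Fin.sum_univ_succ, Finset.sum_eq_zero, add_zero,
      map_smul, map_smul, mul_smul_comm]
    intro i _
    rw [map_smul, map_smul, mul_smul_comm, (commute_pairProd_ι _ _ _).eq,
      ι_mul_pairProd_eq_zero (fun i : Fin m => hol (E i.succ)) (fun i => anti (star (E i.succ))) _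
        ⟨i, Or.inl rfl⟩, smul_zero]
  have hUa : ∀ b : Fin (m + 1) → ℂ, U * ExteriorAlgebra.ι ℂ (anti b) =
      (b ⬝ᵥ g⁻¹.mulVec (E 0)) • (U * ExteriorAlgebra.ι ℂ (anti (star (E 0)))) := by
    intro b
    conv_lhs => rw [hE.anti_expand b]
    rw [map_sum, map_sum, Finset.mul_sum, Fin.sum_univ_succ, Finset.sum_eq_zero, add_zero,
      map_smul, map_smul, mul_smul_comm]
    intro i _
    rw [map_smul, map_smul, mul_smul_comm, (commute_pairProd_ι _ _ _).eq,
      ι_mul_pairProd_eq_zero (fun i : Fin m => hol (E i.succ)) (fun i => anti (star (E i.succ))) _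
        ⟨i, Or.inr rfl⟩, smul_zero]
  have hpair : ∀ a b : Fin (m + 1) → ℂ,
      U * (ExteriorAlgebra.ι ℂ (hol a) * ExteriorAlgebra.ι ℂ (anti b)) =
      ((star (E 0) ⬝ᵥ g⁻¹.mulVec a) * (b ⬝ᵥ g⁻¹.mulVec (E 0))) •
        pairProd (fun i => hol (E i)) (fun i => anti (star (E i))) := by
    intro a b
    rw [← mul_assoc, hUh, smul_mul_assoc, mul_assoc, ι_mul_ι_comm, mul_neg, ← mul_assoc, hUa,
      smul_mul_assoc, mul_assoc, ι_mul_ι_comm, mul_neg, smul_neg, smul_neg, smul_neg, neg_neg, smul_smul, hfull,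
      (commute_pair _ _ U).eq]
  conv_lhs => rw [matrix_eq_sum_vecMulVec B]
  rw [← fundFormLin_apply, map_sum, Finset.mul_sum]
  simp only [fundFormLin_apply, fundForm_vecMulVec, mul_smul_comm, hpair, smul_smul]
  rw [← Finset.sum_smul, ← Finset.mul_sum]
  congr 2
  rw [dotProduct]
  refine Finset.sum_congr rfl fun j _ => ?_
  rw [Matrix.star_mulVec, hg.inv.eq, Matrix.mulVec_single_one]
  rfl

/-- Scale ξ to the first covector e₀ of a unitary frame and test the Hodge relation with ψ =
e₁∧ē₁∧⋯∧e_m∧ē_m. Then ψ∧F(B) sees a diagonal entry β ≤ 0 of B, while ⟨ψ, η⟩ is, up to a factor, also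
the coefficient of e₀∧ē₀∧η (`mul_eq_formInner_smul`). Thus η∧F(ξξ*) is a nonnegative multiple of β
det g once the powers of √-1 are collected. -/
theorem topCoeff_mul_fundForm_nonpos_of_isHodgeStar {k : ℕ} (hn : 2 ≤ n) (hk : k = 2 * n - 2)
    {g B : Matrix (Fin n) (Fin n) ℂ} {η : Form n} (hg : g.PosDef)
    (hη : IsHodgeStar g k η (fundForm B)) (hB : (-B).PosSemidef) (ξ : Fin n → ℂ) :
    topCoeff n (η * fundForm (Matrix.vecMulVec ξ (star ξ))) ≤ 0 := by
  obtain ⟨m, rfl⟩ : ∃ m, n = m + 1 := ⟨n - 1, by omega⟩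
  obtain rfl : k = m * 2 := by omega
  by_cases hξ : ξ = 0
  · have : fundForm (Matrix.vecMulVec ξ (star ξ)) = 0 := by
      rw [fundForm_vecMulVec, hξ]; simp
    rw [this]; simp
  obtain ⟨E, ρ, hρ, hξE, hE⟩ := exists_unitary_frame hg hξ
  replace hE : IsUnitaryFrame g E := hE
  obtain ⟨_, hηk, hψ⟩ := hη
  have hdet : g.det ≠ 0 := hg.det_pos.ne'
  have h1 := mul_eq_formInner_smul hE ⟨η, hηk⟩
  have h2 := hψ (exteriorPower.ιMulti ℂ (m * 2)
    (interleave (fun i : Fin m => hol (E i.succ)) (fun i => anti (star (E i.succ)))))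
  set F := formInner g (m * 2) (exteriorPower.ιMulti ℂ (m * 2)
    (interleave (fun i : Fin m => hol (E i.succ)) (fun i => anti (star (E i.succ))))) ⟨η, hηk⟩
  rw [exteriorPower.ιMulti_apply_coe, ← pairProd_eq_ιMulti,
    pairProd_mul_fundForm hE hg.isHermitian] at h2
  have hfull : pairProd (fun i => hol (E i)) (fun i => anti (star (E i))) =
      g.det • stdPairs (m + 1) := by
    rw [pairProd_hol_anti E (fun i => star (E i)), hE.det_mul_det hdet.isUnit]
  have hvol : volForm g = (g.det * Complex.I ^ (m + 1)) • stdPairs (m + 1) := by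
    rw [volForm, fundForm_pow, smul_smul, ← mul_assoc, inv_mul_cancel₀
      (Nat.cast_ne_zero.2 (Nat.factorial_ne_zero _)), one_mul, stdVol, smul_smul]
  set β := star (g⁻¹.mulVec (E 0)) ⬝ᵥ B.mulVec (g⁻¹.mulVec (E 0))
  have hβ : β ≤ 0 := by
    have := hB.dotProduct_mulVec_nonneg (g⁻¹.mulVec (E 0))
    rw [Matrix.neg_mulVec, dotProduct_neg] at this
    exact neg_nonneg.1 this
  rw [hfull, hvol, smul_smul, smul_smul] at h2
  have h3 := smul_left_injective ℂ (stdPairs_ne_zero (m + 1)) h2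
  have h4 : Complex.I * β = F * Complex.I ^ (m + 1) := by
    apply mul_right_cancel₀ hdet
    linear_combination h3
  have h5 : ExteriorAlgebra.ι ℂ (hol (E 0)) * ExteriorAlgebra.ι ℂ (anti (star (E 0))) *
        pairProd (fun i : Fin m => anti (star (E i.succ))) (fun i => hol (E i.succ)) =
      ((-1 : ℂ) ^ m * g.det) • stdPairs (m + 1) := by
    rw [pairProd_swap, mul_smul_comm, mul_smul, ← hfull]
    simp [pairProd]
  have h6 : topCoeff (m + 1) (stdPairs (m + 1)) * Complex.I ^ (m + 1) = 1 := by
    rw [← topCoeff_stdVol (n := m + 1), stdVol, map_smul, smul_eq_mul, mul_comm]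
  have h7 : η * fundForm (Matrix.vecMulVec ξ (star ξ)) =
      (((ρ ^ 2 : ℝ) : ℂ) * (Complex.I * (F * ((-1 : ℂ) ^ m * g.det)))) • stdPairs (m + 1) := by
    have : Matrix.vecMulVec ξ (star ξ) =
        ((ρ ^ 2 : ℝ) : ℂ) • Matrix.vecMulVec (E 0) (star (E 0)) := by
      rw [hξE]
      ext i j
      simp [Matrix.vecMulVec_apply]
      ring
    rw [this, fundForm_smul, fundForm_vecMulVec, mul_smul_comm, mul_smul_comm,
      ← (commute_pair _ _ η).eq, h1, h5, smul_smul, smul_smul, smul_smul]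
    ring_nf
  have h8 : topCoeff (m + 1) (η * fundForm (Matrix.vecMulVec ξ (star ξ))) =
      ((ρ ^ 2 : ℝ) : ℂ) * (β * g.det) := by
    rw [h7, map_smul, smul_eq_mul]
    -- One factor I^(m+1) normalizes `topCoeff` of `stdPairs` to 1, the other turns F into Iβ.
    apply mul_right_cancel₀ (pow_ne_zero (m + 1) Complex.I_ne_zero)
    apply mul_right_cancel₀ (pow_ne_zero (m + 1) Complex.I_ne_zero)
    have e1 : (Complex.I ^ (m + 1)) * (Complex.I ^ (m + 1)) = -(-1 : ℂ) ^ m := by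
      rw [← mul_pow, Complex.I_mul_I, pow_succ]; ring
    calc _ = ((ρ ^ 2 : ℝ) : ℂ) * Complex.I * ((-1 : ℂ) ^ m * g.det) *
          (topCoeff (m + 1) (stdPairs (m + 1)) * Complex.I ^ (m + 1)) *
          (F * Complex.I ^ (m + 1)) := by ring
      _ = _ := by
        rw [h6, ← h4, mul_assoc _ (Complex.I ^ (m + 1)) (Complex.I ^ (m + 1)), e1]
        linear_combination ((ρ ^ 2 : ℝ) : ℂ) * (-1) ^ m * g.det * β * Complex.I_mul_I
  rw [h8]
  have h9 : β * g.det ≤ 0 := mul_nonpos_of_nonpos_of_nonneg hβ hg.det_pos.le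
  exact mul_nonpos_of_nonneg_of_nonpos (by exact_mod_cast sq_nonneg ρ) h9

/-! ### Calculus of the Wirtinger operators -/

section Wirtinger

variable {f f' : (Fin n → ℂ) → ℂ} {z : Fin n → ℂ} {U : Set (Fin n → ℂ)}

theorem wirtinger_congr (k : Fin n) (h : f =ᶠ[nhds z] f') : wirtinger k f z = wirtinger k f' z := by
  rw [wirtinger, wirtinger, h.fderiv_eq]

theorem wirtinger_add (k : Fin n) (hf : DifferentiableAt ℝ f z) (hf' : DifferentiableAt ℝ f' z) :
    wirtinger k (fun w => f w + f' w) z = wirtinger k f z + wirtinger k f' z := by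
  simp only [wirtinger, fderiv_fun_add hf hf', add_apply]; ring

theorem wirtinger_mul (k : Fin n) (hf : DifferentiableAt ℝ f z) (hf' : DifferentiableAt ℝ f' z) :
    wirtinger k (fun w => f w * f' w) z = f z * wirtinger k f' z + wirtinger k f z * f' z := by
  simp only [wirtinger, fderiv_fun_mul hf hf', add_apply,
    smul_apply, smul_eq_mul]; ring

theorem wirtingerBar_mul (k : Fin n) (hf : DifferentiableAt ℝ f z)
    (hf' : DifferentiableAt ℝ f' z) :
    wirtingerBar k (fun w => f w * f' w) z =
      f z * wirtingerBar k f' z + wirtingerBar k f z * f' z := by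
  simp only [wirtingerBar, fderiv_fun_mul hf hf', add_apply,
    smul_apply, smul_eq_mul]; ring

theorem wirtinger_sum_mul_const {ι : Type*} (s : Finset ι) (k : Fin n)
    (F : ι → (Fin n → ℂ) → ℂ) (c : ι → ℂ) (hF : ∀ i ∈ s, DifferentiableAt ℝ (F i) z) :
    wirtinger k (fun w => ∑ i ∈ s, F i w * c i) z = ∑ i ∈ s, wirtinger k (F i) z * c i := by
  have : fderiv ℝ (fun w => ∑ i ∈ s, F i w * c i) z = ∑ i ∈ s, c i • fderiv ℝ (F i) z := by
    rw [fderiv_fun_sum fun i hi => (hF i hi).mul_const (c i)]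
    exact Finset.sum_congr rfl fun i hi => fderiv_mul_const (hF i hi) _
  simp only [wirtinger, this, sum_apply, smul_apply,
    smul_eq_mul, Finset.mul_sum, ← Finset.sum_sub_distrib]
  exact Finset.sum_congr rfl fun i _ => by ring

theorem wirtingerBar_sum_mul_const {ι : Type*} (s : Finset ι) (k : Fin n)
    (F : ι → (Fin n → ℂ) → ℂ) (c : ι → ℂ) (hF : ∀ i ∈ s, DifferentiableAt ℝ (F i) z) :
    wirtingerBar k (fun w => ∑ i ∈ s, F i w * c i) z =
      ∑ i ∈ s, wirtingerBar k (F i) z * c i := by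
  have : fderiv ℝ (fun w => ∑ i ∈ s, F i w * c i) z = ∑ i ∈ s, c i • fderiv ℝ (F i) z := by
    rw [fderiv_fun_sum fun i hi => (hF i hi).mul_const (c i)]
    exact Finset.sum_congr rfl fun i hi => fderiv_mul_const (hF i hi) _
  simp only [wirtingerBar, this, sum_apply, smul_apply,
    smul_eq_mul, Finset.mul_sum, ← Finset.sum_add_distrib]
  exact Finset.sum_congr rfl fun i _ => by ring

theorem contDiffOn_fderiv_apply {F : Type*} [NormedAddCommGroup F] [NormedSpace ℝ F]
    {E : Type*} [NormedAddCommGroup E] [NormedSpace ℝ E] {f : E → F} {U : Set E}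
    (hU : IsOpen U) (hf : ContDiffOn ℝ ∞ f U) (v : E) :
    ContDiffOn ℝ ∞ (fun w => fderiv ℝ f w v) U :=
  (hf.fderiv_of_isOpen hU (m := ∞) (by simp)).clm_apply contDiffOn_const

theorem ContDiffOn.wirtinger (hU : IsOpen U) (hf : ContDiffOn ℝ ∞ f U) (k : Fin n) :
    ContDiffOn ℝ ∞ (wirtinger k f) U :=
  contDiffOn_const.mul ((contDiffOn_fderiv_apply hU hf _).sub
    (contDiffOn_const.mul (contDiffOn_fderiv_apply hU hf _)))

theorem ContDiffOn.wirtingerBar (hU : IsOpen U) (hf : ContDiffOn ℝ ∞ f U) (k : Fin n) :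
    ContDiffOn ℝ ∞ (wirtingerBar k f) U :=
  contDiffOn_const.mul ((contDiffOn_fderiv_apply hU hf _).add
    (contDiffOn_const.mul (contDiffOn_fderiv_apply hU hf _)))

theorem ContDiffOn.differentiableAt_of_isOpen {F : Type*} [NormedAddCommGroup F] [NormedSpace ℝ F]
    {f : (Fin n → ℂ) → F} (hU : IsOpen U) (hf : ContDiffOn ℝ ∞ f U) (hz : z ∈ U) :
    DifferentiableAt ℝ f z :=
  (hf.contDiffAt (hU.mem_nhds hz)).differentiableAt (by simp)

theorem wirtinger_wirtingerBar_mul (hU : IsOpen U) (hf : ContDiffOn ℝ ∞ f U)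
    (hf' : ContDiffOn ℝ ∞ f' U) (hz : z ∈ U) (l k : Fin n) :
    wirtinger l (wirtingerBar k fun w => f w * f' w) z =
      wirtinger l (wirtingerBar k f) z * f' z + wirtingerBar k f z * wirtinger l f' z +
        wirtinger l f z * wirtingerBar k f' z + f z * wirtinger l (wirtingerBar k f') z := by
  have d : ∀ {F : (Fin n → ℂ) → ℂ}, ContDiffOn ℝ ∞ F U → ∀ {w}, w ∈ U → DifferentiableAt ℝ F w :=
    fun h _ hw => ContDiffOn.differentiableAt_of_isOpen hU h hw
  have h1 : (wirtingerBar k fun w => f w * f' w) =ᶠ[nhds z]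
      fun w => f w * wirtingerBar k f' w + wirtingerBar k f w * f' w := by
    filter_upwards [hU.mem_nhds hz] with w hw
    exact wirtingerBar_mul k (d hf hw) (d hf' hw)
  have b := ContDiffOn.wirtingerBar hU hf k
  have b' := ContDiffOn.wirtingerBar hU hf' k
  rw [wirtinger_congr l h1, wirtinger_add l (d (hf.mul b') hz) (d (b.mul hf') hz),
    wirtinger_mul l (d hf hz) (d b' hz), wirtinger_mul l (d b hz) (d hf' hz)]
  ring

end Wirtinger

/-! ### The operators `∂` and `∂̄` paired with linear functionals -/

section Operators

variable {η : (Fin n → ℂ) → Form n} {z : Fin n → ℂ} {U : Set (Fin n → ℂ)}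

theorem functional_eq_sum (ℓ : Form n →ₗ[ℂ] ℂ) (x : Form n) :
    ℓ x = ∑ S, (formBasis n).repr x S * ℓ (formBasis n S) := by
  conv_lhs => rw [← (formBasis n).sum_repr x]
  simp only [map_sum, map_smul, smul_eq_mul]

theorem functional_coeffwise_wirtinger (ℓ : Form n →ₗ[ℂ] ℂ) (k : Fin n)
    (hη : ∀ ℓ : Form n →ₗ[ℂ] ℂ, DifferentiableAt ℝ (fun w => ℓ (η w)) z) :
    ℓ (coeffwise (wirtinger k) η z) = wirtinger k (fun w => ℓ (η w)) z := by
  rw [funext fun w => functional_eq_sum ℓ (η w), wirtinger_sum_mul_const _ _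
    (fun S w => (formBasis n).repr (η w) S) _ fun S _ => hη ((formBasis n).coord S)]
  simp [coeffwise]

theorem functional_coeffwise_wirtingerBar (ℓ : Form n →ₗ[ℂ] ℂ) (k : Fin n)
    (hη : ∀ ℓ : Form n →ₗ[ℂ] ℂ, DifferentiableAt ℝ (fun w => ℓ (η w)) z) :
    ℓ (coeffwise (wirtingerBar k) η z) = wirtingerBar k (fun w => ℓ (η w)) z := by
  rw [funext fun w => functional_eq_sum ℓ (η w), wirtingerBar_sum_mul_const _ _
    (fun S w => (formBasis n).repr (η w) S) _ fun S _ => hη ((formBasis n).coord S)]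
  simp [coeffwise]

/-- A form-valued function is smooth on `U` if all its linear functionals are. -/
def SmoothForm (η : (Fin n → ℂ) → Form n) (U : Set (Fin n → ℂ)) : Prop :=
  ∀ ℓ : Form n →ₗ[ℂ] ℂ, ContDiffOn ℝ ∞ (fun w => ℓ (η w)) U

theorem functional_delBar (hU : IsOpen U) (hη : SmoothForm η U) (ℓ : Form n →ₗ[ℂ] ℂ)
    (hz : z ∈ U) : ℓ (delBar η z) = ∑ k, wirtingerBar k (fun w => ℓ (dzbar k * η w)) z := by
  rw [delBar, map_sum]
  exact Finset.sum_congr rfl fun k _ =>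
    functional_coeffwise_wirtingerBar (ℓ ∘ₗ LinearMap.mulLeft ℂ (dzbar k)) k
      fun ℓ => ContDiffOn.differentiableAt_of_isOpen hU (hη ℓ) hz

theorem SmoothForm.delBar (hU : IsOpen U) (hη : SmoothForm η U) : SmoothForm (delBar η) U :=
  fun ℓ => (ContDiffOn.sum fun k _ => ContDiffOn.wirtingerBar hU
    (hη (ℓ ∘ₗ LinearMap.mulLeft ℂ (dzbar k))) k).congr fun w hw => functional_delBar hU hη ℓ hw

/-- A linear functional commutes with coefficientwise differentiation, so second derivatives of a
form become second derivatives of scalar functions. All further calculus is done on scalars. -/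
theorem functional_iDelDelBar (hU : IsOpen U) (hη : SmoothForm η U) (ℓ : Form n →ₗ[ℂ] ℂ)
    (hz : z ∈ U) : ℓ (iDelDelBar η z) = ∑ l, ∑ k,
      wirtinger l (wirtingerBar k fun w => ℓ ((Complex.I • (dz l * dzbar k)) * η w)) z := by
  rw [iDelDelBar, map_smul, ← LinearMap.smul_apply, del, map_sum]
  refine Finset.sum_congr rfl fun l _ => ?_
  rw [show (Complex.I • ℓ) (dz l * coeffwise (wirtinger l) (FormTypeCY.delBar η) z) =
    ((Complex.I • ℓ) ∘ₗ LinearMap.mulLeft ℂ (dz l)) (coeffwise (wirtinger l) _ z) from rfl,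
    functional_coeffwise_wirtinger _ _
      fun ℓ => ContDiffOn.differentiableAt_of_isOpen hU (hη.delBar hU ℓ) hz]
  have h1 : (fun w => ((Complex.I • ℓ) ∘ₗ LinearMap.mulLeft ℂ (dz l)) (FormTypeCY.delBar η w))
      =ᶠ[nhds z] fun w => ∑ k,
        wirtingerBar k (fun w => ℓ ((Complex.I • (dz l * dzbar k)) * η w)) w * 1 := by
    filter_upwards [hU.mem_nhds hz] with w hw
    rw [functional_delBar hU hη _ hw]
    simp [mul_assoc]
  rw [wirtinger_congr _ h1, wirtinger_sum_mul_const]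
  · simp
  · intro k _
    exact ContDiffOn.differentiableAt_of_isOpen hU (ContDiffOn.wirtingerBar hU
      (hη (ℓ ∘ₗ LinearMap.mulLeft ℂ (Complex.I • (dz l * dzbar k)))) k) hz

theorem SmoothForm.const_mul (hη : SmoothForm η U) (x : Form n) :
    SmoothForm (fun w => x * η w) U := fun ℓ => hη (ℓ ∘ₗ LinearMap.mulLeft ℂ x)

theorem SmoothForm.smul {u : (Fin n → ℂ) → ℂ} (hu : ContDiffOn ℝ ∞ u U) (hη : SmoothForm η U) :
    SmoothForm (fun w => u w • η w) U := fun ℓ => by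
  simpa using hu.mul (hη ℓ)

theorem SmoothForm.fundForm_mul {g : (Fin n → ℂ) → Matrix (Fin n) (Fin n) ℂ}
    (hg : ∀ i j, ContDiffOn ℝ ∞ (fun z => g z i j) U) (hη : SmoothForm η U) :
    SmoothForm (fun w => fundForm (g w) * η w) U := fun ℓ => by
  simp only [fundForm, Finset.sum_mul, map_sum, smul_mul_assoc, map_smul, smul_eq_mul]
  exact ContDiffOn.sum fun i _ => ContDiffOn.sum fun j _ =>
    (contDiffOn_const.mul (hg i j)).mul (hη.const_mul (dz i * dzbar j) ℓ)

theorem smoothForm_fundForm_pow {g : (Fin n → ℂ) → Matrix (Fin n) (Fin n) ℂ}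
    (hg : ∀ i j, ContDiffOn ℝ ∞ (fun z => g z i j) U) (m : ℕ) :
    SmoothForm (fun w => fundForm (g w) ^ m) U := by
  induction m with
  | zero => intro ℓ; simpa using contDiffOn_const
  | succ m ih => simpa only [pow_succ'] using SmoothForm.fundForm_mul hg ih

end Operators

/-- The mixed discriminant `F(X) ∧ F(g)^{n-2} ∧ F(B)`, relative to the standard volume form. -/
def mixDisc (g X B : Matrix (Fin n) (Fin n) ℂ) : ℂ :=
  topCoeff n (fundForm X * fundForm g ^ (n - 2) * fundForm B)

/-! ### Wedging `√-1 ∂∂̄(u α^{n-2})` with a (1,1)-form -/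

section MixDisc

variable {U : Set (Fin n → ℂ)} {g : (Fin n → ℂ) → Matrix (Fin n) (Fin n) ℂ}

theorem fundForm_single (l k : Fin n) :
    fundForm (Matrix.single l k (1 : ℂ)) = Complex.I • (dz l * dzbar k) := by
  rw [fundForm, Finset.sum_eq_single l, Finset.sum_eq_single k]
  · simp
  · intro j _ hj; simp [hj.symm]
  · simp
  · intro i _ hi; simp [hi.symm]
  · simp

theorem contDiffOn_mixDisc (hg : ∀ i j, ContDiffOn ℝ ∞ (fun z => g z i j) U)
    (X B : Matrix (Fin n) (Fin n) ℂ) : ContDiffOn ℝ ∞ (fun w => mixDisc (g w) X B) U :=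
  (smoothForm_fundForm_pow hg (n - 2)).const_mul (fundForm X)
    (topCoeff n ∘ₗ LinearMap.mulRight ℂ (fundForm B))

theorem topCoeff_iDelDelBar_smul_mul (hU : IsOpen U)
    (hg : ∀ i j, ContDiffOn ℝ ∞ (fun z => g z i j) U) {u : (Fin n → ℂ) → ℂ}
    (hu : ContDiffOn ℝ ∞ u U) (B : Matrix (Fin n) (Fin n) ℂ) {z : Fin n → ℂ} (hz : z ∈ U) :
    topCoeff n (iDelDelBar (fun w => u w • fundForm (g w) ^ (n - 2)) z * fundForm B) =
      ∑ l, ∑ k, wirtinger l (wirtingerBar k fun w =>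
        u w * mixDisc (g w) (Matrix.single l k 1) B) z := by
  have := functional_iDelDelBar hU ((smoothForm_fundForm_pow hg (n - 2)).smul hu)
    (topCoeff n ∘ₗ LinearMap.mulRight ℂ (fundForm B)) hz
  simp only [LinearMap.comp_apply, LinearMap.mulRight_apply, ← fundForm_single] at this
  rw [this]
  simp only [mul_smul_comm, smul_mul_assoc, map_smul, smul_eq_mul]
  rfl

theorem topCoeff_iDelDelBar_mul (hU : IsOpen U)
    (hg : ∀ i j, ContDiffOn ℝ ∞ (fun z => g z i j) U)
    (B : Matrix (Fin n) (Fin n) ℂ) {z : Fin n → ℂ} (hz : z ∈ U) :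
    topCoeff n (iDelDelBar (fun w => fundForm (g w) ^ (n - 2)) z * fundForm B) =
      ∑ l, ∑ k, wirtinger l (wirtingerBar k fun w =>
        mixDisc (g w) (Matrix.single l k 1) B) z := by
  have := topCoeff_iDelDelBar_smul_mul hU hg (u := fun _ => 1) contDiffOn_const B hz
  simpa only [one_smul, one_mul] using this

end MixDisc

/-! ### Mixed discriminants of positive semidefinite matrices -/

theorem topCoeff_list_prod_nonneg (L : List (Matrix (Fin n) (Fin n) ℂ)) (hL : L.length = n)
    (h : ∀ B ∈ L, B.PosSemidef) : 0 ≤ topCoeff n (L.map fundForm).prod := by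
  have := topCoeff_fundProd_nonneg (n := n) (B := fun i => L.get (i.cast hL.symm))
    fun i => h _ (List.get_mem _ _)
  rw [fundProd_apply] at this
  convert this using 3
  apply List.ext_getElem
  · simp [hL]
  · intro i h1 h2
    simp

theorem topCoeff_pow_mul_pow_mul_nonneg {W R B : Matrix (Fin n) (Fin n) ℂ} (hW : W.PosSemidef)
    (hR : R.PosSemidef) (hB : B.PosSemidef) {a b : ℕ} (hab : a + b + 1 = n) :
    0 ≤ topCoeff n (fundForm W ^ a * fundForm R ^ b * fundForm B) := by
  have := topCoeff_list_prod_nonneg (List.replicate a W ++ List.replicate b R ++ [B])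
    (by simpa [add_assoc] using hab) (by
      intro C hC
      simp only [List.mem_append, List.mem_replicate, List.mem_singleton] at hC
      rcases hC with (⟨-, rfl⟩ | ⟨-, rfl⟩) | rfl <;> assumption)
  simpa [mul_assoc] using this

theorem mixDisc_nonneg (hn : 2 ≤ n) {g X B : Matrix (Fin n) (Fin n) ℂ} (hg : g.PosSemidef)
    (hX : X.PosSemidef) (hB : B.PosSemidef) : 0 ≤ mixDisc g X B := by
  have := topCoeff_pow_mul_pow_mul_nonneg hX hg hB (a := 1) (b := n - 2) (by omega)
  simpa [mixDisc] using this

/-- The real part of the mixed discriminant `F(g)^{n-1} ∧ F(B)`. -/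
def powDisc (g B : Matrix (Fin n) (Fin n) ℂ) : ℝ :=
  (topCoeff n (fundForm g ^ (n - 1) * fundForm B)).re

theorem powDisc_nonneg (hn : 2 ≤ n) {g B : Matrix (Fin n) (Fin n) ℂ} (hg : g.PosSemidef)
    (hB : B.PosSemidef) : 0 ≤ powDisc g B := by
  have := topCoeff_pow_mul_pow_mul_nonneg hg hg hB (a := n - 1) (b := 0) (by omega)
  rw [pow_zero, mul_one] at this
  exact (Complex.nonneg_iff.1 this).1

theorem powDisc_add_right (g B B' : Matrix (Fin n) (Fin n) ℂ) :
    powDisc g (B + B') = powDisc g B + powDisc g B' := by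
  simp [powDisc, fundForm_add, mul_add]

theorem powDisc_smul_right (g B : Matrix (Fin n) (Fin n) ℂ) (c : ℝ) :
    powDisc g ((c : ℂ) • B) = c * powDisc g B := by
  simp only [powDisc, fundForm_smul, mul_smul_comm, map_smul, smul_eq_mul, Complex.re_ofReal_mul]

theorem powDisc_smul_left (g B : Matrix (Fin n) (Fin n) ℂ) (c : ℝ) :
    powDisc ((c : ℂ) • g) B = c ^ (n - 1) * powDisc g B := by
  simp only [powDisc, fundForm_smul, smul_pow, smul_mul_assoc, map_smul, smul_eq_mul]
  rw [← Complex.ofReal_pow, Complex.re_ofReal_mul]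

/-- Expand the power of W + (W' - W) binomially: every term is a nonnegative mixed discriminant, and
the term m = n - 1 is the left side. -/
theorem powDisc_mono_left (hn : 2 ≤ n) {W W' B : Matrix (Fin n) (Fin n) ℂ} (hW : W.PosSemidef)
    (hW' : (W' - W).PosSemidef) (hB : B.PosSemidef) : powDisc W B ≤ powDisc W' B := by
  have h1 : topCoeff n (fundForm W' ^ (n - 1) * fundForm B) =
      ∑ m ∈ Finset.range (n - 1 + 1), ((n - 1).choose m : ℂ) *
        topCoeff n (fundForm W ^ m * fundForm (W' - W) ^ (n - 1 - m) * fundForm B) := by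
    conv_lhs => rw [← add_sub_cancel W W', fundForm_add, (commute_fundForm _ _).add_pow]
    rw [Finset.sum_mul, map_sum]
    refine Finset.sum_congr rfl fun m _ => ?_
    rw [← nsmul_eq_mul', smul_mul_assoc, map_nsmul, nsmul_eq_mul]
  have h2 : ∀ m ∈ Finset.range (n - 1 + 1), 0 ≤ ((n - 1).choose m : ℂ) *
      topCoeff n (fundForm W ^ m * fundForm (W' - W) ^ (n - 1 - m) * fundForm B) := by
    intro m hm
    rw [Finset.mem_range] at hm
    exact mul_nonneg (Nat.cast_nonneg _) (topCoeff_pow_mul_pow_mul_nonneg hW hW' hB (by omega))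
  have h3 := Finset.single_le_sum h2 (Finset.mem_range.2 (Nat.lt_succ_self (n - 1)))
  rw [← h1] at h3
  simp only [Nat.choose_self, Nat.cast_one, one_mul, Nat.sub_self, pow_zero, mul_one] at h3
  exact (Complex.le_def.1 h3).1

theorem powDisc_eq (hn : 2 ≤ n) {g : Matrix (Fin n) (Fin n) ℂ} (hg : g.PosDef)
    (B : Matrix (Fin n) (Fin n) ℂ) :
    powDisc g B = ((n - 1).factorial : ℝ) * (g.adjugate * B).trace.re := by
  rw [powDisc, topCoeff_fundForm_pow_mul hg.det_pos.ne'.isUnit B (by omega),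
    ← Complex.ofReal_natCast, Complex.re_ofReal_mul]

theorem powDisc_one (hn : 2 ≤ n) (B : Matrix (Fin n) (Fin n) ℂ) :
    powDisc 1 B = ((n - 1).factorial : ℝ) * B.trace.re := by
  rw [powDisc_eq hn Matrix.PosDef.one, Matrix.adjugate_one, one_mul]

theorem mixDisc_self_right (hn : 2 ≤ n) (g X : Matrix (Fin n) (Fin n) ℂ) :
    (mixDisc g X g).re = powDisc g X := by
  rw [mixDisc, powDisc, mul_assoc, ← pow_succ, show n - 2 + 1 = n - 1 by omega,
    ((commute_fundForm X g).pow_right (n - 1)).eq]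

theorem mixDisc_self_left (hn : 2 ≤ n) (g B : Matrix (Fin n) (Fin n) ℂ) :
    (mixDisc g g B).re = powDisc g B := by
  rw [mixDisc, powDisc, ← pow_succ', show n - 2 + 1 = n - 1 by omega]

theorem mixDisc_add_left (g X X' B : Matrix (Fin n) (Fin n) ℂ) :
    mixDisc g (X + X') B = mixDisc g X B + mixDisc g X' B := by
  simp [mixDisc, fundForm_add, add_mul]

theorem mixDisc_smul_left (g X B : Matrix (Fin n) (Fin n) ℂ) (c : ℂ) :
    mixDisc g (c • X) B = c * mixDisc g X B := by
  simp [mixDisc, fundForm_smul]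

theorem mixDisc_smul_right (g X B : Matrix (Fin n) (Fin n) ℂ) (c : ℂ) :
    mixDisc g X (c • B) = c * mixDisc g X B := by
  simp [mixDisc, fundForm_smul]

theorem mixDisc_sum_left {ι : Type*} (s : Finset ι) (g B : Matrix (Fin n) (Fin n) ℂ)
    (X : ι → Matrix (Fin n) (Fin n) ℂ) :
    mixDisc g (∑ i ∈ s, X i) B = ∑ i ∈ s, mixDisc g (X i) B := by
  simp only [mixDisc, ← fundFormLin_apply, map_sum, Finset.sum_mul]

theorem mixDisc_sum_right {ι : Type*} (s : Finset ι) (g X : Matrix (Fin n) (Fin n) ℂ)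
    (B : ι → Matrix (Fin n) (Fin n) ℂ) :
    mixDisc g X (∑ i ∈ s, B i) = ∑ i ∈ s, mixDisc g X (B i) := by
  simp only [mixDisc, ← fundFormLin_apply, map_sum, Finset.mul_sum]

theorem mixDisc_mono_left (hn : 2 ≤ n) {g X X' B : Matrix (Fin n) (Fin n) ℂ}
    (hg : g.PosSemidef) (hX : (X' - X).PosSemidef) (hB : B.PosSemidef) :
    (mixDisc g X B).re ≤ (mixDisc g X' B).re := by
  have := (Complex.nonneg_iff.1 (mixDisc_nonneg hn hg hX hB)).1
  have h2 := congrArg Complex.re (mixDisc_add_left g X (X' - X) B)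
  rw [add_sub_cancel, Complex.add_re] at h2
  linarith

theorem matrix_eq_sum_smul_single (X : Matrix (Fin n) (Fin n) ℂ) :
    X = ∑ l, ∑ k, X l k • Matrix.single l k (1 : ℂ) := by
  conv_lhs => rw [Matrix.matrix_eq_sum_single X]
  simp [Matrix.smul_single]

theorem mixDisc_eq_sum_left (g X B : Matrix (Fin n) (Fin n) ℂ) :
    mixDisc g X B = ∑ l, ∑ k, X l k * mixDisc g (Matrix.single l k 1) B := by
  conv_lhs => rw [matrix_eq_sum_smul_single X]
  simp only [mixDisc_sum_left, mixDisc_smul_left]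

theorem mixDisc_eq_sum_right (g X B : Matrix (Fin n) (Fin n) ℂ) :
    mixDisc g X B = ∑ i, ∑ j, B i j * mixDisc g X (Matrix.single i j 1) := by
  conv_lhs => rw [matrix_eq_sum_smul_single B]
  simp only [mixDisc_sum_right, mixDisc_smul_right]

/-! ### Traces, determinants and eigenvalues -/

theorem trace_mul_nonneg {A B : Matrix (Fin n) (Fin n) ℂ} (hA : A.PosSemidef)
    (hB : B.PosSemidef) : 0 ≤ (A * B).trace := by
  obtain ⟨R, rfl⟩ := posSemidef_eq_sum_vecMulVec hB
  rw [Finset.mul_sum, Matrix.trace_sum]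
  refine Finset.sum_nonneg fun j _ => ?_
  have := hA.dotProduct_mulVec_nonneg (star (R j))
  rwa [Matrix.mul_vecMulVec, Matrix.trace_vecMulVec, dotProduct_comm, ← star_star (R j),
    star_star (star (R j))]

theorem re_trace_nonneg {B : Matrix (Fin n) (Fin n) ℂ} (hB : B.PosSemidef) : 0 ≤ B.trace.re :=
  (Complex.nonneg_iff.1 hB.trace_nonneg).1

theorem posDef_adjugate {W : Matrix (Fin n) (Fin n) ℂ} (hW : W.PosDef) : W.adjugate.PosDef := by
  have h1 : W.adjugate = W.det • W⁻¹ := by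
    rw [Matrix.inv_def, smul_smul, Ring.mul_inverse_cancel _ hW.det_pos.ne'.isUnit, one_smul]
  rw [h1]
  exact hW.inv.smul hW.det_pos

theorem det_le_trace_pow {G : Matrix (Fin n) (Fin n) ℂ} (hG : G.PosSemidef) :
    G.det.re ≤ G.trace.re ^ n := by
  have h1 : G.det.re = ∏ i, hG.isHermitian.eigenvalues i := by
    rw [hG.isHermitian.det_eq_prod_eigenvalues]; norm_cast
  have h2 : G.trace.re = ∑ i, hG.isHermitian.eigenvalues i := by
    rw [hG.isHermitian.trace_eq_sum_eigenvalues]; norm_cast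
  have h0 := hG.eigenvalues_nonneg
  rw [h1, h2]
  calc ∏ i, hG.isHermitian.eigenvalues i
      ≤ ∏ _i : Fin n, ∑ i, hG.isHermitian.eigenvalues i :=
        Finset.prod_le_prod (fun i _ => h0 i)
          fun i hi => Finset.single_le_sum (fun j _ => h0 j) hi
    _ = _ := by simp

/-- Each eigenvalue times the product of the other n - 1, all at least c, is the determinant; so no
eigenvalue exceeds D/cⁿ⁻¹. -/
theorem trace_le_of_det_le {G : Matrix (Fin n) (Fin n) ℂ} (hG : G.PosSemidef)
    {c D : ℝ} (hc : 0 < c) (hGc : (G - (c : ℂ) • 1).PosSemidef) (hD : G.det.re ≤ D) :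
    G.trace.re ≤ n * (D / c ^ (n - 1)) := by
  have h1 : G.det.re = ∏ i, hG.isHermitian.eigenvalues i := by
    rw [hG.isHermitian.det_eq_prod_eigenvalues]; norm_cast
  have h2 : G.trace.re = ∑ i, hG.isHermitian.eigenvalues i := by
    rw [hG.isHermitian.trace_eq_sum_eigenvalues]; norm_cast
  have h0 : ∀ i, c ≤ hG.isHermitian.eigenvalues i := by
    intro i
    have h3 := hGc.re_dotProduct_nonneg (hG.isHermitian.eigenvectorBasis i)
    rw [Matrix.sub_mulVec, dotProduct_sub, map_sub, ← hG.isHermitian.eigenvalues_eq,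
      Matrix.smul_mulVec, Matrix.one_mulVec, dotProduct_smul] at h3
    have h4 : star (hG.isHermitian.eigenvectorBasis i : Fin n → ℂ) ⬝ᵥ
        (hG.isHermitian.eigenvectorBasis i : Fin n → ℂ) = 1 := by
      rw [dotProduct_comm, ← EuclideanSpace.inner_eq_star_dotProduct,
        orthonormal_iff_ite.1 hG.isHermitian.eigenvectorBasis.orthonormal]
      simp
    rw [h4] at h3
    simp at h3
    exact h3
  rw [h2]
  have h5 : ∀ i, hG.isHermitian.eigenvalues i ≤ D / c ^ (n - 1) := by
    intro i
    rw [le_div_iff₀ (pow_pos hc _)]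
    refine le_trans ?_ (h1 ▸ hD)
    rw [← Finset.mul_prod_erase _ _ (Finset.mem_univ i)]
    refine mul_le_mul_of_nonneg_left ?_ (hc.le.trans (h0 i))
    calc c ^ (n - 1) = ∏ _j ∈ Finset.univ.erase i, c := by
          rw [Finset.prod_const, Finset.card_erase_of_mem (Finset.mem_univ i)]; simp
      _ ≤ _ := Finset.prod_le_prod (fun _ _ => hc.le) fun j _ => h0 j
  calc _ ≤ ∑ _i : Fin n, D / c ^ (n - 1) := Finset.sum_le_sum fun i _ => h5 i
    _ = _ := by simp

theorem posSemidef_of_vecMulVec {A : Matrix (Fin n) (Fin n) ℂ} (hA : A.IsHermitian)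
    (h : ∀ ξ : Fin n → ℂ, 0 ≤ (A * Matrix.vecMulVec ξ (star ξ)).trace.re) : A.PosSemidef := by
  refine Matrix.PosSemidef.of_dotProduct_mulVec_nonneg hA fun ξ => ?_
  have h1 := h ξ
  rw [Matrix.mul_vecMulVec, Matrix.trace_vecMulVec, dotProduct_comm] at h1
  exact Complex.nonneg_iff.2 ⟨h1, (hA.im_star_dotProduct_mulVec_self ξ).symm⟩

/-! ### Pointwise consequences of the equation -/

theorem trace_smul_one_re (c : ℝ) : ((c : ℂ) • (1 : Matrix (Fin n) (Fin n) ℂ)).trace.re = c * n := by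
  rw [Matrix.trace_smul, smul_eq_mul, Complex.re_ofReal_mul, Matrix.trace_one]; simp

theorem trace_re_le_of_le {g : Matrix (Fin n) (Fin n) ℂ} {Λ : ℝ}
    (hΛ : ((Λ : ℂ) • 1 - g).PosSemidef) : g.trace.re ≤ Λ * n := by
  have := re_trace_nonneg hΛ
  rw [Matrix.trace_sub, Complex.sub_re, trace_smul_one_re] at this
  linarith

theorem powDisc_le_of_le (hn : 2 ≤ n) {g B : Matrix (Fin n) (Fin n) ℂ} {Λ : ℝ}
    (hg : g.PosSemidef) (hB : B.PosSemidef) (hΛ : ((Λ : ℂ) • 1 - g).PosSemidef) :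
    powDisc g B ≤ Λ ^ (n - 1) * (((n - 1).factorial : ℝ) * B.trace.re) := by
  rw [← powDisc_one hn, ← powDisc_smul_left]
  exact powDisc_mono_left hn hg hΛ hB

theorem posSemidef_smul_one {c : ℝ} (hc : 0 ≤ c) :
    ((c : ℂ) • (1 : Matrix (Fin n) (Fin n) ℂ)).PosSemidef :=
  Matrix.PosSemidef.one.smul (by exact_mod_cast hc)

theorem le_powDisc_of_le (hn : 2 ≤ n) {g B : Matrix (Fin n) (Fin n) ℂ} {lam : ℝ} (hl : 0 ≤ lam)
    (hB : B.PosSemidef) (hg : (g - (lam : ℂ) • 1).PosSemidef) :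
    lam ^ (n - 1) * B.trace.re ≤ powDisc g B := by
  have h1 : lam ^ (n - 1) * (((n - 1).factorial : ℝ) * B.trace.re) ≤ powDisc g B := by
    rw [← powDisc_one hn, ← powDisc_smul_left]
    exact powDisc_mono_left hn (posSemidef_smul_one hl) hg hB
  refine le_trans ?_ h1
  refine mul_le_mul_of_nonneg_left ?_ (pow_nonneg hl _)
  have : (1 : ℝ) ≤ (n - 1).factorial := by exact_mod_cast Nat.succ_le_of_lt (Nat.factorial_pos _)
  nlinarith [re_trace_nonneg hB]

theorem trace_adjugate_mul_le {W g : Matrix (Fin n) (Fin n) ℂ} {lam : ℝ} (hW : W.PosDef)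
    (hg : (g - (lam : ℂ) • 1).PosSemidef) :
    lam * W.adjugate.trace.re ≤ (W.adjugate * g).trace.re := by
  have h := (Complex.nonneg_iff.1 (trace_mul_nonneg (posDef_adjugate hW).posSemidef hg)).1
  rw [mul_sub, mul_smul_comm, mul_one, Matrix.trace_sub, Matrix.trace_smul, Complex.sub_re,
    smul_eq_mul, Complex.re_ofReal_mul] at h
  linarith

theorem trace_adjugate_mul_ge {W g : Matrix (Fin n) (Fin n) ℂ} {Λ : ℝ} (hW : W.PosDef)
    (hg : ((Λ : ℂ) • 1 - g).PosSemidef) :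
    (W.adjugate * g).trace.re ≤ Λ * W.adjugate.trace.re := by
  have h := (Complex.nonneg_iff.1 (trace_mul_nonneg (posDef_adjugate hW).posSemidef hg)).1
  rw [mul_sub, mul_smul_comm, mul_one, Matrix.trace_sub, Matrix.trace_smul, Complex.sub_re,
    smul_eq_mul, Complex.re_ofReal_mul] at h
  linarith

theorem det_adjugate_re {W : Matrix (Fin n) (Fin n) ℂ} (hW : W.PosDef) :
    W.adjugate.det.re = W.det.re ^ (n - 1) := by
  have h1 : W.det = (W.det.re : ℂ) := Complex.ext rfl (by simp [(Complex.pos_iff.1 hW.det_pos).2.symm])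
  rw [Matrix.det_adjugate, Fintype.card_fin, h1, ← Complex.ofReal_pow, Complex.ofReal_re,
    Complex.ofReal_re]

/-- At a point where the Hessian is nonpositive, the determinant of the solution is bounded. -/
theorem exists_det_bound (hn : 2 ≤ n) {lam Λ K R : ℝ} (hl : 0 < lam) :
    ∃ D : ℝ, ∀ (g g₀ W Φ : Matrix (Fin n) (Fin n) ℂ) (err : ℝ), g.PosDef → g₀.PosDef → W.PosDef →
      (g - (lam : ℂ) • 1).PosSemidef → ((Λ : ℂ) • 1 - g).PosSemidef →
      ((K : ℂ) • g - g₀).PosSemidef → (-Φ).PosSemidef →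
      powDisc W g = powDisc g₀ g + (mixDisc g Φ g).re + err → err ≤ R → W.det.re ≤ D := by
  -- τ will bound the trace of adj W: its numerator bounds the right side of the equation tested
  -- with g, and lam tr(adj W) bounds the left side from below.
  set τ := (|K| ^ (n - 1) * (|Λ| ^ (n - 1) * ((n - 1).factorial * (|Λ| * n))) + R) / lam with hτ
  refine ⟨max 1 (τ ^ n), fun g g₀ W Φ err hg hg₀ hW hgl hgΛ hK hΦ heq herr => ?_⟩
  have h1 : (mixDisc g Φ g).re ≤ 0 := by
    rw [mixDisc_self_right hn]
    have h := powDisc_nonneg hn hg.posSemidef hΦ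
    have h' := powDisc_add_right g Φ (-Φ)
    have h0 : powDisc g 0 = 0 := by simp [powDisc, ← fundFormLin_apply]
    rw [add_neg_cancel, h0] at h'
    linarith
  have hgt := trace_re_le_of_le hgΛ
  have h2 : powDisc g₀ g ≤ |K| ^ (n - 1) * (|Λ| ^ (n - 1) * ((n - 1).factorial * (|Λ| * n))) := by
    have a1 : powDisc g₀ g ≤ K ^ (n - 1) * powDisc g g := by
      rw [← powDisc_smul_left]
      exact powDisc_mono_left hn hg₀.posSemidef hK hg.posSemidef
    have a2 := powDisc_le_of_le hn hg.posSemidef hg.posSemidef hgΛ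
    have a3 := powDisc_nonneg hn hg.posSemidef hg.posSemidef
    have a4 : K ^ (n - 1) ≤ |K| ^ (n - 1) := by rw [← abs_pow]; exact le_abs_self _
    have a5 : Λ ^ (n - 1) ≤ |Λ| ^ (n - 1) := by rw [← abs_pow]; exact le_abs_self _
    have a6 := re_trace_nonneg hg.posSemidef
    have a7 : g.trace.re ≤ |Λ| * n := hgt.trans
      (mul_le_mul_of_nonneg_right (le_abs_self _) (Nat.cast_nonneg _))
    calc powDisc g₀ g ≤ |K| ^ (n - 1) * powDisc g g :=
          a1.trans (mul_le_mul_of_nonneg_right a4 a3)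
      _ ≤ |K| ^ (n - 1) * (|Λ| ^ (n - 1) * ((n - 1).factorial * g.trace.re)) := by
          refine mul_le_mul_of_nonneg_left (a2.trans ?_) (by positivity)
          exact mul_le_mul_of_nonneg_right a5 (by positivity)
      _ ≤ _ := by gcongr
  have h3 : lam * W.adjugate.trace.re ≤ powDisc W g := by
    rw [powDisc_eq hn hW]
    have b1 := trace_adjugate_mul_le hW hgl
    have b2 : (1 : ℝ) ≤ (n - 1).factorial := by
      exact_mod_cast Nat.succ_le_of_lt (Nat.factorial_pos _)
    have b3 := (Complex.nonneg_iff.1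
      (trace_mul_nonneg (posDef_adjugate hW).posSemidef hg.posSemidef)).1
    nlinarith
  have h4 : W.adjugate.trace.re ≤ τ := by
    rw [hτ, le_div_iff₀ hl]; linarith
  have h5 := det_le_trace_pow (posDef_adjugate hW).posSemidef
  rw [det_adjugate_re hW] at h5
  have h6 : W.adjugate.trace.re ^ n ≤ τ ^ n :=
    pow_le_pow_left₀ (re_trace_nonneg (posDef_adjugate hW).posSemidef) h4 n
  -- The trace controls det(adj W) = (det W)ⁿ⁻¹. For det W > 1 this dominates det W, since n - 1 ≥
  -- 1.
  by_cases hd : W.det.re ≤ 1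
  · exact hd.trans (le_max_left _ _)
  · refine le_trans ?_ (le_max_right _ _)
    exact (le_self_pow₀ (not_le.1 hd).le (by omega)).trans (h5.trans h6)

/-- At a point where the Hessian is almost nonnegative and the gradient is small, the Hessian is
bounded. -/
theorem exists_trace_bound (hn : 2 ≤ n) {lam Λ δ D : ℝ} (hl : 0 < lam) (hδ : 0 < δ) :
    ∃ ε > 0, ∃ κ > 0, ∃ C : ℝ, ∀ (g g₀ W Φ : Matrix (Fin n) (Fin n) ℂ)
      (err : Matrix (Fin n) (Fin n) ℂ → ℝ), g.PosDef → W.PosDef →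
      (g - (lam : ℂ) • 1).PosSemidef → ((Λ : ℂ) • 1 - g).PosSemidef →
      (g₀ - (δ : ℂ) • g).PosSemidef → W.det.re ≤ D → (Φ + ((ε : ℝ) : ℂ) • 1).PosSemidef →
      (∀ B, B.PosSemidef → powDisc W B = powDisc g₀ B + (mixDisc g Φ B).re + err B) →
      (∀ B, B.PosSemidef → -(κ * B.trace.re) ≤ err B) →
      (Φ + ((ε : ℝ) : ℂ) • 1).trace.re ≤ C := by
  -- The term with ε (by lam·1 ≤ g) and the error κ tr B (by lamⁿ⁻¹ tr B ≤ `powDisc g B`) each cost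
  -- at most a quarter of δⁿ⁻¹ `powDisc g B`. The remaining half gives the lower bound c for adj W.
  set ε := lam * δ ^ (n - 1) / 4 with hε
  set κ := δ ^ (n - 1) * lam ^ (n - 1) / 4 with hκ
  have hε0 : 0 < ε := by positivity
  have hκ0 : 0 < κ := by positivity
  set F : ℝ := ((n - 1).factorial : ℝ) with hF
  have hF0 : 0 < F := by rw [hF]; exact_mod_cast Nat.factorial_pos _
  set c := δ ^ (n - 1) * lam ^ (n - 1) / 2 / F with hc
  have hc0 : 0 < c := by positivity
  set C1 := F * (|Λ| * (n * (D ^ (n - 1) / c ^ (n - 1)))) + κ * (Λ * n) +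
    ε * (Λ ^ (n - 1) * (F * n)) with hC1
  refine ⟨ε, hε0, κ, hκ0, C1 / lam ^ (n - 1),
    fun g g₀ W Φ err hg hW hgl hgΛ hg₀ hD hΦ heq herr => ?_⟩
  have hmix1 : ∀ B : Matrix (Fin n) (Fin n) ℂ, B.PosSemidef →
      ε * (mixDisc g 1 B).re ≤ δ ^ (n - 1) / 4 * powDisc g B := by
    intro B hB
    have := mixDisc_mono_left hn hg.posSemidef hgl hB
    rw [mixDisc_smul_left, Complex.re_ofReal_mul, mixDisc_self_left hn] at this
    have h2 : (0 : ℝ) < δ ^ (n - 1) / 4 := by positivity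
    calc ε * (mixDisc g 1 B).re = δ ^ (n - 1) / 4 * (lam * (mixDisc g 1 B).re) := by
          rw [hε]; ring
      _ ≤ _ := mul_le_mul_of_nonneg_left this h2.le
  have hlow : ∀ B : Matrix (Fin n) (Fin n) ℂ, B.PosSemidef →
      F * (c * B.trace.re) ≤ powDisc W B := by
    intro B hB
    have e1 : δ ^ (n - 1) * powDisc g B ≤ powDisc g₀ B := by
      rw [← powDisc_smul_left]
      exact powDisc_mono_left hn (hg.posSemidef.smul (by exact_mod_cast hδ.le)) hg₀ hB
    have e2 := (Complex.nonneg_iff.1 (mixDisc_nonneg hn hg.posSemidef hΦ hB)).1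
    rw [mixDisc_add_left, mixDisc_smul_left, Complex.add_re, Complex.re_ofReal_mul] at e2
    have e3 := hmix1 B hB
    have e4 := herr B hB
    have e5 := le_powDisc_of_le hn hl.le hB hgl
    have e6 := heq B hB
    have e7 : F * (c * B.trace.re) = δ ^ (n - 1) / 2 * (lam ^ (n - 1) * B.trace.re) := by
      rw [hc]; field_simp
    have e8 : κ * B.trace.re = δ ^ (n - 1) / 4 * (lam ^ (n - 1) * B.trace.re) := by
      rw [hκ]; ring
    have h2 : (0 : ℝ) < δ ^ (n - 1) := by positivity
    rw [e7]
    rw [e8] at e4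
    nlinarith [mul_le_mul_of_nonneg_left e5 h2.le]
  have hG : W.adjugate.PosSemidef := (posDef_adjugate hW).posSemidef
  -- On rank-one B the lower bound `hlow` is exactly the quadratic form inequality adj W ≥ c,
  -- because `powDisc W B` = (n-1)! tr(adj W · B).
  have hGc : (W.adjugate - (c : ℂ) • 1).PosSemidef := by
    apply posSemidef_of_vecMulVec
    · exact hG.isHermitian.sub (posSemidef_smul_one hc0.le).isHermitian
    · intro ξ
      have := hlow _ (Matrix.posSemidef_vecMulVec_self_star ξ)
      rw [powDisc_eq hn hW] at this
      have := le_of_mul_le_mul_left this hF0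
      rw [sub_mul, smul_mul_assoc, one_mul, Matrix.trace_sub, Matrix.trace_smul, Complex.sub_re,
        smul_eq_mul, Complex.re_ofReal_mul]
      linarith
  have hdet0 : 0 ≤ W.det.re := (Complex.pos_iff.1 hW.det_pos).1.le
  have htr := trace_le_of_det_le (D := D ^ (n - 1)) hG hc0 hGc
    (by rw [det_adjugate_re hW]; exact pow_le_pow_left₀ hdet0 hD _)
  have hWg : powDisc W g ≤ F * (|Λ| * (n * (D ^ (n - 1) / c ^ (n - 1)))) := by
    rw [powDisc_eq hn hW]
    refine mul_le_mul_of_nonneg_left ((trace_adjugate_mul_ge hW hgΛ).trans ?_) hF0.le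
    exact mul_le_mul (le_abs_self _) htr (re_trace_nonneg hG) (abs_nonneg _)
  have hg0 : 0 ≤ powDisc g₀ g := by
    refine powDisc_nonneg hn ?_ hg.posSemidef
    have := hg₀.add (hg.posSemidef.smul (show (0 : ℂ) ≤ δ by exact_mod_cast hδ.le))
    rwa [sub_add_cancel] at this
  have h1 : powDisc g 1 ≤ Λ ^ (n - 1) * (F * n) := by
    have := powDisc_le_of_le hn hg.posSemidef Matrix.PosSemidef.one hgΛ
    simpa using this
  -- The equation tested with B = g now bounds the Hessian term: its left side is bounded by the
  -- trace of adj W, and the term with g₀ is nonnegative and can be dropped.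
  have h2 : powDisc g (Φ + (ε : ℂ) • 1) ≤ C1 := by
    rw [powDisc_add_right, powDisc_smul_right]
    have e6 := heq g hg.posSemidef
    rw [mixDisc_self_right hn] at e6
    have e4 := herr g hg.posSemidef
    have e7 := trace_re_le_of_le hgΛ
    rw [hC1]
    nlinarith
  have h3 := le_powDisc_of_le hn hl.le hΦ hgl
  rw [le_div_iff₀ (by positivity)]
  linarith

/-! ### Real and complex Hessians -/

section Hessian

variable {u : (Fin n → ℂ) → ℝ} {z : Fin n → ℂ} {U : Set (Fin n → ℂ)}

/-- The second derivative of `u` in the directions `a` and `b`. -/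
def rHess (u : (Fin n → ℂ) → ℝ) (z a b : Fin n → ℂ) : ℝ :=
  fderiv ℝ (fun w => fderiv ℝ u w a) z b

/-- The complex Hessian `∂²u/∂z_l∂z̄_k`. -/
def cHess (u : (Fin n → ℂ) → ℝ) (z : Fin n → ℂ) : Matrix (Fin n) (Fin n) ℂ :=
  Matrix.of fun l k => wirtinger l (wirtingerBar k fun w => (u w : ℂ)) z

theorem fderiv_ofReal_comp (hu : DifferentiableAt ℝ u z) (a : Fin n → ℂ) :
    fderiv ℝ (fun w => (u w : ℂ)) z a = (fderiv ℝ u z a : ℂ) := by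
  have := (Complex.ofRealCLM.hasFDerivAt.comp z hu.hasFDerivAt).fderiv
  rw [show (fun w => (u w : ℂ)) = Complex.ofRealCLM ∘ u from rfl, this]
  rfl

theorem wirtinger_ofReal (hu : DifferentiableAt ℝ u z) (k : Fin n) :
    wirtinger k (fun w => (u w : ℂ)) z = (1 / 2) * ((fderiv ℝ u z (Pi.single k 1) : ℂ) -
      Complex.I * (fderiv ℝ u z (Pi.single k Complex.I) : ℂ)) := by
  rw [wirtinger, fderiv_ofReal_comp hu, fderiv_ofReal_comp hu]

theorem wirtingerBar_ofReal (hu : DifferentiableAt ℝ u z) (k : Fin n) :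
    wirtingerBar k (fun w => (u w : ℂ)) z = (1 / 2) * ((fderiv ℝ u z (Pi.single k 1) : ℂ) +
      Complex.I * (fderiv ℝ u z (Pi.single k Complex.I) : ℂ)) := by
  rw [wirtingerBar, fderiv_ofReal_comp hu, fderiv_ofReal_comp hu]

theorem differentiableAt_fderiv_apply (hU : IsOpen U) (hu : ContDiffOn ℝ ∞ u U) (hz : z ∈ U)
    (a : Fin n → ℂ) : DifferentiableAt ℝ (fun w => fderiv ℝ u w a) z :=
  ContDiffOn.differentiableAt_of_isOpen hU (contDiffOn_fderiv_apply hU hu a) hz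

theorem cHess_apply (hU : IsOpen U) (hu : ContDiffOn ℝ ∞ u U) (hz : z ∈ U) (l k : Fin n) :
    cHess u z l k = (1 / 4) *
      (((rHess u z (Pi.single k 1) (Pi.single l 1) +
        rHess u z (Pi.single k Complex.I) (Pi.single l Complex.I) : ℝ) : ℂ) +
      Complex.I * ((rHess u z (Pi.single k Complex.I) (Pi.single l 1) -
        rHess u z (Pi.single k 1) (Pi.single l Complex.I) : ℝ) : ℂ)) := by
  have h1 : (wirtingerBar k fun w => (u w : ℂ)) =ᶠ[nhds z] fun w =>
      (1 / 2 : ℂ) * ((fderiv ℝ u w (Pi.single k 1) : ℂ) +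
        Complex.I * (fderiv ℝ u w (Pi.single k Complex.I) : ℂ)) := by
    filter_upwards [hU.mem_nhds hz] with w hw
    exact wirtingerBar_ofReal (ContDiffOn.differentiableAt_of_isOpen hU hu hw) k
  have d1 := differentiableAt_fderiv_apply hU hu hz (Pi.single k 1)
  have d2 := differentiableAt_fderiv_apply hU hu hz (Pi.single k Complex.I)
  have h2 : ∀ v, fderiv ℝ (fun w => (1 / 2 : ℂ) * ((fderiv ℝ u w (Pi.single k 1) : ℂ) +
        Complex.I * (fderiv ℝ u w (Pi.single k Complex.I) : ℂ))) z v =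
      (1 / 2 : ℂ) * ((rHess u z (Pi.single k 1) v : ℂ) +
        Complex.I * (rHess u z (Pi.single k Complex.I) v : ℂ)) := by
    intro v
    have c1 : DifferentiableAt ℝ (fun w => (fderiv ℝ u w (Pi.single k 1) : ℂ)) z :=
      Complex.ofRealCLM.differentiableAt.comp z d1
    have c2 : DifferentiableAt ℝ (fun w => (fderiv ℝ u w (Pi.single k Complex.I) : ℂ)) z :=
      Complex.ofRealCLM.differentiableAt.comp z d2
    rw [fderiv_const_mul (c1.fun_add (c2.const_mul _)), fderiv_fun_add c1 (c2.const_mul _),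
      fderiv_const_mul c2]
    simp only [smul_apply, add_apply, smul_eq_mul]
    rw [fderiv_ofReal_comp d1, fderiv_ofReal_comp d2]
    rfl
  rw [cHess, Matrix.of_apply, wirtinger_congr l h1, wirtinger, h2, h2]
  push_cast
  linear_combination (-(1 / 4 : ℂ) * rHess u z (Pi.single k Complex.I) (Pi.single l Complex.I)) *
    Complex.I_mul_I

theorem rHess_eq (hU : IsOpen U) (hu : ContDiffOn ℝ ∞ u U) (hz : z ∈ U) (a b : Fin n → ℂ) :
    rHess u z a b = fderiv ℝ (fderiv ℝ u) z b a := by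
  have h : DifferentiableAt ℝ (fderiv ℝ u) z :=
    ((hu.fderiv_of_isOpen hU (m := ∞) (by simp)).contDiffAt (hU.mem_nhds hz)).differentiableAt
      (by simp)
  rw [rHess, fderiv_clm_apply h (differentiableAt_const a)]
  simp

theorem rHess_symm (hU : IsOpen U) (hu : ContDiffOn ℝ ∞ u U) (hz : z ∈ U) (a b : Fin n → ℂ) :
    rHess u z a b = rHess u z b a := by
  rw [rHess_eq hU hu hz, rHess_eq hU hu hz]
  exact ((hu.contDiffAt (hU.mem_nhds hz)).isSymmSndFDerivAt (by
    simp only [minSmoothness_of_isRCLikeNormedField]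
    exact WithTop.coe_le_coe.2 le_top)) b a

theorem cHess_isHermitian (hU : IsOpen U) (hu : ContDiffOn ℝ ∞ u U) (hz : z ∈ U) :
    (cHess u z).IsHermitian := by
  ext l k
  rw [Matrix.conjTranspose_apply, cHess_apply hU hu hz, cHess_apply hU hu hz,
    rHess_symm hU hu hz (Pi.single l 1) (Pi.single k 1),
    rHess_symm hU hu hz (Pi.single l Complex.I) (Pi.single k Complex.I),
    rHess_symm hU hu hz (Pi.single l Complex.I) (Pi.single k 1),
    rHess_symm hU hu hz (Pi.single l 1) (Pi.single k Complex.I)]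
  simp [Complex.ext_iff]

theorem pi_eq_sum_single_re_im (a : Fin n → ℂ) :
    a = ∑ l, ((a l).re • (Pi.single l 1 : Fin n → ℂ) +
      (a l).im • (Pi.single l Complex.I : Fin n → ℂ)) := by
  ext i
  rw [Finset.sum_apply, Finset.sum_eq_single i]
  · simpa [mul_comm] using (Complex.re_add_im (a i)).symm
  · intro j _ hj; simp [hj.symm]
  · simp

/-- The complex Hessian form at x is a quarter of the sum of the real Hessian forms at v and √-1 v,
where v is the conjugate of x. This is why q is minus the imaginary part and `key` is used at (p, q)
and (-q, p). -/
theorem cHess_posSemidef (hU : IsOpen U) (hu : ContDiffOn ℝ ∞ u U) (hz : z ∈ U)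
    (h : ∀ a, 0 ≤ rHess u z a a) : (cHess u z).PosSemidef := by
  have hH := cHess_isHermitian hU hu hz
  refine Matrix.PosSemidef.of_dotProduct_mulVec_nonneg hH fun x => ?_
  refine Complex.nonneg_iff.2 ⟨?_, (hH.im_star_dotProduct_mulVec_self x).symm⟩
  set p : Fin n → ℝ := fun l => (x l).re
  set q : Fin n → ℝ := fun l => -(x l).im
  have key : ∀ p q : Fin n → ℝ, (0 : ℝ) ≤ ∑ l, ∑ k,
      (p l * p k * rHess u z (Pi.single k 1) (Pi.single l 1) +
        p l * q k * rHess u z (Pi.single k Complex.I) (Pi.single l 1) +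
        (q l * p k * rHess u z (Pi.single k 1) (Pi.single l Complex.I) +
        q l * q k * rHess u z (Pi.single k Complex.I) (Pi.single l Complex.I))) := by
    intro p q
    have := h (∑ l, (p l • (Pi.single l 1 : Fin n → ℂ) +
      q l • (Pi.single l Complex.I : Fin n → ℂ)))
    rw [rHess_eq hU hu hz] at this
    simp only [map_sum, map_add, map_smul, add_apply, smul_apply, smul_eq_mul, sum_apply] at this
    simp only [rHess_eq hU hu hz]
    simp only [Finset.mul_sum, ← Finset.sum_add_distrib] at this
    rw [Finset.sum_comm] at this
    refine this.trans_eq ?_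
    refine Finset.sum_congr rfl fun l _ => Finset.sum_congr rfl fun k _ => ?_
    ring
  have h1 := key p q
  have h2 := key (fun l => -q l) p
  have h3 := add_nonneg h1 h2
  rw [← Finset.sum_add_distrib] at h3
  have h4 : (star x ⬝ᵥ (cHess u z).mulVec x).re = (1 / 4) * ∑ l, ∑ k,
      ((p l * p k + q l * q k) * (rHess u z (Pi.single k 1) (Pi.single l 1) +
        rHess u z (Pi.single k Complex.I) (Pi.single l Complex.I)) +
      (p l * q k - q l * p k) * (rHess u z (Pi.single k Complex.I) (Pi.single l 1) -
        rHess u z (Pi.single k 1) (Pi.single l Complex.I))) := by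
    simp only [dotProduct, Matrix.mulVec, Complex.re_sum, Finset.mul_sum]
    refine Finset.sum_congr rfl fun l _ => Finset.sum_congr rfl fun k _ => ?_
    rw [cHess_apply hU hu hz]
    simp [p, q]
    ring
  rw [h4]
  refine mul_nonneg (by norm_num) (h3.trans_eq ?_)
  refine Finset.sum_congr rfl fun l _ => ?_
  rw [← Finset.sum_add_distrib]
  refine Finset.sum_congr rfl fun k _ => ?_
  ring

theorem cHess_trace_re (hU : IsOpen U) (hu : ContDiffOn ℝ ∞ u U) (hz : z ∈ U) :
    (cHess u z).trace.re = (1 / 4) * ∑ l, (rHess u z (Pi.single l 1) (Pi.single l 1) +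
      rHess u z (Pi.single l Complex.I) (Pi.single l Complex.I)) := by
  rw [Matrix.trace, Complex.re_sum, Finset.mul_sum]
  refine Finset.sum_congr rfl fun l _ => ?_
  rw [Matrix.diag_apply, cHess_apply hU hu hz]
  simp

/-- The squared Euclidean distance. -/
def sqDist (z₀ z : Fin n → ℂ) : ℝ := ∑ k, (((z k - z₀ k).re) ^ 2 + ((z k - z₀ k).im) ^ 2)

theorem contDiff_sqDist (z₀ : Fin n → ℂ) : ContDiff ℝ ∞ (sqDist z₀) := by
  unfold sqDist
  have h : ∀ k : Fin n, ContDiff ℝ ∞ (fun z : Fin n → ℂ => z k - z₀ k) := fun k =>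
    (contDiff_apply ℝ ℂ k).sub contDiff_const
  refine ContDiff.sum fun k _ => ?_
  exact ((Complex.reCLM.contDiff.comp (h k)).pow 2).add ((Complex.imCLM.contDiff.comp (h k)).pow 2)

theorem fderiv_sqDist (z₀ w a : Fin n → ℂ) : fderiv ℝ (sqDist z₀) w a =
    ∑ k, 2 * ((w k - z₀ k).re * (a k).re + (w k - z₀ k).im * (a k).im) := by
  have h : ∀ k : Fin n, HasFDerivAt (fun z : Fin n → ℂ => z k - z₀ k)
      (ContinuousLinearMap.proj k : (Fin n → ℂ) →L[ℝ] ℂ) w := fun k =>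
    (ContinuousLinearMap.proj (R := ℝ) (φ := fun _ : Fin n => ℂ) k).hasFDerivAt.sub_const _
  have h2 : HasFDerivAt (sqDist z₀) (∑ k, ((2 * (w k - z₀ k).re ^ (2 - 1)) • (Complex.reCLM ∘L
      (ContinuousLinearMap.proj k : (Fin n → ℂ) →L[ℝ] ℂ)) +
      (2 * (w k - z₀ k).im ^ (2 - 1)) • (Complex.imCLM ∘L
      (ContinuousLinearMap.proj k : (Fin n → ℂ) →L[ℝ] ℂ)))) w := by
    unfold sqDist
    refine HasFDerivAt.fun_sum fun k _ => ?_
    simpa using ((Complex.reCLM.hasFDerivAt.comp w (h k)).pow 2).fun_add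
      ((Complex.imCLM.hasFDerivAt.comp w (h k)).pow 2)
  rw [h2.fderiv]
  simp only [sum_apply, add_apply, smul_apply, smul_eq_mul]
  refine Finset.sum_congr rfl fun k _ => ?_
  simp
  ring

theorem rHess_sqDist (z₀ z a b : Fin n → ℂ) : rHess (sqDist z₀) z a b =
    ∑ k, 2 * ((b k).re * (a k).re + (b k).im * (a k).im) := by
  rw [rHess, funext fun w => fderiv_sqDist z₀ w a]
  have h : ∀ k : Fin n, HasFDerivAt (fun z : Fin n → ℂ => z k - z₀ k)
      (ContinuousLinearMap.proj k : (Fin n → ℂ) →L[ℝ] ℂ) z := fun k =>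
    (ContinuousLinearMap.proj (R := ℝ) (φ := fun _ : Fin n => ℂ) k).hasFDerivAt.sub_const _
  have h2 : HasFDerivAt (fun w : Fin n → ℂ =>
      ∑ k, 2 * ((w k - z₀ k).re * (a k).re + (w k - z₀ k).im * (a k).im))
      (∑ k, (2 : ℝ) • ((a k).re • (Complex.reCLM ∘L
        (ContinuousLinearMap.proj k : (Fin n → ℂ) →L[ℝ] ℂ)) + (a k).im • (Complex.imCLM ∘L
      (ContinuousLinearMap.proj k : (Fin n → ℂ) →L[ℝ] ℂ)))) z := by
    refine HasFDerivAt.fun_sum fun k _ => ?_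
    exact (((Complex.reCLM.hasFDerivAt.comp z (h k)).mul_const _).add
      ((Complex.imCLM.hasFDerivAt.comp z (h k)).mul_const _)).const_mul 2
  rw [h2.fderiv]
  simp only [sum_apply, add_apply, smul_apply, smul_eq_mul]
  refine Finset.sum_congr rfl fun k _ => ?_
  simp
  ring

theorem rHess_add_sqDist (hU : IsOpen U) (hu : ContDiffOn ℝ ∞ u U) (hz : z ∈ U) (ε : ℝ)
    (z₀ a b : Fin n → ℂ) : rHess (fun w => u w + ε * sqDist z₀ w) z a b =
      rHess u z a b + ε * ∑ k, 2 * ((b k).re * (a k).re + (b k).im * (a k).im) := by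
  have hq : ∀ w, DifferentiableAt ℝ (sqDist z₀) w := fun w =>
    (contDiff_sqDist z₀).differentiable (by simp) w
  have h1 : (fun w => fderiv ℝ (fun w => u w + ε * sqDist z₀ w) w a) =ᶠ[nhds z]
      fun w => fderiv ℝ u w a + ε * fderiv ℝ (sqDist z₀) w a := by
    filter_upwards [hU.mem_nhds hz] with w hw
    rw [fderiv_fun_add (ContDiffOn.differentiableAt_of_isOpen hU hu hw) ((hq w).const_mul ε),
      fderiv_const_mul (hq w)]
    rfl
  have hq2 : DifferentiableAt ℝ (fun w => fderiv ℝ (sqDist z₀) w a) z :=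
    differentiableAt_fderiv_apply isOpen_univ (contDiff_sqDist z₀).contDiffOn (Set.mem_univ z) a
  rw [rHess, h1.fderiv_eq, fderiv_fun_add (differentiableAt_fderiv_apply hU hu hz a)
    (hq2.const_mul ε), fderiv_const_mul hq2, ← rHess_sqDist z₀ z a b]
  rfl

theorem cHess_add_sqDist (hU : IsOpen U) (hu : ContDiffOn ℝ ∞ u U) (hz : z ∈ U) (ε : ℝ)
    (z₀ : Fin n → ℂ) :
    cHess (fun w => u w + ε * sqDist z₀ w) z = cHess u z + (ε : ℂ) • 1 := by
  ext l k
  have hv : ContDiffOn ℝ ∞ (fun w => u w + ε * sqDist z₀ w) U :=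
    hu.add (contDiffOn_const.mul (contDiff_sqDist z₀).contDiffOn)
  rw [Matrix.add_apply, cHess_apply hU hv hz, cHess_apply hU hu hz]
  simp only [rHess_add_sqDist hU hu hz]
  by_cases hlk : l = k
  · subst hlk
    simp [Pi.single_apply, apply_ite]
    ring
  · simp [Pi.single_apply, apply_ite, hlk, Ne.symm hlk]

end Hessian

/-! ### The equation in a coordinate domain -/

/-- Write B as a Gram matrix; then |Bᵢⱼ| ≤ (Bᵢᵢ + Bⱼⱼ)/2. Hence every linear expression in B is
controlled by tr B, which is how lower-order terms are compared with the leading ones. -/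
theorem norm_apply_le_trace {B : Matrix (Fin n) (Fin n) ℂ} (hB : B.PosSemidef) (i j : Fin n) :
    ‖B i j‖ ≤ B.trace.re := by
  obtain ⟨R, hR⟩ := posSemidef_eq_sum_vecMulVec hB
  have hd : ∀ i, (B i i).re = ∑ k, ‖R k i‖ ^ 2 := by
    intro i
    rw [hR, Matrix.sum_apply, Complex.re_sum]
    refine Finset.sum_congr rfl fun k _ => ?_
    rw [Matrix.vecMulVec_apply, Pi.star_apply, Complex.star_def, Complex.conj_mul']
    norm_cast
  have hle : ∀ i, (B i i).re ≤ B.trace.re := by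
    intro i
    rw [Matrix.trace, Complex.re_sum]
    exact Finset.single_le_sum (f := fun i => (B i i).re)
      (fun k _ => by rw [hd]; positivity) (Finset.mem_univ i)
  have h1 : ‖B i j‖ ≤ ∑ k, ‖R k i‖ * ‖R k j‖ := by
    conv_lhs => rw [hR, Matrix.sum_apply]
    refine (norm_sum_le _ _).trans (Finset.sum_le_sum fun k _ => ?_)
    rw [Matrix.vecMulVec_apply, norm_mul, Pi.star_apply, norm_star]
  have h2 : ∑ k, ‖R k i‖ * ‖R k j‖ ≤ ((B i i).re + (B j j).re) / 2 := by
    rw [hd, hd, ← Finset.sum_add_distrib, Finset.sum_div]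
    exact Finset.sum_le_sum fun k _ => by nlinarith [sq_nonneg (‖R k i‖ - ‖R k j‖)]
  linarith [hle i, hle j]

theorem mixDisc_eq_sum_prod (g X B : Matrix (Fin n) (Fin n) ℂ) :
    mixDisc g X B = ∑ p : Fin n × Fin n,
      mixDisc g X (Matrix.single p.1 p.2 1) * B p.1 p.2 := by
  rw [mixDisc_eq_sum_right, Fintype.sum_prod_type]
  exact Finset.sum_congr rfl fun _ _ => Finset.sum_congr rfl fun _ _ => mul_comm _ _

theorem norm_sum_mul_le_trace {B : Matrix (Fin n) (Fin n) ℂ} (hB : B.PosSemidef)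
    (c : Fin n × Fin n → ℂ) :
    ‖∑ p : Fin n × Fin n, c p * B p.1 p.2‖ ≤ (∑ p, ‖c p‖) * B.trace.re := by
  refine (norm_sum_le _ _).trans ?_
  rw [Finset.sum_mul]
  refine Finset.sum_le_sum fun p _ => ?_
  rw [norm_mul]
  exact mul_le_mul_of_nonneg_left (norm_apply_le_trace hB _ _) (norm_nonneg _)

/-- The `ℓ¹` norm of `∂u`. -/
def gradNorm (u : (Fin n → ℂ) → ℝ) (z : Fin n → ℂ) : ℝ :=
  ∑ k, ‖wirtinger k (fun w => (u w : ℂ)) z‖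

theorem gradNorm_nonneg (u : (Fin n → ℂ) → ℝ) (z : Fin n → ℂ) : 0 ≤ gradNorm u z :=
  Finset.sum_nonneg fun _ _ => norm_nonneg _

theorem wirtingerBar_eq_conj {u : (Fin n → ℂ) → ℝ} {z : Fin n → ℂ} (hu : DifferentiableAt ℝ u z)
    (k : Fin n) : wirtingerBar k (fun w => (u w : ℂ)) z =
      starRingEnd ℂ (wirtinger k (fun w => (u w : ℂ)) z) := by
  rw [wirtingerBar_ofReal hu, wirtinger_ofReal hu]
  simp [Complex.ext_iff]

theorem norm_wirtingerBar_eq {u : (Fin n → ℂ) → ℝ} {z : Fin n → ℂ} (hu : DifferentiableAt ℝ u z)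
    (k : Fin n) : ‖wirtingerBar k (fun w => (u w : ℂ)) z‖ =
      ‖wirtinger k (fun w => (u w : ℂ)) z‖ := by
  rw [wirtingerBar_eq_conj hu, RCLike.norm_conj]

theorem gradNorm_le {u : (Fin n → ℂ) → ℝ} {z : Fin n → ℂ} (hu : DifferentiableAt ℝ u z) :
    gradNorm u z ≤ n * ‖fderiv ℝ u z‖ := by
  have h : ∀ k, ‖wirtinger k (fun w => (u w : ℂ)) z‖ ≤ ‖fderiv ℝ u z‖ := by
    intro k
    have h1 : ∀ c : ℂ, ‖c‖ = 1 → ‖(fderiv ℝ u z (Pi.single k c) : ℂ)‖ ≤ ‖fderiv ℝ u z‖ := by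
      intro c hc
      have := (fderiv ℝ u z).le_opNorm (Pi.single k c)
      rwa [Pi.norm_single, hc, mul_one, ← Complex.norm_real] at this
    rw [wirtinger_ofReal hu, norm_mul]
    have h2 := norm_sub_le (fderiv ℝ u z (Pi.single k 1) : ℂ)
      (Complex.I * (fderiv ℝ u z (Pi.single k Complex.I) : ℂ))
    rw [norm_mul, Complex.norm_I, one_mul] at h2
    have h3 := h1 1 (by simp)
    have h4 := h1 Complex.I (by simp)
    have h5 : ‖(1 / 2 : ℂ)‖ = 1 / 2 := by simp
    rw [h5]
    linarith
  calc gradNorm u z ≤ ∑ _k : Fin n, ‖fderiv ℝ u z‖ := Finset.sum_le_sum fun k _ => h k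
    _ = _ := by simp

theorem norm_fderiv_le_gradNorm {u : (Fin n → ℂ) → ℝ} {z : Fin n → ℂ}
    (hu : DifferentiableAt ℝ u z) : ‖fderiv ℝ u z‖ ≤ 4 * gradNorm u z := by
  refine ContinuousLinearMap.opNorm_le_bound _ (by linarith [gradNorm_nonneg u z]) fun a => ?_
  have h1 : ∀ k, |fderiv ℝ u z (Pi.single k 1)| ≤ 2 * ‖wirtinger k (fun w => (u w : ℂ)) z‖ := by
    intro k
    have := Complex.abs_re_le_norm (wirtinger k (fun w => (u w : ℂ)) z)
    rw [wirtinger_ofReal hu] at this ⊢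
    simp at this ⊢
    exact this
  have h2 : ∀ k, |fderiv ℝ u z (Pi.single k Complex.I)| ≤
      2 * ‖wirtinger k (fun w => (u w : ℂ)) z‖ := by
    intro k
    have := Complex.abs_im_le_norm (wirtinger k (fun w => (u w : ℂ)) z)
    rw [wirtinger_ofReal hu] at this ⊢
    simp at this ⊢
    exact this
  conv_lhs => rw [pi_eq_sum_single_re_im a]
  simp only [map_sum, map_add, map_smul, smul_eq_mul]
  rw [gradNorm, Finset.mul_sum, Finset.sum_mul]
  refine (norm_sum_le _ _).trans (Finset.sum_le_sum fun k _ => ?_)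
  refine (norm_add_le _ _).trans ?_
  rw [norm_mul, norm_mul, Real.norm_eq_abs, Real.norm_eq_abs, Real.norm_eq_abs, Real.norm_eq_abs]
  have h3 : |(a k).re| ≤ ‖a‖ := (Complex.abs_re_le_norm _).trans (norm_le_pi_norm a k)
  have h4 : |(a k).im| ≤ ‖a‖ := (Complex.abs_im_le_norm _).trans (norm_le_pi_norm a k)
  have h5 := mul_le_mul h3 (h1 k) (abs_nonneg _) (norm_nonneg _)
  have h6 := mul_le_mul h4 (h2 k) (abs_nonneg _) (norm_nonneg _)
  linarith

section Coefficients

variable {U : Set (Fin n → ℂ)} {g : (Fin n → ℂ) → Matrix (Fin n) (Fin n) ℂ}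

/-- The first-order part of `√-1 ∂∂̄(u α^{n-2}) ∧ F(B)`. -/
def firstOrder (g : (Fin n → ℂ) → Matrix (Fin n) (Fin n) ℂ) (u : (Fin n → ℂ) → ℝ)
    (B : Matrix (Fin n) (Fin n) ℂ) (z : Fin n → ℂ) : ℂ :=
  ∑ l, ∑ k,
    (wirtingerBar k (fun w => (u w : ℂ)) z *
        wirtinger l (fun w => mixDisc (g w) (Matrix.single l k 1) B) z +
      wirtinger l (fun w => (u w : ℂ)) z *
        wirtingerBar k (fun w => mixDisc (g w) (Matrix.single l k 1) B) z)

/-- The zeroth-order part `√-1 ∂∂̄(α^{n-2}) ∧ F(B)` of `√-1 ∂∂̄(u α^{n-2}) ∧ F(B)`. -/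
def zerothOrder (g : (Fin n → ℂ) → Matrix (Fin n) (Fin n) ℂ)
    (B : Matrix (Fin n) (Fin n) ℂ) (z : Fin n → ℂ) : ℂ :=
  topCoeff n (iDelDelBar (fun w => fundForm (g w) ^ (n - 2)) z * fundForm B)

theorem contDiffOn_ofReal_comp {u : (Fin n → ℂ) → ℝ} (hu : ContDiffOn ℝ ∞ u U) :
    ContDiffOn ℝ ∞ (fun w => (u w : ℂ)) U :=
  Complex.ofRealCLM.contDiff.comp_contDiffOn hu

/-- Leibniz rule for the mixed second derivatives of u times a coefficient of αⁿ⁻². The terms in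
which both derivatives fall on the coefficients reassemble to √-1∂∂̄(αⁿ⁻²). -/
theorem topCoeff_equation (hU : IsOpen U)
    (hg : ∀ i j, ContDiffOn ℝ ∞ (fun z => g z i j) U) {u : (Fin n → ℂ) → ℝ}
    (hu : ContDiffOn ℝ ∞ u U) (B : Matrix (Fin n) (Fin n) ℂ) {z : Fin n → ℂ} (hz : z ∈ U) :
    topCoeff n (iDelDelBar (fun w => (u w : ℂ) • fundForm (g w) ^ (n - 2)) z * fundForm B) =
      mixDisc (g z) (cHess u z) B + firstOrder g u B z + u z * zerothOrder g B z := by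
  rw [topCoeff_iDelDelBar_smul_mul hU hg (contDiffOn_ofReal_comp hu) B hz, zerothOrder,
    topCoeff_iDelDelBar_mul hU hg B hz, mixDisc_eq_sum_left, firstOrder, Finset.mul_sum,
    ← Finset.sum_add_distrib, ← Finset.sum_add_distrib]
  refine Finset.sum_congr rfl fun l _ => ?_
  rw [Finset.mul_sum, ← Finset.sum_add_distrib, ← Finset.sum_add_distrib]
  refine Finset.sum_congr rfl fun k _ => ?_
  rw [wirtinger_wirtingerBar_mul hU (contDiffOn_ofReal_comp hu) (contDiffOn_mixDisc hg _ _) hz]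
  simp only [cHess, Matrix.of_apply]
  ring

/-- A bound for the first-order coefficients. -/
def firstCoeff (g : (Fin n → ℂ) → Matrix (Fin n) (Fin n) ℂ) (z : Fin n → ℂ) : ℝ :=
  ∑ l : Fin n, ∑ k : Fin n, ((∑ p : Fin n × Fin n,
    ‖wirtinger l (fun w => mixDisc (g w) (Matrix.single l k 1) (Matrix.single p.1 p.2 1)) z‖) +
    ∑ p : Fin n × Fin n,
    ‖wirtingerBar k (fun w => mixDisc (g w) (Matrix.single l k 1) (Matrix.single p.1 p.2 1)) z‖)

/-- A bound for the zeroth-order coefficient. -/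
def zerothCoeff (g : (Fin n → ℂ) → Matrix (Fin n) (Fin n) ℂ) (z : Fin n → ℂ) : ℝ :=
  ∑ p : Fin n × Fin n, ‖zerothOrder g (Matrix.single p.1 p.2 1) z‖

theorem continuousOn_firstCoeff (hU : IsOpen U)
    (hg : ∀ i j, ContDiffOn ℝ ∞ (fun z => g z i j) U) : ContinuousOn (firstCoeff g) U := by
  refine continuousOn_finsetSum _ fun l _ => continuousOn_finsetSum _ fun k _ => ?_
  refine ContinuousOn.add (continuousOn_finsetSum _ fun p _ => ?_)
    (continuousOn_finsetSum _ fun p _ => ?_)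
  · exact (ContDiffOn.wirtinger hU (contDiffOn_mixDisc hg _ _) l).continuousOn.norm
  · exact (ContDiffOn.wirtingerBar hU (contDiffOn_mixDisc hg _ _) k).continuousOn.norm

theorem continuousOn_zerothCoeff (hU : IsOpen U)
    (hg : ∀ i j, ContDiffOn ℝ ∞ (fun z => g z i j) U) : ContinuousOn (zerothCoeff g) U := by
  refine continuousOn_finsetSum _ fun p _ => ContinuousOn.norm ?_
  have : ContinuousOn (fun z => ∑ l, ∑ k, wirtinger l (wirtingerBar k fun w =>
      mixDisc (g w) (Matrix.single l k 1) (Matrix.single p.1 p.2 1)) z) U :=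
    continuousOn_finsetSum _ fun l _ => continuousOn_finsetSum _ fun k _ =>
      (ContDiffOn.wirtinger hU (ContDiffOn.wirtingerBar hU
        (contDiffOn_mixDisc hg _ _) k) l).continuousOn
  exact this.congr fun z hz => topCoeff_iDelDelBar_mul hU hg _ hz

theorem norm_firstOrder_le (hU : IsOpen U)
    (hg : ∀ i j, ContDiffOn ℝ ∞ (fun z => g z i j) U) {u : (Fin n → ℂ) → ℝ}
    {z : Fin n → ℂ} (hz : z ∈ U) (hu : DifferentiableAt ℝ u z)
    {B : Matrix (Fin n) (Fin n) ℂ} (hB : B.PosSemidef) :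
    ‖firstOrder g u B z‖ ≤ gradNorm u z * (firstCoeff g z * B.trace.re) := by
  have hd : ∀ (l k : Fin n) (p : Fin n × Fin n), DifferentiableAt ℝ (fun w =>
      mixDisc (g w) (Matrix.single l k 1) (Matrix.single p.1 p.2 1)) z := fun l k p =>
    ContDiffOn.differentiableAt_of_isOpen hU (contDiffOn_mixDisc hg _ _) hz
  rw [firstOrder, firstCoeff, Finset.sum_mul, Finset.mul_sum]
  refine (norm_sum_le _ _).trans (Finset.sum_le_sum fun l _ => ?_)
  rw [Finset.sum_mul, Finset.mul_sum]
  refine (norm_sum_le _ _).trans (Finset.sum_le_sum fun k _ => ?_)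
  refine (norm_add_le _ _).trans ?_
  rw [norm_mul, norm_mul, norm_wirtingerBar_eq hu, add_mul, mul_add]
  have hk : ∀ k, ‖wirtinger k (fun w => (u w : ℂ)) z‖ ≤ gradNorm u z := fun k =>
    Finset.single_le_sum (f := fun k => ‖wirtinger k (fun w => (u w : ℂ)) z‖)
      (fun _ _ => norm_nonneg _) (Finset.mem_univ k)
  refine add_le_add (mul_le_mul (hk k) ?_ (norm_nonneg _) (gradNorm_nonneg u z))
    (mul_le_mul (hk l) ?_ (norm_nonneg _) (gradNorm_nonneg u z))
  · rw [funext fun w => mixDisc_eq_sum_prod (g w) (Matrix.single l k 1) B,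
      wirtinger_sum_mul_const _ _ _ _ fun p _ => hd l k p]
    exact norm_sum_mul_le_trace hB _
  · rw [funext fun w => mixDisc_eq_sum_prod (g w) (Matrix.single l k 1) B,
      wirtingerBar_sum_mul_const _ _ _ _ fun p _ => hd l k p]
    exact norm_sum_mul_le_trace hB _

theorem zerothOrder_eq_sum (B : Matrix (Fin n) (Fin n) ℂ) (z : Fin n → ℂ) :
    zerothOrder g B z =
      ∑ p : Fin n × Fin n, zerothOrder g (Matrix.single p.1 p.2 1) z * B p.1 p.2 := by
  rw [Fintype.sum_prod_type]
  unfold zerothOrder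
  conv_lhs => rw [matrix_eq_sum_smul_single B, ← fundFormLin_apply]
  simp only [map_sum, map_smul, Finset.mul_sum, mul_smul_comm, smul_eq_mul, fundFormLin_apply]
  exact Finset.sum_congr rfl fun _ _ => Finset.sum_congr rfl fun _ _ => mul_comm _ _

theorem norm_zerothOrder_le {B : Matrix (Fin n) (Fin n) ℂ} (hB : B.PosSemidef) (z : Fin n → ℂ) :
    ‖zerothOrder g B z‖ ≤ zerothCoeff g z * B.trace.re := by
  rw [zerothOrder_eq_sum]
  exact norm_sum_mul_le_trace hB _

end Coefficients

/-- The coordinate expression of a Hermitian metric whose astheno-Ricci curvature is nonpositive. -/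
structure LocalMetric (U : Set (Fin n → ℂ)) (g : (Fin n → ℂ) → Matrix (Fin n) (Fin n) ℂ) :
    Prop where
  isOpen : IsOpen U
  smooth : ∀ i j, ContDiffOn ℝ ∞ (fun z => g z i j) U
  posDef : ∀ z ∈ U, (g z).PosDef
  nonpos : ∀ z ∈ U, ∀ ξ : Fin n → ℂ, zerothOrder g (Matrix.vecMulVec ξ (star ξ)) z ≤ 0

/-- The coordinate expression of a solution of the form-type Calabi-Yau equation. -/
structure LocalSolution (U : Set (Fin n → ℂ)) (g : (Fin n → ℂ) → Matrix (Fin n) (Fin n) ℂ)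
    (δ K H b : ℝ) (u : (Fin n → ℂ) → ℝ) : Prop where
  smooth : ContDiffOn ℝ ∞ u U
  le_one : ∀ z ∈ U, u z ≤ 1
  eqn : ∀ z ∈ U, ∃ g₀ W : Matrix (Fin n) (Fin n) ℂ, g₀.PosDef ∧ W.PosDef ∧
    (g₀ - (δ : ℂ) • g z).PosSemidef ∧ ((K : ℂ) • g z - g₀).PosSemidef ∧
    fundForm W ^ (n - 1) = fundForm g₀ ^ (n - 1) +
      iDelDelBar (fun w => (u w : ℂ) • fundForm (g w) ^ (n - 2)) z ∧
    ∃ t : ℝ, |t| ≤ H ∧ fundForm W ^ n = (Real.exp (t + b) : ℂ) • fundForm (g z) ^ n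

/-! ### Uniform bounds for the metric on compact subsets of a chart -/

section Local

variable {U : Set (Fin n → ℂ)} {g : (Fin n → ℂ) → Matrix (Fin n) (Fin n) ℂ}

theorem LocalMetric.zerothOrder_re_nonpos (hg : LocalMetric U g) {z : Fin n → ℂ} (hz : z ∈ U)
    {B : Matrix (Fin n) (Fin n) ℂ} (hB : B.PosSemidef) : (zerothOrder g B z).re ≤ 0 := by
  obtain ⟨R, rfl⟩ := posSemidef_eq_sum_vecMulVec hB
  have : zerothOrder g (∑ j, Matrix.vecMulVec (star (R j)) (R j)) z =
      ∑ j, zerothOrder g (Matrix.vecMulVec (star (R j)) (R j)) z := by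
    simp only [zerothOrder, ← fundFormLin_apply, map_sum, Finset.mul_sum]
  rw [this, Complex.re_sum]
  refine Finset.sum_nonpos fun j _ => ?_
  have := hg.nonpos z hz (star (R j))
  rw [star_star] at this
  exact (Complex.le_def.1 this).1

theorem LocalMetric.exists_bounds (hg : LocalMetric U g) {Kc : Set (Fin n → ℂ)}
    (hK : IsCompact Kc) (hKU : Kc ⊆ U) : ∃ lam : ℝ, 0 < lam ∧ ∃ Λ : ℝ, ∀ z ∈ Kc,
      (g z - (lam : ℂ) • 1).PosSemidef ∧ ((Λ : ℂ) • 1 - g z).PosSemidef := by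
  let q : (Fin n → ℂ) × (Fin n → ℂ) → ℝ := fun p => (star p.2 ⬝ᵥ (g p.1).mulVec p.2).re
  have hq : ContinuousOn q (Kc ×ˢ Metric.sphere 0 1) := by
    apply Complex.continuous_re.comp_continuousOn
    simp only [dotProduct, Matrix.mulVec]
    refine continuousOn_finsetSum _ fun i _ => ContinuousOn.mul ?_
      (continuousOn_finsetSum _ fun j _ => ContinuousOn.mul ?_ ?_)
    · exact (continuous_star.comp ((continuous_apply i).comp continuous_snd)).continuousOn
    · exact ((hg.smooth i j).continuousOn.mono hKU).comp continuousOn_fst fun p hp => hp.1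
    · exact ((continuous_apply j).comp continuous_snd).continuousOn
  have hcomp : IsCompact (Kc ×ˢ Metric.sphere (0 : Fin n → ℂ) 1) :=
    hK.prod (isCompact_sphere 0 1)
  have hpos : ∀ p ∈ Kc ×ˢ Metric.sphere (0 : Fin n → ℂ) 1, 0 < q p := by
    intro p hp
    have h0 : p.2 ≠ 0 := by
      intro h
      have := hp.2
      rw [h] at this
      simp at this
    exact (hg.posDef _ (hKU hp.1)).re_dotProduct_pos h0
  obtain ⟨m, hm0, hm⟩ : ∃ m > 0, ∀ p ∈ Kc ×ˢ Metric.sphere (0 : Fin n → ℂ) 1, m ≤ q p := by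
    rcases (Kc ×ˢ Metric.sphere (0 : Fin n → ℂ) 1).eq_empty_or_nonempty with h | h
    · exact ⟨1, one_pos, by simp [h]⟩
    · obtain ⟨p, hp, hmin⟩ := hcomp.exists_isMinOn h hq
      exact ⟨q p, hpos p hp, fun p' hp' => hmin hp'⟩
  obtain ⟨Λ, hΛ⟩ := hcomp.exists_bound_of_continuousOn hq
  have hnorm : ∀ ξ : Fin n → ℂ, ‖ξ‖ ^ 2 ≤ (star ξ ⬝ᵥ ξ).re ∧ (star ξ ⬝ᵥ ξ).re ≤ n * ‖ξ‖ ^ 2 := by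
    intro ξ
    have h1 : (star ξ ⬝ᵥ ξ).re = ∑ i, ‖ξ i‖ ^ 2 := by
      rw [dotProduct, Complex.re_sum]
      refine Finset.sum_congr rfl fun k _ => ?_
      rw [Pi.star_apply, Complex.star_def, Complex.conj_mul']
      norm_cast
    rw [h1]
    constructor
    · have hS : 0 ≤ ∑ i, ‖ξ i‖ ^ 2 := by positivity
      have h2 : ‖ξ‖ ≤ √(∑ i, ‖ξ i‖ ^ 2) :=
        (pi_norm_le_iff_of_nonneg (Real.sqrt_nonneg _)).2 fun i => Real.le_sqrt_of_sq_le
          (Finset.single_le_sum (f := fun i => ‖ξ i‖ ^ 2) (fun _ _ => by positivity)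
            (Finset.mem_univ i))
      calc ‖ξ‖ ^ 2 ≤ √(∑ i, ‖ξ i‖ ^ 2) ^ 2 := pow_le_pow_left₀ (norm_nonneg _) h2 2
        _ = _ := Real.sq_sqrt hS
    · calc ∑ i, ‖ξ i‖ ^ 2 ≤ ∑ _i : Fin n, ‖ξ‖ ^ 2 := Finset.sum_le_sum fun i _ =>
            pow_le_pow_left₀ (norm_nonneg _) (norm_le_pi_norm ξ i) 2
        _ = _ := by simp
  have hhom : ∀ z ∈ Kc, ∀ ξ : Fin n → ℂ, m * ‖ξ‖ ^ 2 ≤ q (z, ξ) ∧ q (z, ξ) ≤ |Λ| * ‖ξ‖ ^ 2 := by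
    intro z hz ξ
    by_cases hξ : ξ = 0
    · simp [hξ, q]
    have hn : 0 < ‖ξ‖ := norm_pos_iff.2 hξ
    have hs : (((‖ξ‖ : ℂ)⁻¹) • ξ) ∈ Metric.sphere (0 : Fin n → ℂ) 1 := by
      simp [norm_smul, hn.ne']
    have e : q (z, ξ) = ‖ξ‖ ^ 2 * q (z, ((‖ξ‖ : ℂ)⁻¹) • ξ) := by
      simp only [q, Matrix.mulVec_smul, dotProduct_smul, star_smul, smul_dotProduct, smul_eq_mul]
      rw [← Complex.ofReal_inv, Complex.star_def, Complex.conj_ofReal, Complex.re_ofReal_mul,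
        Complex.re_ofReal_mul]
      field_simp
    have h1 := hm (z, _) ⟨hz, hs⟩
    have h2 := (le_abs_self _).trans (hΛ (z, _) ⟨hz, hs⟩)
    have h3 := h2.trans (le_abs_self Λ)
    rw [e]
    constructor <;> nlinarith [sq_nonneg ‖ξ‖]
  have hn1 : (0 : ℝ) < n + 1 := by positivity
  -- The norm on ℂⁿ is the sup norm, so ξ*ξ ≤ n‖ξ‖² and a factor n is lost; n + 1 keeps the
  -- denominator positive for every n.
  obtain ⟨lam, hlam⟩ : ∃ lam : ℝ, lam = m / (n + 1) := ⟨_, rfl⟩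
  obtain ⟨L, hL⟩ : ∃ L : ℝ, L = |Λ| := ⟨_, rfl⟩
  have hlam0 : 0 < lam := hlam ▸ by positivity
  have hL0 : 0 ≤ L := hL ▸ abs_nonneg Λ
  refine ⟨lam, hlam0, L, fun z hz => ⟨?_, ?_⟩⟩
  · have hH : (g z - (lam : ℂ) • 1).IsHermitian :=
      (hg.posDef z (hKU hz)).isHermitian.sub (posSemidef_smul_one hlam0.le).isHermitian
    refine Matrix.PosSemidef.of_dotProduct_mulVec_nonneg hH fun ξ => ?_
    refine Complex.nonneg_iff.2 ⟨?_, (hH.im_star_dotProduct_mulVec_self ξ).symm⟩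
    rw [Matrix.sub_mulVec, dotProduct_sub, Complex.sub_re, Matrix.smul_mulVec, Matrix.one_mulVec,
      dotProduct_smul, smul_eq_mul, Complex.re_ofReal_mul]
    have h1 := (hhom z hz ξ).1
    have h2 := (hnorm ξ).2
    have h3 : lam * (star ξ ⬝ᵥ ξ).re ≤ m * ‖ξ‖ ^ 2 := by
      rw [hlam, div_mul_eq_mul_div, div_le_iff₀ hn1]
      nlinarith [sq_nonneg ‖ξ‖, mul_nonneg hm0.le (sq_nonneg ‖ξ‖)]
    change m * ‖ξ‖ ^ 2 ≤ (star ξ ⬝ᵥ (g z).mulVec ξ).re at h1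
    linarith
  · have hH : ((L : ℂ) • 1 - g z).IsHermitian :=
      (posSemidef_smul_one hL0).isHermitian.sub (hg.posDef z (hKU hz)).isHermitian
    refine Matrix.PosSemidef.of_dotProduct_mulVec_nonneg hH fun ξ => ?_
    refine Complex.nonneg_iff.2 ⟨?_, (hH.im_star_dotProduct_mulVec_self ξ).symm⟩
    rw [Matrix.sub_mulVec, dotProduct_sub, Complex.sub_re, Matrix.smul_mulVec, Matrix.one_mulVec,
      dotProduct_smul, smul_eq_mul, Complex.re_ofReal_mul]
    have h1 := (hhom z hz ξ).2
    have h2 := (hnorm ξ).1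
    rw [← hL] at h1
    change (star ξ ⬝ᵥ (g z).mulVec ξ).re ≤ L * ‖ξ‖ ^ 2 at h1
    nlinarith

end Local

/-! ### Solutions at maximum points and at contact points -/

section Local

variable {U : Set (Fin n → ℂ)} {g : (Fin n → ℂ) → Matrix (Fin n) (Fin n) ℂ}

/-- The scalar form of both equations, in which all the estimates are made: B is free, and the last
two summands are treated as an error. -/
theorem LocalSolution.powDisc_eqn {δ K H b : ℝ} {u : (Fin n → ℂ) → ℝ}
    (hg : LocalMetric U g) (hu : LocalSolution U g δ K H b u) {z : Fin n → ℂ} (hz : z ∈ U) :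
    ∃ g₀ W : Matrix (Fin n) (Fin n) ℂ, g₀.PosDef ∧ W.PosDef ∧
      (g₀ - (δ : ℂ) • g z).PosSemidef ∧ ((K : ℂ) • g z - g₀).PosSemidef ∧
      (∀ B, powDisc W B = powDisc g₀ B + (mixDisc (g z) (cHess u z) B).re +
        ((firstOrder g u B z).re + u z * (zerothOrder g B z).re)) ∧
      ∃ t : ℝ, |t| ≤ H ∧ W.det.re = Real.exp (t + b) * (g z).det.re := by
  obtain ⟨g₀, W, h1, h2, h3, h4, h5, t, ht, h6⟩ := hu.eqn z hz
  refine ⟨g₀, W, h1, h2, h3, h4, fun B => ?_, t, ht, ?_⟩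
  · rw [powDisc, h5, add_mul, map_add, topCoeff_equation hg.isOpen hg.smooth hu.smooth B hz,
      Complex.add_re, Complex.add_re, Complex.add_re, Complex.re_ofReal_mul, powDisc]
    ring
  · have h7 := congrArg (topCoeff n) h6
    rw [map_smul, topCoeff_fundForm_pow, topCoeff_fundForm_pow, smul_eq_mul] at h7
    have h8 : W.det = (Real.exp (t + b) : ℂ) * (g z).det := by
      apply mul_left_cancel₀ (Nat.cast_ne_zero.2 (Nat.factorial_ne_zero n) : (n.factorial : ℂ) ≠ 0)
      rw [h7]; ring
    rw [h8, Complex.re_ofReal_mul]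

theorem LocalMetric.exists_coeff_bound (hg : LocalMetric U g) {Kc : Set (Fin n → ℂ)}
    (hK : IsCompact Kc) (hKU : Kc ⊆ U) : ∃ C : ℝ, 0 < C ∧ ∀ z ∈ Kc,
      firstCoeff g z ≤ C ∧ zerothCoeff g z ≤ C := by
  obtain ⟨C1, h1⟩ := hK.exists_bound_of_continuousOn
    ((continuousOn_firstCoeff hg.isOpen hg.smooth).mono hKU)
  obtain ⟨C2, h2⟩ := hK.exists_bound_of_continuousOn
    ((continuousOn_zerothCoeff hg.isOpen hg.smooth).mono hKU)
  refine ⟨|C1| + |C2| + 1, by positivity, fun z hz => ⟨?_, ?_⟩⟩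
  · linarith [le_abs_self (firstCoeff g z), h1 z hz, Real.norm_eq_abs (firstCoeff g z),
      le_abs_self C1, abs_nonneg C2]
  · linarith [le_abs_self (zerothCoeff g z), h2 z hz, Real.norm_eq_abs (zerothCoeff g z),
      le_abs_self C2, abs_nonneg C1]

theorem exists_det_bounds (hg : LocalMetric U g) {Kc : Set (Fin n → ℂ)}
    (hK : IsCompact Kc) (hKU : Kc ⊆ U) : ∃ d : ℝ, 0 < d ∧ ∃ D : ℝ, 0 < D ∧ ∀ z ∈ Kc,
      d ≤ (g z).det.re ∧ (g z).det.re ≤ D := by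
  have hc : ContinuousOn (fun z => (g z).det.re) Kc := by
    apply Complex.continuous_re.comp_continuousOn
    simp only [Matrix.det_apply]
    exact continuousOn_finsetSum _ fun σ _ => ContinuousOn.const_smul (continuousOn_finsetProd _
      fun i _ => (hg.smooth _ _).continuousOn.mono hKU) _
  have hpos : ∀ z ∈ Kc, 0 < (g z).det.re := fun z hz =>
    (Complex.pos_iff.1 (hg.posDef z (hKU hz)).det_pos).1
  obtain ⟨D, hD⟩ := hK.exists_bound_of_continuousOn hc
  have hD' : ∀ z ∈ Kc, (g z).det.re ≤ |D| + 1 := fun z hz => by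
    linarith [le_abs_self (g z).det.re, hD z hz, Real.norm_eq_abs (g z).det.re, le_abs_self D]
  rcases Kc.eq_empty_or_nonempty with h | h
  · exact ⟨1, one_pos, 1, one_pos, by simp [h]⟩
  · obtain ⟨p, hp, hmin⟩ := hK.exists_isMinOn h hc
    exact ⟨_, hpos p hp, |D| + 1, by positivity, fun z hz => ⟨hmin hz, hD' z hz⟩⟩

/-- Upper bound for the constant `b`, from a point where the Hessian is nonpositive. -/
theorem exists_const_bound (hn : 2 ≤ n) (hg : LocalMetric U g) {Kc : Set (Fin n → ℂ)}
    (hK : IsCompact Kc) (hKU : Kc ⊆ U) (δ K H T : ℝ) : ∃ b₀ : ℝ, ∀ (b : ℝ) (u : (Fin n → ℂ) → ℝ),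
      LocalSolution U g δ K H b u → ∀ z ∈ Kc, fderiv ℝ u z = 0 → (∀ a, rHess u z a a ≤ 0) →
      -T ≤ u z → b ≤ b₀ := by
  obtain ⟨lam, hl, Λ, hb⟩ := hg.exists_bounds hK hKU
  obtain ⟨C, hC0, hC⟩ := hg.exists_coeff_bound hK hKU
  obtain ⟨d, hd, _, _, hdet⟩ := exists_det_bounds hg hK hKU
  -- At the point considered -T ≤ u ≤ 1, hence |u| ≤ |T| + 1; the value of `R` bounds u times the
  -- zeroth-order coefficient tested with g.
  obtain ⟨D, hD⟩ := exists_det_bound hn (Λ := Λ) (K := K) (R := (|T| + 1) * (C * (|Λ| * n))) hl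
  refine ⟨Real.log ((|D| + 1) / d) + H, fun b u hu z hz hgrad hhess hT => ?_⟩
  obtain ⟨g₀, W, h0, hW, -, hK', heq, t, ht, hdetW⟩ := hu.powDisc_eqn hg (hKU hz)
  have hdiff := ContDiffOn.differentiableAt_of_isOpen hg.isOpen hu.smooth (hKU hz)
  have hgz := hg.posDef z (hKU hz)
  have hgn : gradNorm u z = 0 := by
    have := gradNorm_le hdiff
    rw [hgrad, norm_zero, mul_zero] at this
    exact le_antisymm this (gradNorm_nonneg u z)
  have hf : (firstOrder g u (g z) z).re = 0 := by
    have := norm_firstOrder_le hg.isOpen hg.smooth (hKU hz) hdiff hgz.posSemidef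
    rw [hgn, zero_mul] at this
    rw [norm_le_zero_iff.1 this]; rfl
  have hneg : (-(cHess u z)).PosSemidef := by
    have hs : ContDiffOn ℝ ∞ (fun w => -u w) U := hu.smooth.neg
    have e : cHess (fun w => -u w) z = -(cHess u z) := by
      ext l k
      have e2 : ∀ a b, rHess (fun w => -u w) z a b = -rHess u z a b := by
        intro a b
        simp only [rHess, fderiv_fun_neg, neg_apply]
      rw [Matrix.neg_apply, cHess_apply hg.isOpen hs (hKU hz),
        cHess_apply hg.isOpen hu.smooth (hKU hz)]
      simp only [e2]
      push_cast
      ring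
    rw [← e]
    refine cHess_posSemidef hg.isOpen hs (hKU hz) fun a => ?_
    have : rHess (fun w => -u w) z a a = -rHess u z a a := by
      simp only [rHess, fderiv_fun_neg, neg_apply]
    rw [this]
    linarith [hhess a]
  have herr : (firstOrder g u (g z) z).re + u z * (zerothOrder g (g z) z).re ≤
      (|T| + 1) * (C * (|Λ| * n)) := by
    rw [hf, zero_add]
    have h1 := norm_zerothOrder_le (g := g) hgz.posSemidef z
    have h2 : |(zerothOrder g (g z) z).re| ≤ C * (|Λ| * n) := by
      refine (Complex.abs_re_le_norm _).trans (h1.trans ?_)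
      refine mul_le_mul (hC z hz).2 ?_ (re_trace_nonneg hgz.posSemidef) hC0.le
      exact (trace_re_le_of_le (hb z hz).2).trans
        (mul_le_mul_of_nonneg_right (le_abs_self _) (Nat.cast_nonneg _))
    have h3 : |u z| ≤ |T| + 1 := abs_le.2
      ⟨by linarith [le_abs_self T], by linarith [hu.le_one z (hKU hz), abs_nonneg T]⟩
    refine (le_abs_self _).trans ?_
    rw [abs_mul]
    exact mul_le_mul h3 h2 (abs_nonneg _) (by positivity)
  have hWd := hD (g z) g₀ W (cHess u z) _ hgz h0 hW (hb z hz).1 (hb z hz).2 hK' hneg (heq _) herr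
  rw [hdetW] at hWd
  have h4 : Real.exp (t + b) * d ≤ |D| + 1 := by
    have := mul_le_mul_of_nonneg_left (hdet z hz).1 (Real.exp_pos (t + b)).le
    linarith [le_abs_self D]
  have h5 : t + b ≤ Real.log ((|D| + 1) / d) := by
    rw [Real.le_log_iff_exp_le (by positivity), le_div_iff₀ hd]
    exact h4
  linarith [(abs_le.1 ht).1]

/-- Bound for the Hessian at points where a solution touches a paraboloid from above. -/
theorem exists_contact_bound (hn : 2 ≤ n) (hg : LocalMetric U g) {Kc : Set (Fin n → ℂ)}
    (hK : IsCompact Kc) (hKU : Kc ⊆ U) {δ : ℝ} (hδ : 0 < δ) (K H b₀ : ℝ) :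
    ∃ ε : ℝ, 0 < ε ∧ ∃ κ : ℝ, 0 < κ ∧ ∃ C : ℝ, ∀ (b : ℝ) (u : (Fin n → ℂ) → ℝ)
      (z₀ : Fin n → ℂ), b ≤ b₀ →
      LocalSolution U g δ K H b u → ∀ z ∈ Kc, ‖fderiv ℝ u z‖ ≤ κ →
      (∀ a, 0 ≤ rHess (fun w => u w + ε * sqDist z₀ w) z a a) → u z ≤ 0 →
      (cHess (fun w => u w + ε * sqDist z₀ w) z).trace.re ≤ C := by
  obtain ⟨lam, hl, Λ, hb⟩ := hg.exists_bounds hK hKU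
  obtain ⟨C, hC0, hC⟩ := hg.exists_coeff_bound hK hKU
  obtain ⟨_, _, D, hD0, hdet⟩ := exists_det_bounds hg hK hKU
  -- The bound b ≤ b₀ enters here: det W = e^{t+b} det g with |t| ≤ H.
  obtain ⟨ε, hε, κ, hκ, C', hC'⟩ := exists_trace_bound hn (Λ := Λ)
    (D := Real.exp (H + b₀) * D) hl hδ
  have hn0 : (0 : ℝ) < n := by exact_mod_cast (by omega : 0 < n)
  -- The factor n compares `gradNorm` with the operator norm of the derivative, and C bounds the
  -- first-order coefficients; together they make the first-order error at most κ tr B.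
  refine ⟨ε, hε, κ / (n * C), by positivity, C', fun b u z₀ hbb hu z hz hgrad hhess hle => ?_⟩
  obtain ⟨g₀, W, h0, hW, hδ', -, heq, t, ht, hdetW⟩ := hu.powDisc_eqn hg (hKU hz)
  have hdiff := ContDiffOn.differentiableAt_of_isOpen hg.isOpen hu.smooth (hKU hz)
  have hv : ContDiffOn ℝ ∞ (fun w => u w + ε * sqDist z₀ w) U :=
    hu.smooth.add (contDiffOn_const.mul (contDiff_sqDist z₀).contDiffOn)
  have hpsd := cHess_posSemidef hg.isOpen hv (hKU hz) hhess
  rw [cHess_add_sqDist hg.isOpen hu.smooth (hKU hz)] at hpsd ⊢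
  refine hC' (g z) g₀ W (cHess u z) _ (hg.posDef z (hKU hz)) hW (hb z hz).1 (hb z hz).2 hδ' ?_ hpsd
    (fun B _ => heq B) ?_
  · rw [hdetW]
    refine mul_le_mul (Real.exp_le_exp.2 ?_) (hdet z hz).2 ?_ (Real.exp_pos _).le
    · linarith [(abs_le.1 ht).2]
    · exact (Complex.pos_iff.1 (hg.posDef z (hKU hz)).det_pos).1.le
  · intro B hB
    have h1 := norm_firstOrder_le hg.isOpen hg.smooth (hKU hz) hdiff hB
    have h2 := (abs_le.1 (Complex.abs_re_le_norm (firstOrder g u B z))).1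
    have h3 := hg.zerothOrder_re_nonpos (hKU hz) hB
    have h4 : gradNorm u z ≤ κ / C := by
      refine (gradNorm_le hdiff).trans ?_
      calc (n : ℝ) * ‖fderiv ℝ u z‖ ≤ n * (κ / (n * C)) := by gcongr
        _ = κ / C := by field_simp
    have h5 : gradNorm u z * (firstCoeff g z * B.trace.re) ≤ κ / C * (C * B.trace.re) :=
      mul_le_mul h4 (mul_le_mul_of_nonneg_right (hC z hz).1 (re_trace_nonneg hB))
        (mul_nonneg (Finset.sum_nonneg fun _ _ => Finset.sum_nonneg fun _ _ => by positivity)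
          (re_trace_nonneg hB)) (by positivity)
    have h6 : κ / C * (C * B.trace.re) = κ * B.trace.re := by field_simp
    -- The one place where the sign of the curvature matters: both factors are nonpositive, so this
    -- term helps no matter how negative u is.
    have h7 : 0 ≤ u z * (zerothOrder g B z).re := mul_nonneg_of_nonpos_of_nonpos hle h3
    linarith

end Local

/-! ### The gradient estimate for `log (2 - u)` -/

section LogEstimate

variable {U : Set (Fin n → ℂ)} {g : (Fin n → ℂ) → Matrix (Fin n) (Fin n) ℂ}
  {u : (Fin n → ℂ) → ℝ} {z : Fin n → ℂ}

/-- The function `log (2 - u)`. -/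
def logTwoSub (u : (Fin n → ℂ) → ℝ) (z : Fin n → ℂ) : ℝ := Real.log (2 - u z)

theorem contDiffOn_logTwoSub (hu : ContDiffOn ℝ ∞ u U) (h1 : ∀ z ∈ U, u z ≤ 1) :
    ContDiffOn ℝ ∞ (logTwoSub u) U :=
  (contDiffOn_const.sub hu).log fun z hz => by linarith [h1 z hz]

theorem exp_logTwoSub (h1 : u z ≤ 1) : Real.exp (logTwoSub u z) = 2 - u z :=
  Real.exp_log (by linarith)

/-- Differentiate u = 2 - e^w, where w = log(2 - u). -/
theorem fderiv_eq_neg_exp_mul (hU : IsOpen U) (hu : ContDiffOn ℝ ∞ u U) (h1 : ∀ z ∈ U, u z ≤ 1)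
    (hz : z ∈ U) (a : Fin n → ℂ) :
    fderiv ℝ u z a = -(Real.exp (logTwoSub u z) * fderiv ℝ (logTwoSub u) z a) := by
  have hw := ContDiffOn.differentiableAt_of_isOpen hU (contDiffOn_logTwoSub hu h1) hz
  have h2 : u =ᶠ[nhds z] fun x => 2 - Real.exp (logTwoSub u x) := by
    filter_upwards [hU.mem_nhds hz] with x hx
    rw [exp_logTwoSub (h1 x hx)]; ring
  rw [h2.fderiv_eq, (hw.hasFDerivAt.exp.const_sub 2).fderiv]
  simp

theorem rHess_eq_neg_exp_mul (hU : IsOpen U) (hu : ContDiffOn ℝ ∞ u U) (h1 : ∀ z ∈ U, u z ≤ 1)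
    (hz : z ∈ U) (a b : Fin n → ℂ) : rHess u z a b =
      -(Real.exp (logTwoSub u z) * (rHess (logTwoSub u) z a b +
        fderiv ℝ (logTwoSub u) z a * fderiv ℝ (logTwoSub u) z b)) := by
  have hw' := contDiffOn_logTwoSub hu h1
  have hw := ContDiffOn.differentiableAt_of_isOpen hU hw' hz
  have h2 : (fun x => fderiv ℝ u x a) =ᶠ[nhds z] fun x =>
      -(Real.exp (logTwoSub u x) * fderiv ℝ (logTwoSub u) x a) := by
    filter_upwards [hU.mem_nhds hz] with x hx
    exact fderiv_eq_neg_exp_mul hU hu h1 hx a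
  have h3 := (hw.hasFDerivAt.exp.fun_mul
    (differentiableAt_fderiv_apply hU hw' hz a).hasFDerivAt).fun_neg
  rw [rHess, h2.fderiv_eq, h3.fderiv]
  simp [rHess]
  ring

/-- The vector `∂u/∂z_l`. -/
def cGrad (u : (Fin n → ℂ) → ℝ) (z : Fin n → ℂ) : Fin n → ℂ :=
  fun l => wirtinger l (fun w => (u w : ℂ)) z

theorem cHess_eq_neg_exp_smul (hU : IsOpen U) (hu : ContDiffOn ℝ ∞ u U) (h1 : ∀ z ∈ U, u z ≤ 1)
    (hz : z ∈ U) : cHess u z = (-(Real.exp (logTwoSub u z)) : ℂ) • (cHess (logTwoSub u) z +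
      Matrix.vecMulVec (cGrad (logTwoSub u) z) (star (cGrad (logTwoSub u) z))) := by
  have hw' := contDiffOn_logTwoSub hu h1
  have hw := ContDiffOn.differentiableAt_of_isOpen hU hw' hz
  ext l k
  rw [Matrix.smul_apply, Matrix.add_apply, Matrix.vecMulVec_apply, cHess_apply hU hu hz,
    cHess_apply hU hw' hz, Pi.star_apply, Complex.star_def]
  simp only [cGrad]
  rw [← wirtingerBar_eq_conj hw, wirtinger_ofReal hw, wirtingerBar_ofReal hw]
  simp only [rHess_eq_neg_exp_mul hU hu h1 hz, smul_eq_mul]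
  push_cast
  linear_combination (1 / 4 : ℂ) * Complex.exp (logTwoSub u z) *
    (fderiv ℝ (logTwoSub u) z (Pi.single k Complex.I) : ℂ) *
    (fderiv ℝ (logTwoSub u) z (Pi.single l Complex.I) : ℂ) * (-Complex.I_mul_I)

theorem gradNorm_eq_exp_mul (hU : IsOpen U) (hu : ContDiffOn ℝ ∞ u U) (h1 : ∀ z ∈ U, u z ≤ 1)
    (hz : z ∈ U) : gradNorm u z = Real.exp (logTwoSub u z) * gradNorm (logTwoSub u) z := by
  have hw := ContDiffOn.differentiableAt_of_isOpen hU (contDiffOn_logTwoSub hu h1) hz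
  rw [gradNorm, gradNorm, Finset.mul_sum]
  refine Finset.sum_congr rfl fun k _ => ?_
  have : wirtinger k (fun w => (u w : ℂ)) z = -(Real.exp (logTwoSub u z) : ℂ) *
      wirtinger k (fun w => (logTwoSub u w : ℂ)) z := by
    rw [wirtinger_ofReal (ContDiffOn.differentiableAt_of_isOpen hU hu hz), wirtinger_ofReal hw,
      fderiv_eq_neg_exp_mul hU hu h1 hz, fderiv_eq_neg_exp_mul hU hu h1 hz]
    push_cast
    ring
  rw [this, norm_mul, norm_neg, Complex.norm_real, Real.norm_of_nonneg (Real.exp_pos _).le]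

/-- The sum `∑ ‖∂u/∂z_l‖²`. -/
def gradSq (u : (Fin n → ℂ) → ℝ) (z : Fin n → ℂ) : ℝ := ∑ l, ‖cGrad u z l‖ ^ 2

theorem gradSq_nonneg (u : (Fin n → ℂ) → ℝ) (z : Fin n → ℂ) : 0 ≤ gradSq u z :=
  Finset.sum_nonneg fun _ _ => by positivity

/-- Young's inequality in each of the n components. -/
theorem mul_gradNorm_le {C mu t : ℝ} (hmu : 0 < mu) :
    C * (t * gradNorm u z) ≤ mu * (t ^ 2 * gradSq u z) + n * (C ^ 2 / (4 * mu)) := by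
  have h : ∀ k, C * (t * ‖cGrad u z k‖) ≤ mu * (t ^ 2 * ‖cGrad u z k‖ ^ 2) + C ^ 2 / (4 * mu) := by
    intro k
    have e : mu * (t ^ 2 * ‖cGrad u z k‖ ^ 2) + C ^ 2 / (4 * mu) - C * (t * ‖cGrad u z k‖) =
        (2 * mu * (t * ‖cGrad u z k‖) - C) ^ 2 / (4 * mu) := by
      field_simp; ring
    have : 0 ≤ (2 * mu * (t * ‖cGrad u z k‖) - C) ^ 2 / (4 * mu) := by positivity
    linarith
  calc C * (t * gradNorm u z) = ∑ k, C * (t * ‖cGrad u z k‖) := by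
        rw [gradNorm, Finset.mul_sum, Finset.mul_sum]; rfl
    _ ≤ ∑ k, (mu * (t ^ 2 * ‖cGrad u z k‖ ^ 2) + C ^ 2 / (4 * mu)) :=
        Finset.sum_le_sum fun k _ => h k
    _ = _ := by
        rw [Finset.sum_add_distrib, gradSq, Finset.mul_sum, Finset.mul_sum]; simp

theorem trace_vecMulVec_cGrad : (Matrix.vecMulVec (cGrad u z) (star (cGrad u z))).trace.re =
    gradSq u z := by
  rw [Matrix.trace_vecMulVec, dotProduct, Complex.re_sum, gradSq]
  refine Finset.sum_congr rfl fun l _ => ?_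
  rw [Pi.star_apply, Complex.star_def, Complex.mul_conj']
  norm_cast

/-- Test the equation with g itself and use `powDisc W g` ≥ 0. With u = 2 - e^w the Hessian of u is
-e^w(∂∂̄w + ∂w⊗∂̄w), and since e^w ≥ 1 and |u| ≤ 3e^w all remaining terms are O(e^w(1 + |∂w|)).
Divide by e^w and absorb |∂w| in half of the quadratic gradient term. Neither a bound for b nor a
lower bound for u is needed. -/
theorem exists_log_inequality (hn : 2 ≤ n) (hg : LocalMetric U g) {Kc : Set (Fin n → ℂ)}
    (hK : IsCompact Kc) (hKU : Kc ⊆ U) (δ K H : ℝ) :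
    ∃ mu : ℝ, 0 < mu ∧ ∃ C : ℝ, ∀ (b : ℝ) (u : (Fin n → ℂ) → ℝ),
      LocalSolution U g δ K H b u → ∀ z ∈ Kc,
      (mixDisc (g z) (cHess (logTwoSub u) z) (g z)).re + mu * gradSq (logTwoSub u) z ≤ C := by
  obtain ⟨lam, hl, Λ, hb⟩ := hg.exists_bounds hK hKU
  obtain ⟨C, hC0, hC⟩ := hg.exists_coeff_bound hK hKU
  set F : ℝ := ((n - 1).factorial : ℝ)
  set mu := lam ^ (n - 1) / 2 with hmu
  have hmu0 : 0 < mu := by positivity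
  set L : ℝ := |Λ| * n with hL
  set C1 := |K| ^ (n - 1) * (|Λ| ^ (n - 1) * (F * L))
  have hC10 : 0 ≤ C1 := by positivity
  refine ⟨mu, hmu0, C1 + n * ((C * L) ^ 2 / (4 * mu)) + 3 * (C * L), fun b u hu z hz => ?_⟩
  obtain ⟨g₀, W, h0, hW, -, hK', heq, -⟩ := hu.powDisc_eqn hg (hKU hz)
  have hgz := hg.posDef z (hKU hz)
  have hdiff := ContDiffOn.differentiableAt_of_isOpen hg.isOpen hu.smooth (hKU hz)
  set w := logTwoSub u
  have htr0 := re_trace_nonneg hgz.posSemidef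
  have htr : (g z).trace.re ≤ L := (trace_re_le_of_le (hb z hz).2).trans
    (mul_le_mul_of_nonneg_right (le_abs_self _) (Nat.cast_nonneg _))
  have hL0 : 0 ≤ L := htr0.trans htr
  have e1 : powDisc g₀ (g z) ≤ C1 := by
    have a1 : powDisc g₀ (g z) ≤ K ^ (n - 1) * powDisc (g z) (g z) := by
      rw [← powDisc_smul_left]
      exact powDisc_mono_left hn h0.posSemidef hK' hgz.posSemidef
    have a2 := powDisc_le_of_le hn hgz.posSemidef hgz.posSemidef (hb z hz).2
    have a3 := powDisc_nonneg hn hgz.posSemidef hgz.posSemidef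
    have a4 : K ^ (n - 1) ≤ |K| ^ (n - 1) := by rw [← abs_pow]; exact le_abs_self _
    have a5 : Λ ^ (n - 1) ≤ |Λ| ^ (n - 1) := by rw [← abs_pow]; exact le_abs_self _
    calc powDisc g₀ (g z) ≤ |K| ^ (n - 1) * powDisc (g z) (g z) :=
          a1.trans (mul_le_mul_of_nonneg_right a4 a3)
      _ ≤ |K| ^ (n - 1) * (|Λ| ^ (n - 1) * (F * (g z).trace.re)) := by
          refine mul_le_mul_of_nonneg_left (a2.trans ?_) (by positivity)
          exact mul_le_mul_of_nonneg_right a5 (by positivity)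
      _ ≤ |K| ^ (n - 1) * (|Λ| ^ (n - 1) * (F * L)) := by
          exact mul_le_mul_of_nonneg_left (mul_le_mul_of_nonneg_left
            (mul_le_mul_of_nonneg_left htr (Nat.cast_nonneg _)) (by positivity)) (by positivity)
  have e2 : (firstOrder g u (g z) z).re ≤ Real.exp (w z) * (C * L * (1 * gradNorm w z)) := by
    refine (Complex.re_le_norm _).trans
      ((norm_firstOrder_le hg.isOpen hg.smooth (hKU hz) hdiff hgz.posSemidef).trans ?_)
    rw [gradNorm_eq_exp_mul hg.isOpen hu.smooth hu.le_one (hKU hz), one_mul, mul_comm (C * L),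
      ← mul_assoc (Real.exp (w z))]
    exact mul_le_mul_of_nonneg_left (mul_le_mul (hC z hz).1 htr htr0 hC0.le)
      (mul_nonneg (Real.exp_pos _).le (gradNorm_nonneg _ _))
  have hexp : Real.exp (w z) = 2 - u z := exp_logTwoSub (hu.le_one z (hKU hz))
  have hu1 := hu.le_one z (hKU hz)
  have e3 : u z * (zerothOrder g (g z) z).re ≤ Real.exp (w z) * (3 * (C * L)) := by
    have h1 : |(zerothOrder g (g z) z).re| ≤ C * L := (Complex.abs_re_le_norm _).trans
      ((norm_zerothOrder_le hgz.posSemidef z).trans (mul_le_mul (hC z hz).2 htr htr0 hC0.le))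
    have h2 : |u z| ≤ 3 * Real.exp (w z) := by
      rw [hexp, abs_le]; constructor <;> linarith
    refine (le_abs_self _).trans ?_
    rw [abs_mul]
    calc |u z| * |(zerothOrder g (g z) z).re| ≤ 3 * Real.exp (w z) * (C * L) :=
          mul_le_mul h2 h1 (abs_nonneg _) (by positivity)
      _ = _ := by ring
  have e4 := heq (g z)
  have e5 := powDisc_nonneg hn hW.posSemidef hgz.posSemidef
  have hX := Matrix.posSemidef_vecMulVec_self_star (cGrad w z)
  have e6 := le_powDisc_of_le hn hl.le hX (hb z hz).1
  rw [trace_vecMulVec_cGrad] at e6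
  have e7 : (mixDisc (g z) (cHess u z) (g z)).re = -(Real.exp (w z) *
      ((mixDisc (g z) (cHess w z) (g z)).re +
        powDisc (g z) (Matrix.vecMulVec (cGrad w z) (star (cGrad w z))))) := by
    rw [cHess_eq_neg_exp_smul hg.isOpen hu.smooth hu.le_one (hKU hz), mixDisc_smul_left,
      mixDisc_add_left, ← mixDisc_self_right hn, ← Complex.ofReal_neg, Complex.re_ofReal_mul,
      Complex.add_re]
    ring
  have e8 : gradSq w z * (2 * mu) = lam ^ (n - 1) * gradSq w z := by rw [hmu]; ring
  have e9 := mul_gradNorm_le (u := w) (z := z) (C := C * L) (t := 1) hmu0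
  rw [one_pow, one_mul (gradSq w z)] at e9
  have hexp1 : 1 ≤ Real.exp (w z) := by rw [hexp]; linarith
  have e10 : C1 ≤ Real.exp (w z) * C1 := by nlinarith
  have e11 : Real.exp (w z) * ((mixDisc (g z) (cHess w z) (g z)).re +
        powDisc (g z) (Matrix.vecMulVec (cGrad w z) (star (cGrad w z)))) ≤
      Real.exp (w z) * (C1 + C * L * (1 * gradNorm w z) + 3 * (C * L)) := by
    rw [mul_add (Real.exp (w z)) (C1 + _), mul_add (Real.exp (w z)) C1]
    linarith
  have e12 := le_of_mul_le_mul_left e11 (Real.exp_pos _)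
  linarith

/-! ### Integrals of derivatives of compactly supported functions -/

theorem integral_fderiv_eq_zero {f : (Fin n → ℂ) → ℂ} (hf : ContDiff ℝ ∞ f)
    (hc : HasCompactSupport f) (v : Fin n → ℂ) : ∫ z, fderiv ℝ f z v = 0 := by
  have hd : Integrable (fun z => fderiv ℝ f z v) :=
    ((hf.continuous_fderiv (by simp)).clm_apply continuous_const).integrable_of_hasCompactSupport
      (hc.fderiv_apply (𝕜 := ℝ) v)
  have := integral_mul_fderiv_eq_neg_fderiv_mul_of_integrable (μ := volume)
    (f := fun _ : Fin n → ℂ => (1 : ℂ)) (g := f) (v := v) (by simp) (by simpa using hd)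
    (by simpa using hf.continuous.integrable_of_hasCompactSupport hc) (by simp)
    (fun x _ => hf.differentiable (by simp) x)
  simpa using this

theorem integrable_fderiv_apply {f : (Fin n → ℂ) → ℂ} (hf : ContDiff ℝ ∞ f)
    (hc : HasCompactSupport f) (v : Fin n → ℂ) : Integrable (fun z => fderiv ℝ f z v) :=
  ((hf.continuous_fderiv (by simp)).clm_apply continuous_const).integrable_of_hasCompactSupport
    (hc.fderiv_apply (𝕜 := ℝ) v)

theorem integrable_wirtinger {f : (Fin n → ℂ) → ℂ} (hf : ContDiff ℝ ∞ f)
    (hc : HasCompactSupport f) (l : Fin n) : Integrable (wirtinger l f) :=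
  ((integrable_fderiv_apply hf hc _).sub
    ((integrable_fderiv_apply hf hc _).const_mul _)).const_mul _

theorem integral_wirtinger_eq_zero {f : (Fin n → ℂ) → ℂ} (hf : ContDiff ℝ ∞ f)
    (hc : HasCompactSupport f) (l : Fin n) : ∫ z, wirtinger l f z = 0 := by
  unfold wirtinger
  rw [integral_const_mul, integral_sub (integrable_fderiv_apply hf hc _)
    ((integrable_fderiv_apply hf hc _).const_mul _), integral_const_mul,
    integral_fderiv_eq_zero hf hc, integral_fderiv_eq_zero hf hc]
  simp

theorem contDiff_mul_of_tsupport_subset {η F : (Fin n → ℂ) → ℂ} (hU : IsOpen U)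
    (hη : ContDiff ℝ ∞ η) (hs : tsupport η ⊆ U) (hF : ContDiffOn ℝ ∞ F U) :
    ContDiff ℝ ∞ (fun z => η z * F z) := by
  rw [contDiff_iff_contDiffAt]
  intro x
  by_cases hx : x ∈ tsupport η
  · exact hη.contDiffAt.mul (hF.contDiffAt (hU.mem_nhds (hs hx)))
  · have : (fun z => η z * F z) =ᶠ[nhds x] fun _ => 0 := by
      filter_upwards [notMem_tsupport_iff_eventuallyEq.1 hx] with y hy
      rw [hy]; simp
    exact contDiffAt_const.congr_of_eventuallyEq this

end LogEstimate

/-! ### The local integral bound for the gradient of `log (2 - u)` -/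

section GradientIntegral

variable {U : Set (Fin n → ℂ)} {g : (Fin n → ℂ) → Matrix (Fin n) (Fin n) ℂ}

/-- The leading coefficients of the linearized equation. -/
def leadCoeff (g : (Fin n → ℂ) → Matrix (Fin n) (Fin n) ℂ) (l k : Fin n) (z : Fin n → ℂ) : ℂ :=
  mixDisc (g z) (Matrix.single l k 1) (g z)

theorem contDiffOn_leadCoeff (hg : ∀ i j, ContDiffOn ℝ ∞ (fun z => g z i j) U) (l k : Fin n) :
    ContDiffOn ℝ ∞ (leadCoeff g l k) U := by
  have : leadCoeff g l k = fun z => ∑ i, ∑ j,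
      g z i j * mixDisc (g z) (Matrix.single l k 1) (Matrix.single i j 1) :=
    funext fun z => mixDisc_eq_sum_right _ _ _
  rw [this]
  exact ContDiffOn.sum fun i _ => ContDiffOn.sum fun j _ =>
    (hg i j).mul (contDiffOn_mixDisc hg _ _)

/-- The second-order operator is a divergence up to first-order terms. The cutoff enters squared so
that each leftover term still carries a factor η and can be absorbed by η²|∂w|². -/
theorem sum_wirtinger_mul_re {w : (Fin n → ℂ) → ℝ} {η : (Fin n → ℂ) → ℂ} {z : Fin n → ℂ}
    (hU : IsOpen U) (hg : ∀ i j, ContDiffOn ℝ ∞ (fun z => g z i j) U) (hw : ContDiffOn ℝ ∞ w U)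
    (hη : ContDiff ℝ ∞ η) (hz : z ∈ U) :
    ∑ l, ∑ k, wirtinger l (fun x => η x * (η x * leadCoeff g l k x *
        wirtingerBar k (fun w' => (w w' : ℂ)) x)) z =
      η z ^ 2 * mixDisc (g z) (cHess w z) (g z) +
        ∑ l, ∑ k, η z * (2 * wirtinger l η z * leadCoeff g l k z +
          η z * wirtinger l (leadCoeff g l k) z) * wirtingerBar k (fun w' => (w w' : ℂ)) z := by
  rw [mixDisc_eq_sum_left, Finset.mul_sum, ← Finset.sum_add_distrib]
  refine Finset.sum_congr rfl fun l _ => ?_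
  rw [Finset.mul_sum, ← Finset.sum_add_distrib]
  refine Finset.sum_congr rfl fun k _ => ?_
  have hηz : DifferentiableAt ℝ η z := hη.differentiable (by simp) z
  have hS := ContDiffOn.differentiableAt_of_isOpen hU (contDiffOn_leadCoeff hg l k) hz
  have hw' : ContDiffOn ℝ ∞ (fun x => (w x : ℂ)) U := Complex.ofRealCLM.contDiff.comp_contDiffOn hw
  have hv := ContDiffOn.differentiableAt_of_isOpen hU (ContDiffOn.wirtingerBar hU hw' k) hz
  rw [wirtinger_mul l hηz ((hηz.fun_mul hS).fun_mul hv), wirtinger_mul l (hηz.fun_mul hS) hv,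
    wirtinger_mul l hηz hS]
  simp only [cHess, Matrix.of_apply, leadCoeff]
  ring

/-- Multiply the inequality Lw + μ|∂w|² ≤ C by the squared cutoff and integrate: the divergence `Y`
integrates to zero, and the first-order leftovers use up half of the gradient term. -/
theorem exists_lintegral_gradient_bound (hn : 2 ≤ n) (hg : LocalMetric U g) {c : Fin n → ℂ}
    {ρ : ℝ} (hρ : 0 < ρ) (hU : Metric.closedBall c (2 * ρ) ⊆ U) (δ K H : ℝ) :
    ∃ C : ℝ, ∀ (b : ℝ) (u : (Fin n → ℂ) → ℝ), LocalSolution U g δ K H b u →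
      ∫⁻ z in Metric.ball c ρ, ENNReal.ofReal ‖fderiv ℝ (logTwoSub u) z‖ ≤ ENNReal.ofReal C := by
  set Kc := Metric.closedBall c (2 * ρ) with hKc
  have hcomp : IsCompact Kc := isCompact_closedBall _ _
  obtain ⟨mu, hmu, C, hC⟩ := exists_log_inequality hn hg hcomp hU δ K H
  let β : ContDiffBump c := ⟨ρ, 2 * ρ, hρ, by linarith⟩
  set η : (Fin n → ℂ) → ℂ := fun z => (β z : ℂ) with hη
  have hηs : ContDiff ℝ ∞ η := Complex.ofRealCLM.contDiff.comp β.contDiff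
  have hts : tsupport η ⊆ Kc := by
    refine closure_minimal (fun z hz => ?_) Metric.isClosed_closedBall
    have : z ∈ Function.support β := fun h => hz (by simp [hη, h])
    rw [β.support_eq] at this
    exact Metric.ball_subset_closedBall this
  have hηc : HasCompactSupport η := hcomp.of_isClosed_subset (isClosed_tsupport _) hts
  have hbd : ∀ l k : Fin n, ∃ D, ∀ z ∈ Kc, ‖2 * wirtinger l η z * leadCoeff g l k z +
      η z * wirtinger l (leadCoeff g l k) z‖ ≤ D := fun l k => by
    refine hcomp.exists_bound_of_continuousOn ?_
    have h1 := (contDiffOn_leadCoeff hg.smooth l k)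
    have h2 := ContDiffOn.wirtinger hg.isOpen h1 l
    have h3 := ContDiffOn.wirtinger isOpen_univ hηs.contDiffOn l
    exact ((continuousOn_const.mul (h3.continuousOn.mono (Set.subset_univ _))).mul
      (h1.continuousOn.mono hU)).add (hηs.continuous.continuousOn.mul (h2.continuousOn.mono hU))
  choose D hD using hbd
  set E : ℝ := ∑ l, ∑ k, |D l k|
  have hE0 : 0 ≤ E := Finset.sum_nonneg fun _ _ => Finset.sum_nonneg fun _ _ => abs_nonneg _
  -- The first summand comes from `exists_log_inequality`, the second from Young's inequality with
  -- parameter mu/2.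
  set C' : ℝ := |C| + n * (E ^ 2 / (4 * (mu / 2)))
  have hC'0 : 0 ≤ C' := by positivity
  have hvol : volume Kc ≠ ⊤ := hcomp.measure_lt_top.ne
  -- The factor 4 is that of `norm_fderiv_le_gradNorm`, and `gradNorm` is at most n + `gradSq`.
  refine ⟨4 * (n * (volume Kc).toReal + C' * (volume Kc).toReal / (mu / 2)), fun b u hu => ?_⟩
  have hw := contDiffOn_logTwoSub hu.smooth hu.le_one
  set w := logTwoSub u with hwdef
  have hwC : ContDiffOn ℝ ∞ (fun x => (w x : ℂ)) U := Complex.ofRealCLM.contDiff.comp_contDiffOn hw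
  set X : Fin n → Fin n → (Fin n → ℂ) → ℂ := fun l k x => η x * (η x * leadCoeff g l k x *
        wirtingerBar k (fun w' => (w w' : ℂ)) x) with hX
  have hXs : ∀ l k, ContDiff ℝ ∞ (X l k) := fun l k =>
    contDiff_mul_of_tsupport_subset hg.isOpen hηs (hts.trans hU)
      ((hηs.contDiffOn.mul (contDiffOn_leadCoeff hg.smooth l k)).mul
        (ContDiffOn.wirtingerBar hg.isOpen hwC k))
  have hXc : ∀ l k, HasCompactSupport (X l k) := fun l k => hηc.mul_right
  have hXz : ∀ l k, ∀ z ∉ Kc, wirtinger l (X l k) z = 0 := fun l k z hz => by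
    have : X l k =ᶠ[nhds z] fun _ => 0 := by
      filter_upwards [hcomp.isClosed.isOpen_compl.mem_nhds hz] with y hy
      simp only [hX]
      rw [image_eq_zero_of_notMem_tsupport fun h => hy (hts h), zero_mul]
    rw [wirtinger_congr l this]
    simp [wirtinger]
  have hint : ∀ l k, Integrable (wirtinger l (X l k)) := fun l k =>
    integrable_wirtinger (hXs l k) (hXc l k) l
  set Y : (Fin n → ℂ) → ℝ := fun z => (∑ l, ∑ k, wirtinger l (X l k) z).re
  have hYc : Integrable (fun z => ∑ l, ∑ k, wirtinger l (X l k) z) :=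
    integrable_finsetSum _ fun l _ => integrable_finsetSum _ fun k _ => hint l k
  have hYi : Integrable Y := hYc.re
  have hY0 : ∫ z, Y z = 0 := by
    have : ∫ z, Y z = (∫ z, ∑ l, ∑ k, wirtinger l (X l k) z).re := integral_re hYc
    rw [this, integral_finsetSum _ fun l _ => integrable_finsetSum _ fun k _ => hint l k]
    simp only [integral_finsetSum _ fun k _ => hint _ k,
      integral_wirtinger_eq_zero (hXs _ _) (hXc _ _), Finset.sum_const_zero, Complex.zero_re]
  have hpt : ∀ z ∈ Kc, β z ^ 2 * gradSq w z * (mu / 2) + Y z ≤ C' := by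
    intro z hz
    have hzU := hU hz
    have hwd := ContDiffOn.differentiableAt_of_isOpen hg.isOpen hw hzU
    have hb0 : 0 ≤ β z := β.nonneg
    have hb1 : β z ≤ 1 := β.le_one
    have e1 : Y z ≤ β z ^ 2 * (mixDisc (g z) (cHess w z) (g z)).re +
        E * (β z * gradNorm w z) := by
      simp only [Y, hX]
      rw [sum_wirtinger_mul_re hg.isOpen hg.smooth hw hηs hzU, Complex.add_re]
      refine add_le_add (le_of_eq ?_) ((Complex.re_le_norm _).trans ?_)
      · simp only [hη]; rw [← Complex.ofReal_pow, Complex.re_ofReal_mul]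
      · rw [Finset.sum_mul]
        refine (norm_sum_le _ _).trans (Finset.sum_le_sum fun l _ => ?_)
        rw [Finset.sum_mul]
        refine (norm_sum_le _ _).trans (Finset.sum_le_sum fun k _ => ?_)
        rw [norm_mul, norm_mul, norm_wirtingerBar_eq hwd]
        have h1 : ‖η z‖ = β z := by simp [hη, abs_of_nonneg hb0]
        have h2 : ‖wirtinger k (fun w' => (w w' : ℂ)) z‖ ≤ gradNorm w z :=
          Finset.single_le_sum (f := fun k => ‖wirtinger k (fun w' => (w w' : ℂ)) z‖)
            (fun _ _ => norm_nonneg _) (Finset.mem_univ k)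
        rw [h1, mul_comm (β z), mul_assoc]
        exact mul_le_mul ((hD l k z hz).trans (le_abs_self _))
          (mul_le_mul_of_nonneg_left h2 hb0) (by positivity) (abs_nonneg _)
    have e2 := hC b u hu z hz
    have e3 := mul_gradNorm_le (u := w) (z := z) (C := E) (t := β z) (mu := mu / 2) (by positivity)
    have e4 : β z ^ 2 * ((mixDisc (g z) (cHess w z) (g z)).re + mu * gradSq w z) ≤ |C| :=
      calc _ ≤ β z ^ 2 * |C| := mul_le_mul_of_nonneg_left (e2.trans (le_abs_self _)) (by positivity)
        _ ≤ 1 * |C| := mul_le_mul_of_nonneg_right (pow_le_one₀ hb0 hb1) (abs_nonneg _)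
        _ = |C| := one_mul _
    linarith
  have hgc : ContinuousOn (gradSq w) U := by
    have : ∀ l, ContinuousOn (fun z => cGrad w z l) U := fun l =>
      (ContDiffOn.wirtinger hg.isOpen hwC l).continuousOn
    exact continuousOn_finsetSum _ fun l _ => ((this l).norm.pow 2)
  have hgi : IntegrableOn (fun z => β z ^ 2 * gradSq w z) Kc :=
    ((β.continuous.continuousOn.pow 2).mul (hgc.mono hU)).integrableOn_compact hcomp
  have hI : (∫ z in Kc, β z ^ 2 * gradSq w z) * (mu / 2) ≤ C' * (volume Kc).toReal := by
    have hYK : ∫ z in Kc, Y z = 0 := by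
      rw [setIntegral_eq_integral_of_forall_compl_eq_zero, hY0]
      intro z hz
      simp only [Y, hXz _ _ z hz, Finset.sum_const_zero, Complex.zero_re]
    have h1 : ∫ z in Kc, (β z ^ 2 * gradSq w z * (mu / 2) + Y z) ≤ ∫ z in Kc, C' :=
      setIntegral_mono_on ((hgi.mul_const _).add hYi.integrableOn)
        (integrableOn_const hvol) hcomp.measurableSet hpt
    rw [integral_add (hgi.mul_const _) hYi.integrableOn, hYK, add_zero, integral_mul_const,
      setIntegral_const, smul_eq_mul, mul_comm (volume.real Kc)] at h1
    exact h1
  have hsub : Metric.ball c ρ ⊆ Kc := fun z hz => by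
    rw [hKc, Metric.mem_closedBall]; linarith [Metric.mem_ball.1 hz]
  have hI2 : ∫ z in Metric.ball c ρ, ((n : ℝ) + gradSq w z) ≤
      n * (volume Kc).toReal + C' * (volume Kc).toReal / (mu / 2) := by
    have h0 : ∫ z in Metric.ball c ρ, ((n : ℝ) + gradSq w z) =
        ∫ z in Metric.ball c ρ, ((n : ℝ) + β z ^ 2 * gradSq w z) := by
      refine setIntegral_congr_fun measurableSet_ball fun z hz => ?_
      have : β z = 1 := β.one_of_mem_closedBall (Metric.ball_subset_closedBall hz)
      simp [this]
    rw [h0]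
    have hi : IntegrableOn (fun z => (n : ℝ) + β z ^ 2 * gradSq w z) Kc :=
      (integrableOn_const hvol).add hgi
    refine (setIntegral_mono_set hi ?_ hsub.eventuallyLE).trans ?_
    · exact Filter.Eventually.of_forall fun z =>
        add_nonneg (Nat.cast_nonneg _) (mul_nonneg (sq_nonneg _) (gradSq_nonneg _ _))
    · have hc : IntegrableOn (fun _ : Fin n → ℂ => (n : ℝ)) Kc := integrableOn_const hvol
      rw [integral_add hc hgi, setIntegral_const, smul_eq_mul, mul_comm]
      refine add_le_add le_rfl ?_
      rwa [le_div_iff₀ (by positivity)]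
  have hfin : IntegrableOn (fun z => 4 * ((n : ℝ) + gradSq w z)) (Metric.ball c ρ) :=
    ((continuousOn_const.mul (continuousOn_const.add (hgc.mono hU))).integrableOn_compact
      hcomp).mono_set hsub
  calc ∫⁻ z in Metric.ball c ρ, ENNReal.ofReal ‖fderiv ℝ w z‖
      ≤ ∫⁻ z in Metric.ball c ρ, ENNReal.ofReal (4 * (n + gradSq w z)) := by
        refine setLIntegral_mono' measurableSet_ball fun z hz => ENNReal.ofReal_le_ofReal ?_
        have h1 := norm_fderiv_le_gradNorm (ContDiffOn.differentiableAt_of_isOpen hg.isOpen hw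
          (hU (hsub hz)))
        have h2 := mul_gradNorm_le (u := w) (z := z) (C := 1) (t := 1) (mu := 1) one_pos
        have h3 : (n : ℝ) * (1 ^ 2 / (4 * 1)) ≤ n := by
          have : (0 : ℝ) ≤ n := Nat.cast_nonneg _
          linarith
        linarith
    _ = ENNReal.ofReal (∫ z in Metric.ball c ρ, 4 * ((n : ℝ) + gradSq w z)) := by
        rw [ofReal_integral_eq_lintegral_ofReal hfin]
        exact Filter.Eventually.of_forall fun z =>
          mul_nonneg (by norm_num) (add_nonneg (Nat.cast_nonneg _) (gradSq_nonneg _ _))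
    _ ≤ _ := by
        rw [integral_const_mul]
        exact ENNReal.ofReal_le_ofReal (mul_le_mul_of_nonneg_left hI2 (by norm_num))

end GradientIntegral

/-! ### A Poincaré-type inequality for level sets -/

section Poincare

variable {U : Set (Fin n → ℂ)}

/-- Fundamental theorem of calculus along the segment, which stays in the ball and has length at
most 2ρ. The gradient is cut off by zero outside the ball so that it can later be translated over
all of ℂⁿ. -/
theorem enorm_sub_le_lintegral_fderiv {f : (Fin n → ℂ) → ℝ} {c : Fin n → ℂ} {ρ : ℝ}
    (hU : IsOpen U) (hf : ContDiffOn ℝ ∞ f U) (hB : Metric.ball c ρ ⊆ U) {x y : Fin n → ℂ}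
    (hx : x ∈ Metric.ball c ρ) (hy : y ∈ Metric.ball c ρ) :
    ‖f y - f x‖ₑ ≤ ∫⁻ τ in Set.Ioc (0 : ℝ) 1, ENNReal.ofReal (2 * ρ) *
      (Metric.ball c ρ).indicator (fun z => ‖fderiv ℝ f z‖ₑ) (x + τ • (y - x)) := by
  have hmem : ∀ τ ∈ Set.Icc (0 : ℝ) 1, x + τ • (y - x) ∈ Metric.ball c ρ := fun τ hτ =>
    (convex_ball c ρ).add_smul_sub_mem hx hy hτ
  have hd : ∀ τ ∈ Set.uIcc (0 : ℝ) 1, HasDerivAt (fun τ : ℝ => f (x + τ • (y - x)))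
      (fderiv ℝ f (x + τ • (y - x)) (y - x)) τ := by
    intro τ hτ
    rw [Set.uIcc_of_le zero_le_one] at hτ
    have h1 := (ContDiffOn.differentiableAt_of_isOpen hU hf (hB (hmem τ hτ))).hasFDerivAt
    have h2 : HasDerivAt (fun τ : ℝ => x + τ • (y - x)) (y - x) τ := by
      simpa using ((hasDerivAt_id τ).smul_const (y - x)).const_add x
    exact h1.comp_hasDerivAt τ h2
  have hc : ContinuousOn (fun τ : ℝ => fderiv ℝ f (x + τ • (y - x)) (y - x)) (Set.uIcc 0 1) := by
    rw [Set.uIcc_of_le zero_le_one]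
    have h1 : ContinuousOn (fun z => fderiv ℝ f z (y - x)) U :=
      (contDiffOn_fderiv_apply hU hf (y - x)).continuousOn
    exact h1.comp (by fun_prop) fun τ hτ => hB (hmem τ hτ)
  have h3 := intervalIntegral.integral_eq_sub_of_hasDerivAt hd hc.intervalIntegrable
  simp only [one_smul, zero_smul, add_zero, add_sub_cancel] at h3
  rw [← h3, intervalIntegral.integral_of_le zero_le_one]
  refine (enorm_integral_le_lintegral_enorm _).trans ?_
  refine setLIntegral_mono' measurableSet_Ioc fun τ hτ => ?_
  rw [Set.indicator_of_mem (hmem τ ⟨hτ.1.le, hτ.2⟩), mul_comm]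
  refine (ContinuousLinearMap.le_opENorm _ _).trans (mul_le_mul_right ?_ _)
  rw [← ofReal_norm]
  refine ENNReal.ofReal_le_ofReal ?_
  rw [← dist_eq_norm]
  have := dist_triangle_right y x c
  linarith [Metric.mem_ball.1 hx, Metric.mem_ball.1 hy]

/-- For x in the lower and y in the upper set, t ≤ f(y) - f(x) is at most the integral of |∇f| along
the segment. Integrate over x and v = y - x, with ‖v‖ < 2ρ: for fixed v and τ the map x ↦ x + τv
preserves volume, so each pair (v, τ) contributes the full integral of |∇f|. -/
theorem mul_volume_mul_volume_le {f : (Fin n → ℂ) → ℝ} {c : Fin n → ℂ} {ρ : ℝ}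
    (hU : IsOpen U) (hf : ContDiffOn ℝ ∞ f U) (hB : Metric.ball c ρ ⊆ U) (s t : ℝ) :
    ENNReal.ofReal t * (volume {z ∈ Metric.ball c ρ | f z ≤ s} *
        volume {z ∈ Metric.ball c ρ | s + t ≤ f z}) ≤
      ENNReal.ofReal (2 * ρ) * volume (Metric.ball (0 : Fin n → ℂ) (2 * ρ)) *
        ∫⁻ z in Metric.ball c ρ, ‖fderiv ℝ f z‖ₑ := by
  set B := Metric.ball c ρ with hBdef
  set S := {z ∈ B | f z ≤ s}
  set T := {z ∈ B | s + t ≤ f z}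
  set G : (Fin n → ℂ) → ENNReal := B.indicator fun z => ‖fderiv ℝ f z‖ₑ with hG
  have hGm : Measurable G := (measurable_fderiv ℝ f).enorm.indicator measurableSet_ball
  set V := Metric.ball (0 : Fin n → ℂ) (2 * ρ)
  set J : (Fin n → ℂ) → (Fin n → ℂ) → ENNReal := fun x v =>
    ∫⁻ τ in Set.Ioc (0 : ℝ) 1, ENNReal.ofReal (2 * ρ) * G (x + τ • v) with hJ
  have hfc : ContinuousOn f B := hf.continuousOn.mono hB
  have hS : MeasurableSet S := by
    have : S = B \ (B ∩ f ⁻¹' Set.Ioi s) := by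
      ext z; simp only [S, Set.mem_ofPred_eq, Set.mem_sdiff, Set.mem_inter_iff, Set.mem_preimage,
        Set.mem_Ioi]; grind
    rw [this]
    exact measurableSet_ball.diff
      (hfc.isOpen_inter_preimage Metric.isOpen_ball isOpen_Ioi).measurableSet
  have hT : MeasurableSet T := by
    have : T = B \ (B ∩ f ⁻¹' Set.Iio (s + t)) := by
      ext z; simp only [T, Set.mem_ofPred_eq, Set.mem_sdiff, Set.mem_inter_iff, Set.mem_preimage,
        Set.mem_Iio]; grind
    rw [this]
    exact measurableSet_ball.diff
      (hfc.isOpen_inter_preimage Metric.isOpen_ball isOpen_Iio).measurableSet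
  have hJm : Measurable (Function.uncurry J) := by
    refine Measurable.lintegral_prod_right' (ν := volume.restrict (Set.Ioc (0 : ℝ) 1))
      (f := fun p : ((Fin n → ℂ) × (Fin n → ℂ)) × ℝ =>
        ENNReal.ofReal (2 * ρ) * G (p.1.1 + p.2 • p.1.2)) ?_
    exact (hGm.comp (by fun_prop)).const_mul _
  calc ENNReal.ofReal t * (volume S * volume T)
      = ∫⁻ x in S, ∫⁻ y in T, ENNReal.ofReal t := by
        simp only [lintegral_const, Measure.restrict_apply_univ]
        ring
    _ ≤ ∫⁻ x in S, ∫⁻ y, V.indicator (J x) (y - x) := by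
        refine setLIntegral_mono' hS fun x hx => ?_
        rw [← lintegral_indicator hT]
        refine lintegral_mono fun y => ?_
        by_cases hy : y ∈ T
        · rw [Set.indicator_of_mem hy]
          have hV : y - x ∈ V := by
            rw [mem_ball_zero_iff, ← dist_eq_norm]
            have := dist_triangle_right y x c
            linarith [Metric.mem_ball.1 hx.1, Metric.mem_ball.1 hy.1]
          rw [Set.indicator_of_mem hV]
          refine le_trans ?_ (enorm_sub_le_lintegral_fderiv hU hf hB hx.1 hy.1)
          rw [← ofReal_norm]
          refine ENNReal.ofReal_le_ofReal ((?_ : t ≤ f y - f x).trans (le_abs_self _))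
          have h1 := hx.2
          have h2 := hy.2
          linarith
        · rw [Set.indicator_of_notMem hy]; exact zero_le
    _ ≤ ∫⁻ x, ∫⁻ y, V.indicator (J x) (y - x) := setLIntegral_le_lintegral _ _
    _ = ∫⁻ x, ∫⁻ v, V.indicator (J x) v := by
        refine lintegral_congr fun x => ?_
        exact lintegral_sub_right_eq_self (V.indicator (J x)) x
    _ = ∫⁻ x, ∫⁻ v in V, J x v := by
        refine lintegral_congr fun x => ?_
        exact lintegral_indicator (measurableSet_ball : MeasurableSet V) _
    _ = ∫⁻ v in V, ∫⁻ x, J x v := lintegral_lintegral_swap hJm.aemeasurable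
    _ = ∫⁻ v in V, ENNReal.ofReal (2 * ρ) * ∫⁻ z in B, ‖fderiv ℝ f z‖ₑ := by
        refine lintegral_congr fun v => ?_
        simp only [hJ]
        rw [lintegral_lintegral_swap]
        · have : ∀ τ : ℝ, ∫⁻ x, ENNReal.ofReal (2 * ρ) * G (x + τ • v) =
              ENNReal.ofReal (2 * ρ) * ∫⁻ z in B, ‖fderiv ℝ f z‖ₑ := fun τ => by
            have hm : Measurable fun x : Fin n → ℂ => G (x + τ • v) := hGm.comp (by fun_prop)
            rw [lintegral_const_mul _ hm,
              lintegral_add_right_eq_self G (τ • v), hG,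
              lintegral_indicator (measurableSet_ball : MeasurableSet B)]
          simp only [this, lintegral_const, Measure.restrict_apply_univ, Real.volume_Ioc]
          simp
        · exact ((hGm.comp (by fun_prop)).const_mul _).aemeasurable
    _ = _ := by
        rw [lintegral_const, Measure.restrict_apply_univ]
        ring

/-- The super- and sublevel sets of `log (2 - u)` in a ball cannot both be large. -/
theorem exists_level_bound {g : (Fin n → ℂ) → Matrix (Fin n) (Fin n) ℂ} (hn : 2 ≤ n)
    (hg : LocalMetric U g) {c : Fin n → ℂ}
    {ρ : ℝ} (hρ : 0 < ρ) (hU : Metric.closedBall c (2 * ρ) ⊆ U) (δ K H : ℝ) :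
    ∃ C : ℝ, ∀ (b : ℝ) (u : (Fin n → ℂ) → ℝ), LocalSolution U g δ K H b u → ∀ s t : ℝ,
      ENNReal.ofReal t * (volume {z ∈ Metric.ball c ρ | logTwoSub u z ≤ s} *
        volume {z ∈ Metric.ball c ρ | s + t ≤ logTwoSub u z}) ≤ ENNReal.ofReal C := by
  obtain ⟨C, hC⟩ := exists_lintegral_gradient_bound hn hg hρ hU δ K H
  refine ⟨2 * ρ * (volume (Metric.ball (0 : Fin n → ℂ) (2 * ρ))).toReal * C,
    fun b u hu s t => ?_⟩
  have hsub : Metric.ball c ρ ⊆ U := fun z hz => hU (by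
    rw [Metric.mem_closedBall]; linarith [Metric.mem_ball.1 hz])
  refine (mul_volume_mul_volume_le hg.isOpen (contDiffOn_logTwoSub hu.smooth hu.le_one) hsub
    s t).trans ?_
  rw [ENNReal.ofReal_mul (p := 2 * ρ * _) (by positivity),
    ENNReal.ofReal_mul (p := 2 * ρ) (by positivity), ENNReal.ofReal_toReal measure_ball_lt_top.ne]
  refine mul_le_mul_right ?_ _
  simpa only [ofReal_norm] using hC b u hu

end Poincare

/-! ### Contact with paraboloids and the volume estimate near a minimum -/

section ContactSet

variable {U : Set (Fin n → ℂ)} {u : (Fin n → ℂ) → ℝ} {z : Fin n → ℂ}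

/-- A negative second derivative along a line would make the minimum a local maximum on that line as
well. The function would then be locally constant there, with zero second derivative. -/
theorem rHess_nonneg_of_isLocalMin (hU : IsOpen U) (hu : ContDiffOn ℝ ∞ u U) (hz : z ∈ U)
    (h : IsLocalMin u z) (a : Fin n → ℂ) : 0 ≤ rHess u z a a := by
  by_contra! hneg
  set γ : ℝ → (Fin n → ℂ) := fun t => z + t • a with hγ
  have hγd : ∀ t, HasDerivAt γ a t := fun t => by
    have := ((hasDerivAt_id t).smul_const a).const_add z
    rw [one_smul] at this
    exact this
  have hγ0 : γ 0 = z := by simp [hγ]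
  have hγc : Continuous γ := by fun_prop
  have hUn : ∀ᶠ t in nhds (0 : ℝ), γ t ∈ U := hγc.continuousAt.eventually_mem
    (by rw [hγ0]; exact hU.mem_nhds hz)
  have h1 : deriv (u ∘ γ) =ᶠ[nhds 0] fun t => fderiv ℝ u (γ t) a := by
    filter_upwards [hUn] with t ht
    exact ((ContDiffOn.differentiableAt_of_isOpen hU hu ht).hasFDerivAt.comp_hasDerivAt t
      (hγd t)).deriv
  have h2 : deriv (deriv (u ∘ γ)) 0 = rHess u z a a := by
    rw [h1.deriv_eq]
    have h3 : HasFDerivAt (fun w => fderiv ℝ u w a) (fderiv ℝ (fun w => fderiv ℝ u w a) (γ 0))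
        (γ 0) := by
      rw [hγ0]; exact (differentiableAt_fderiv_apply hU hu hz a).hasFDerivAt
    exact (h3.comp_hasDerivAt (0 : ℝ) (hγd 0)).deriv.trans (by rw [hγ0, rHess])
  have hmin : IsLocalMin (u ∘ γ) 0 := by
    have : Filter.Tendsto γ (nhds 0) (nhds z) := by
      simpa [hγ0] using hγc.tendsto 0
    simpa [IsLocalMin, IsMinFilter, hγ0] using this.eventually h
  have hmax : IsLocalMax (u ∘ γ) 0 := by
    refine isLocalMax_of_deriv_deriv_neg (by rw [h2]; exact hneg) hmin.deriv_eq_zero ?_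
    refine ContinuousAt.comp ?_ hγc.continuousAt
    rw [hγ0]
    exact (ContDiffOn.differentiableAt_of_isOpen hU hu hz).continuousAt
  have hconst : u ∘ γ =ᶠ[nhds 0] fun _ => (u ∘ γ) 0 := by
    filter_upwards [hmin, hmax] with t h1 h2 using le_antisymm h2 h1
  have h4 : deriv (u ∘ γ) =ᶠ[nhds 0] fun _ => 0 := by
    have := hconst.deriv
    simpa using this
  have h5 := h4.deriv_eq
  rw [h2] at h5
  simp only [deriv_const] at h5
  linarith

theorem rHess_nonpos_of_isLocalMax (hU : IsOpen U) (hu : ContDiffOn ℝ ∞ u U) (hz : z ∈ U)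
    (h : IsLocalMax u z) (a : Fin n → ℂ) : rHess u z a a ≤ 0 := by
  have h1 := rHess_nonneg_of_isLocalMin hU hu.neg hz h.neg a
  have h2 : rHess (fun w => -u w) z a a = -rHess u z a a := by
    rw [rHess, rHess]
    have : (fun w => fderiv ℝ (fun w => -u w) w a) = fun w => -fderiv ℝ u w a := by
      funext w; rw [fderiv_fun_neg]; rfl
    rw [this, fderiv_fun_neg]; rfl
  linarith

theorem abs_rHess_le (hU : IsOpen U) (hu : ContDiffOn ℝ ∞ u U) (hz : z ∈ U)
    (h : ∀ a, 0 ≤ rHess u z a a) (a b : Fin n → ℂ) :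
    |rHess u z a b| ≤ (rHess u z a a + rHess u z b b) / 2 := by
  have h1 := h (a + b)
  have h2 := h (a - b)
  have h3 := rHess_symm hU hu hz a b
  rw [rHess_eq hU hu hz] at h1 h2 ⊢
  rw [rHess_eq hU hu hz, rHess_eq hU hu hz] at h3
  rw [rHess_eq hU hu hz, rHess_eq hU hu hz]
  simp only [map_add, map_sub, add_apply, sub_apply] at h1 h2
  rw [abs_le]
  constructor <;> linarith

/-- The trace of the complex Hessian is a quarter of the Laplacian, so nonnegativity bounds each
diagonal entry of the real Hessian by 4C; polarization then bounds the other entries. -/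
theorem abs_rHess_apply_le (hU : IsOpen U) (hu : ContDiffOn ℝ ∞ u U) (hz : z ∈ U)
    (h : ∀ a, 0 ≤ rHess u z a a) {C : ℝ} (hC : (cHess u z).trace.re ≤ C) {e : Fin n → ℂ}
    (he : ∃ k, e = Pi.single k 1 ∨ e = Pi.single k Complex.I) (b : Fin n → ℂ) :
    |rHess u z e b| ≤ 8 * n * C * ‖b‖ := by
  rw [cHess_trace_re hU hu hz] at hC
  have hdiag : ∀ e : Fin n → ℂ, (∃ k, e = Pi.single k 1 ∨ e = Pi.single k Complex.I) →
      rHess u z e e ≤ 4 * C := by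
    rintro e ⟨k, hk⟩
    have h1 := Finset.single_le_sum (f := fun l => rHess u z (Pi.single l 1) (Pi.single l 1) +
      rHess u z (Pi.single l Complex.I) (Pi.single l Complex.I))
      (fun l _ => add_nonneg (h _) (h _)) (Finset.mem_univ k)
    have h2 := h (Pi.single k 1)
    have h3 := h (Pi.single k Complex.I)
    rcases hk with rfl | rfl <;> linarith
  have hoff : ∀ e' : Fin n → ℂ, (∃ k, e' = Pi.single k 1 ∨ e' = Pi.single k Complex.I) →
      |rHess u z e e'| ≤ 4 * C := fun e' he' =>
    (abs_rHess_le hU hu hz h e e').trans (by linarith [hdiag e he, hdiag e' he'])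
  have hC0 : 0 ≤ 4 * C := (abs_nonneg _).trans (hoff e he)
  have hexp : rHess u z e b = ∑ l, ((b l).re * rHess u z e (Pi.single l 1) +
      (b l).im * rHess u z e (Pi.single l Complex.I)) := by
    conv_lhs => rw [pi_eq_sum_single_re_im b]
    simp only [rHess, map_sum, map_add, map_smul, smul_eq_mul]
  rw [hexp]
  refine (Finset.abs_sum_le_sum_abs _ _).trans ?_
  calc _ ≤ ∑ l : Fin n, (‖b‖ * (4 * C) + ‖b‖ * (4 * C)) := by
        refine Finset.sum_le_sum fun l _ => (abs_add_le _ _).trans ?_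
        rw [abs_mul, abs_mul]
        exact add_le_add
          (mul_le_mul ((Complex.abs_re_le_norm _).trans (norm_le_pi_norm b l))
            (hoff _ ⟨l, Or.inl rfl⟩) (abs_nonneg _) (norm_nonneg _))
          (mul_le_mul ((Complex.abs_im_le_norm _).trans (norm_le_pi_norm b l))
            (hoff _ ⟨l, Or.inr rfl⟩) (abs_nonneg _) (norm_nonneg _))
    _ = _ := by simp; ring

/-- The map `z ↦ z + ∇u / (2 ε)`, which sends a critical point of `u + ε |z - z₁|²` to `z₁`. -/
def vertexMap (ε : ℝ) (u : (Fin n → ℂ) → ℝ) (z : Fin n → ℂ) : Fin n → ℂ := fun k =>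
  z k + (((1 / (2 * ε)) * fderiv ℝ u z (Pi.single k 1) : ℝ) +
    ((1 / (2 * ε)) * fderiv ℝ u z (Pi.single k Complex.I) : ℝ) * Complex.I)

theorem fderiv_add_sqDist (hU : IsOpen U) (hu : ContDiffOn ℝ ∞ u U) (hz : z ∈ U) (ε : ℝ)
    (z₁ a : Fin n → ℂ) : fderiv ℝ (fun w => u w + ε * sqDist z₁ w) z a = fderiv ℝ u z a +
      ε * ∑ k, 2 * ((z k - z₁ k).re * (a k).re + (z k - z₁ k).im * (a k).im) := by
  have hd := ContDiffOn.differentiableAt_of_isOpen hU hu hz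
  have hq := (contDiff_sqDist z₁).differentiable (by simp) z
  rw [fderiv_fun_add hd (hq.const_mul ε), fderiv_const_mul hq]
  simp only [add_apply, smul_apply, smul_eq_mul,
    fderiv_sqDist]

theorem vertexMap_eq (hU : IsOpen U) (hu : ContDiffOn ℝ ∞ u U) (hz : z ∈ U) {ε : ℝ} (hε : ε ≠ 0)
    {z₁ : Fin n → ℂ} (h : fderiv ℝ (fun w => u w + ε * sqDist z₁ w) z = 0) :
    vertexMap ε u z = z₁ := by
  have h1 : ∀ a, fderiv ℝ u z a =
      -(ε * ∑ k, 2 * ((z k - z₁ k).re * (a k).re + (z k - z₁ k).im * (a k).im)) := fun a => by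
    have := fderiv_add_sqDist hU hu hz ε z₁ a
    rw [h] at this
    simp only [zero_apply] at this
    linarith
  funext k
  have e1 : fderiv ℝ u z (Pi.single k 1) = -(ε * (2 * (z k - z₁ k).re)) := by
    rw [h1, Finset.sum_eq_single k]
    · simp
    · intro j _ hj; simp [hj]
    · simp
  have e2 : fderiv ℝ u z (Pi.single k Complex.I) = -(ε * (2 * (z k - z₁ k).im)) := by
    rw [h1, Finset.sum_eq_single k]
    · simp
    · intro j _ hj; simp [hj]
    · simp
  rw [vertexMap, e1, e2]
  apply Complex.ext
  · simp; field_simp; ring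
  · simp; field_simp; ring

theorem differentiableAt_vertexMap (hU : IsOpen U) (hu : ContDiffOn ℝ ∞ u U) (hz : z ∈ U) {ε : ℝ} :
    DifferentiableAt ℝ (vertexMap ε u) z := by
  rw [differentiableAt_pi]
  intro k
  have h1 := differentiableAt_fderiv_apply hU hu hz (Pi.single k 1)
  have h2 := differentiableAt_fderiv_apply hU hu hz (Pi.single k Complex.I)
  have h3 : DifferentiableAt ℝ (fun z : Fin n → ℂ => z k) z := differentiableAt_apply k z
  exact h3.add ((Complex.ofRealCLM.differentiableAt.comp z (h1.const_mul (1 / (2 * ε)))).add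
    ((Complex.ofRealCLM.differentiableAt.comp z (h2.const_mul (1 / (2 * ε)))).mul_const _))

/-- The identity is 1/(2ε) times the Hessian of ε|z - z₁|², whatever z₁ is. So the derivative of the
vertex map is the Hessian of the shifted function, the one that is controlled at contact points. -/
theorem fderiv_vertexMap (hU : IsOpen U) (hu : ContDiffOn ℝ ∞ u U) (hz : z ∈ U) {ε : ℝ}
    (hε : ε ≠ 0) (z₁ b : Fin n → ℂ) (k : Fin n) : fderiv ℝ (vertexMap ε u) z b k =
      (((1 / (2 * ε)) * rHess (fun w => u w + ε * sqDist z₁ w) z (Pi.single k 1) b : ℝ) : ℂ) +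
      ((1 / (2 * ε)) * rHess (fun w => u w + ε * sqDist z₁ w) z (Pi.single k Complex.I) b : ℝ) *
        Complex.I := by
  have h0 := (differentiableAt_vertexMap hU hu hz (ε := ε)).hasFDerivAt
  have h1 := (differentiableAt_fderiv_apply hU hu hz (Pi.single k 1)).hasFDerivAt
  have h2 := (differentiableAt_fderiv_apply hU hu hz (Pi.single k Complex.I)).hasFDerivAt
  have h3 := (ContinuousLinearMap.proj (R := ℝ) (φ := fun _ : Fin n => ℂ) k).hasFDerivAt (x := z)
  have h4 := h3.add ((Complex.ofRealCLM.hasFDerivAt.comp z (h1.const_mul (1 / (2 * ε)))).add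
    ((Complex.ofRealCLM.hasFDerivAt.comp z (h2.const_mul (1 / (2 * ε)))).mul_const Complex.I))
  have h5 := (hasFDerivAt_pi'.1 h0 k).unique h4
  have h6 := congrArg (fun L => L b) h5
  simp only [rHess_add_sqDist hU hu hz]
  have s1 : ∑ j, 2 * ((b j).re * ((Pi.single k 1 : Fin n → ℂ) j).re +
      (b j).im * ((Pi.single k 1 : Fin n → ℂ) j).im) = 2 * (b k).re := by
    rw [Finset.sum_eq_single k]
    · simp
    · intro j _ hj; simp [hj]
    · simp
  have s2 : ∑ j, 2 * ((b j).re * ((Pi.single k Complex.I : Fin n → ℂ) j).re +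
      (b j).im * ((Pi.single k Complex.I : Fin n → ℂ) j).im) = 2 * (b k).im := by
    rw [Finset.sum_eq_single k]
    · simp
    · intro j _ hj; simp [hj]
    · simp
  rw [s1, s2]
  simp at h6
  rw [h6]
  apply Complex.ext
  · simp [rHess]; field_simp; ring
  · simp [rHess]; field_simp; ring

theorem norm_fderiv_vertexMap_le (hU : IsOpen U) (hu : ContDiffOn ℝ ∞ u U) (hz : z ∈ U) {ε : ℝ}
    (hε : 0 < ε) {z₁ : Fin n → ℂ} {C : ℝ} (hC0 : 0 ≤ C)
    (h : ∀ a, 0 ≤ rHess (fun w => u w + ε * sqDist z₁ w) z a a)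
    (hC : (cHess (fun w => u w + ε * sqDist z₁ w) z).trace.re ≤ C) :
    ‖fderiv ℝ (vertexMap ε u) z‖ ≤ 8 * n * C / ε := by
  have hv : ContDiffOn ℝ ∞ (fun w => u w + ε * sqDist z₁ w) U :=
    hu.add (contDiffOn_const.mul (contDiff_sqDist z₁).contDiffOn)
  refine ContinuousLinearMap.opNorm_le_bound _ (by positivity) fun b => ?_
  refine (pi_norm_le_iff_of_nonneg (by positivity)).2 fun k => ?_
  rw [fderiv_vertexMap hU hu hz hε.ne' z₁]
  refine (norm_add_le _ _).trans ?_
  have h1 := abs_rHess_apply_le hU hv hz h hC ⟨k, Or.inl rfl⟩ b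
  have h2 := abs_rHess_apply_le hU hv hz h hC ⟨k, Or.inr rfl⟩ b
  rw [norm_mul, Complex.norm_I, mul_one, Complex.norm_real, Complex.norm_real, norm_mul, norm_mul,
    Real.norm_of_nonneg (by positivity : 0 ≤ 1 / (2 * ε)), Real.norm_eq_abs, Real.norm_eq_abs]
  calc _ ≤ 1 / (2 * ε) * (8 * n * C * ‖b‖) + 1 / (2 * ε) * (8 * n * C * ‖b‖) := by gcongr
    _ = _ := by field_simp; ring

theorem exists_abs_det_le (D : ℝ) :
    ∃ C : ℝ, ∀ L : (Fin n → ℂ) →L[ℝ] (Fin n → ℂ), ‖L‖ ≤ D → |L.det| ≤ C := by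
  have : ProperSpace ((Fin n → ℂ) →L[ℝ] (Fin n → ℂ)) := FiniteDimensional.proper ℝ _
  obtain ⟨C, hC⟩ := (isCompact_closedBall (0 : (Fin n → ℂ) →L[ℝ] (Fin n → ℂ))
    D).exists_bound_of_continuousOn ContinuousLinearMap.continuous_det.continuousOn
  exact ⟨C, fun L hL => hC L (by simpa using hL)⟩

theorem norm_sq_le_sqDist (z₁ z : Fin n → ℂ) : ‖z - z₁‖ ^ 2 ≤ sqDist z₁ z := by
  have h0 : 0 ≤ sqDist z₁ z := Finset.sum_nonneg fun _ _ => by positivity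
  rw [← Real.sqrt_le_sqrt_iff h0, Real.sqrt_sq (norm_nonneg _),
    pi_norm_le_iff_of_nonneg (Real.sqrt_nonneg _)]
  intro k
  refine Real.le_sqrt_of_sq_le ?_
  rw [← Complex.normSq_eq_norm_sq, Complex.normSq_apply]
  have := Finset.single_le_sum (f := fun k => ((z k - z₁ k).re ^ 2 + (z k - z₁ k).im ^ 2))
    (fun _ _ => by positivity) (Finset.mem_univ k)
  simp only [Pi.sub_apply, sqDist] at this ⊢
  linarith

theorem sqDist_le (z₁ z : Fin n → ℂ) : sqDist z₁ z ≤ n * ‖z - z₁‖ ^ 2 := by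
  calc sqDist z₁ z ≤ ∑ _k : Fin n, ‖z - z₁‖ ^ 2 := by
        refine Finset.sum_le_sum fun k _ => ?_
        have h1 : (z k - z₁ k).re ^ 2 + (z k - z₁ k).im ^ 2 = ‖z k - z₁ k‖ ^ 2 := by
          rw [← Complex.normSq_eq_norm_sq, Complex.normSq_apply]; ring
        rw [h1]
        have := norm_le_pi_norm (z - z₁) k
        rw [Pi.sub_apply] at this
        gcongr
    _ = _ := by simp

/-- Near an interior minimum a solution is close to its minimal value on a set of definite size. -/
theorem exists_volume_sublevel_bound {g : (Fin n → ℂ) → Matrix (Fin n) (Fin n) ℂ} (hn : 2 ≤ n)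
    (hg : LocalMetric U g) {c : Fin n → ℂ} {ρ : ℝ} (hρ : 0 < ρ)
    (hU' : Metric.closedBall c (2 * ρ) ⊆ U) {δ : ℝ} (hδ : 0 < δ) (K H b₀ : ℝ) :
    ∃ m : ENNReal, 0 < m ∧ ∀ (b : ℝ) (u : (Fin n → ℂ) → ℝ), b ≤ b₀ →
      LocalSolution U g δ K H b u → ∀ z₀ ∈ Metric.ball c ρ,
      (∀ z ∈ U, u z₀ ≤ u z) → u z₀ ≤ -1 →
      m ≤ volume {z ∈ Metric.ball c (2 * ρ) | u z ≤ u z₀ + 1} := by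
  have hcomp : IsCompact (Metric.closedBall c (2 * ρ)) := isCompact_closedBall _ _
  obtain ⟨ε, hε, κ, hκ, C, hC⟩ := exists_contact_bound hn hg hcomp hU' hδ K H b₀
  obtain ⟨D, hD⟩ := exists_abs_det_le (n := n) (8 * n * |C| / ε)
  have hn' : (2 : ℝ) ≤ n := by exact_mod_cast hn
  -- The four bounds keep the ball around z₀ inside the doubled ball, make θ² ≤ r below, make the
  -- gradient at contact points at most κ, and keep u within 1 of its minimum there.
  set r : ℝ := min (min (ρ / 2) 1) (min (κ / (8 * n * ε)) (1 / (ε * n))) with hr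
  have hr0 : 0 < r := by positivity
  have hrρ : r ≤ ρ / 2 := (min_le_left _ _).trans (min_le_left _ _)
  have hr1 : r ≤ 1 := (min_le_left _ _).trans (min_le_right _ _)
  have hrκ : 8 * n * ε * r ≤ κ := by
    have : r ≤ κ / (8 * n * ε) := (min_le_right _ _).trans (min_le_left _ _)
    rw [le_div_iff₀ (by positivity)] at this
    linarith
  have hrε : ε * n * r ≤ 1 := by
    have : r ≤ 1 / (ε * n) := (min_le_right _ _).trans (min_le_right _ _)
    rw [le_div_iff₀ (by positivity)] at this
    linarith
  -- A minimum of the shifted function on the sphere of radius r would satisfy |z - z₁|² ≥ (nθ)² >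
  -- nθ² ≥ |z₀ - z₁|², contradicting minimality at z₀. Strictness uses n ≥ 2; the factors n compare
  -- the Euclidean distance with the sup norm.
  set θ : ℝ := r / (2 * n) with hθ
  have hθ0 : 0 < θ := by positivity
  have hrθ : r = 2 * n * θ := by rw [hθ]; field_simp
  have hθr : θ ≤ r := by rw [hrθ]; nlinarith
  set D' : ℝ := |D| + 1
  have hD'0 : 0 < D' := by positivity
  refine ⟨volume (Metric.ball (0 : Fin n → ℂ) θ) / ENNReal.ofReal D', ?_,
    fun b u hb hu z₀ hz₀ hmin hle => ?_⟩
  · exact ENNReal.div_pos (Metric.measure_ball_pos _ _ hθ0).ne' ENNReal.ofReal_ne_top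
  have hballK : Metric.closedBall z₀ r ⊆ Metric.ball c (2 * ρ) := fun z hz => by
    rw [Metric.mem_ball]
    have := dist_triangle z z₀ c
    linarith [Metric.mem_closedBall.1 hz, Metric.mem_ball.1 hz₀]
  have hbK' := hballK.trans Metric.ball_subset_closedBall
  have hbU : Metric.closedBall z₀ r ⊆ U := hbK'.trans hU'
  have hus := hu.smooth
  have hUo := hg.isOpen
  -- P contains the contact points but is cut out by explicit conditions, so its measurability is
  -- clear and the Jacobian bound holds on it by definition.
  set P : Set (Fin n → ℂ) := {z ∈ Metric.ball z₀ r | u z ≤ u z₀ + 1} ∩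
    {z | |(fderiv ℝ (vertexMap ε u) z).det| ≤ D'}
  have hballU : Metric.ball z₀ r ⊆ U := Metric.ball_subset_closedBall.trans hbU
  have hPm : MeasurableSet P := by
    refine MeasurableSet.inter ?_ ?_
    · have : {z ∈ Metric.ball z₀ r | u z ≤ u z₀ + 1} =
          Metric.ball z₀ r \ (Metric.ball z₀ r ∩ u ⁻¹' Set.Ioi (u z₀ + 1)) := by
        ext z; simp only [Set.mem_ofPred_eq, Set.mem_sdiff, Set.mem_inter_iff, Set.mem_preimage,
          Set.mem_Ioi]; grind
      rw [this]
      exact measurableSet_ball.diff ((hus.continuousOn.mono hballU).isOpen_inter_preimage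
        Metric.isOpen_ball isOpen_Ioi).measurableSet
    · exact measurableSet_le
        (continuous_abs.measurable.comp (ContinuousLinearMap.continuous_det.measurable.comp
          (measurable_fderiv ℝ _))) measurable_const
  -- Each z₁ near z₀ is the vertex of a paraboloid -ε|z - z₁|² + const that touches u from below at
  -- an interior point z of the small ball, and the vertex map sends z back to z₁.
  have himg : Metric.ball z₀ θ ⊆ vertexMap ε u '' P := by
    intro z₁ hz₁
    set v : (Fin n → ℂ) → ℝ := fun w => u w + ε * sqDist z₁ w with hvdef
    have hv : ContDiffOn ℝ ∞ v U :=
      hus.add (contDiffOn_const.mul (contDiff_sqDist z₁).contDiffOn)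
    obtain ⟨z, hz, hzmin⟩ := (isCompact_closedBall z₀ r).exists_isMinOn
      ⟨z₀, Metric.mem_closedBall_self hr0.le⟩ (hv.continuousOn.mono hbU)
    have hd1 : ‖z₀ - z₁‖ ≤ θ := by rw [← dist_eq_norm, dist_comm]; exact (Metric.mem_ball.1 hz₁).le
    have hv0 : v z ≤ v z₀ := hzmin (Metric.mem_closedBall_self hr0.le)
    have hq0 : sqDist z₁ z₀ ≤ n * θ ^ 2 := (sqDist_le z₁ z₀).trans (by gcongr)
    have hq1 := norm_sq_le_sqDist z₁ z
    have hu0 := hmin z (hbU hz)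
    simp only [hvdef] at hv0
    have hdz : dist z z₀ < r := by
      refine lt_of_le_of_ne (Metric.mem_closedBall.1 hz) fun heq => ?_
      have h1 : r - θ ≤ ‖z - z₁‖ := by
        rw [← heq, dist_eq_norm]
        have := norm_sub_le (z - z₁) (z₀ - z₁)
        rw [sub_sub_sub_cancel_right] at this
        linarith
      have h2 : n * θ ≤ ‖z - z₁‖ := by nlinarith
      have h3 : (n * θ) ^ 2 ≤ ‖z - z₁‖ ^ 2 := by gcongr
      have h4 : n * θ ^ 2 < (n * θ) ^ 2 := by nlinarith [mul_pos hθ0 hθ0]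
      have h5 : sqDist z₁ z ≤ sqDist z₁ z₀ := by
        by_contra! h
        nlinarith
      linarith
    have hzb : z ∈ Metric.ball z₀ r := hdz
    have hzU := hbU hz
    have hloc : IsLocalMin v z :=
      hzmin.isLocalMin (Filter.mem_of_superset (Metric.isOpen_ball.mem_nhds hzb)
        Metric.ball_subset_closedBall)
    have hdv : fderiv ℝ v z = 0 := hloc.fderiv_eq_zero
    have hH := rHess_nonneg_of_isLocalMin hUo hv hzU hloc
    have hq2 : 0 ≤ sqDist z₁ z := (sq_nonneg _).trans hq1
    have huz : u z ≤ u z₀ + 1 := by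
      have h1 : ε * sqDist z₁ z₀ ≤ 1 := by
        calc ε * sqDist z₁ z₀ ≤ ε * (n * θ ^ 2) := by gcongr
          _ ≤ ε * (n * (r * 1)) := by
              rw [pow_two]
              have := mul_le_mul hθr (hθr.trans hr1) hθ0.le hr0.le
              gcongr
          _ ≤ 1 := by linarith
      have h2 : 0 ≤ ε * sqDist z₁ z := by positivity
      linarith
    have hgrad : ‖fderiv ℝ u z‖ ≤ κ := by
      refine ContinuousLinearMap.opNorm_le_bound _ hκ.le fun a => ?_
      have h1 := fderiv_add_sqDist hUo hus hzU ε z₁ a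
      rw [hdv, zero_apply] at h1
      have h2 : fderiv ℝ u z a =
          -(ε * ∑ k, 2 * ((z k - z₁ k).re * (a k).re + (z k - z₁ k).im * (a k).im)) := by linarith
      have h3 : ‖z - z₁‖ ≤ 2 * r := by
        have := norm_add_le (z - z₀) (z₀ - z₁)
        rw [sub_add_sub_cancel] at this
        rw [dist_eq_norm] at hdz
        linarith
      rw [h2, norm_neg, norm_mul, Real.norm_of_nonneg hε.le]
      calc ε * ‖∑ k, 2 * ((z k - z₁ k).re * (a k).re + (z k - z₁ k).im * (a k).im)‖
          ≤ ε * ∑ _k : Fin n, 2 * (2 * r * ‖a‖ + 2 * r * ‖a‖) := by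
            gcongr
            refine (norm_sum_le _ _).trans (Finset.sum_le_sum fun k _ => ?_)
            have hk : ‖z k - z₁ k‖ ≤ 2 * r := (norm_le_pi_norm (z - z₁) k).trans h3
            have ha := norm_le_pi_norm a k
            rw [norm_mul, Real.norm_of_nonneg (by norm_num : (0 : ℝ) ≤ 2)]
            refine mul_le_mul_of_nonneg_left ((norm_add_le _ _).trans ?_) (by norm_num)
            rw [norm_mul, norm_mul]
            exact add_le_add
              (mul_le_mul ((Complex.abs_re_le_norm _).trans hk)
                ((Complex.abs_re_le_norm _).trans ha) (norm_nonneg _) (by positivity))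
              (mul_le_mul ((Complex.abs_im_le_norm _).trans hk)
                ((Complex.abs_im_le_norm _).trans ha) (norm_nonneg _) (by positivity))
        _ = (8 * n * ε * r) * ‖a‖ := by simp; ring
        _ ≤ κ * ‖a‖ := by gcongr
    have htr := hC b u z₁ hb hu z (hbK' hz) hgrad hH (by linarith)
    refine ⟨z, ⟨⟨hzb, huz⟩, ?_⟩, vertexMap_eq hUo hus hzU hε.ne' hdv⟩
    have h1 := norm_fderiv_vertexMap_le hUo hus hzU hε (abs_nonneg C) hH
      (htr.trans (le_abs_self _))
    exact (hD _ h1).trans ((le_abs_self _).trans (by simp [D']))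
  -- The area inequality: the volume of the covered ball is at most the integral of the Jacobian
  -- over P, so at most D' times the volume of P.
  have hmain := addHaar_image_le_lintegral_abs_det_fderiv (μ := volume) hPm
    (f := vertexMap ε u) (f' := fderiv ℝ (vertexMap ε u)) fun x hx =>
      (differentiableAt_vertexMap hUo hus (hballU hx.1.1)).hasFDerivAt.hasFDerivWithinAt
  refine ENNReal.div_le_of_le_mul ?_
  calc volume (Metric.ball (0 : Fin n → ℂ) θ) = volume (Metric.ball z₀ θ) :=
        (Measure.addHaar_ball_center volume z₀ θ).symm
    _ ≤ volume (vertexMap ε u '' P) := measure_mono himg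
    _ ≤ ∫⁻ x in P, ENNReal.ofReal |(fderiv ℝ (vertexMap ε u) x).det| := hmain
    _ ≤ ∫⁻ x in P, ENNReal.ofReal D' :=
        setLIntegral_mono' hPm fun x hx => ENNReal.ofReal_le_ofReal hx.2
    _ = ENNReal.ofReal D' * volume P := by
        rw [lintegral_const, Measure.restrict_apply_univ]
    _ ≤ ENNReal.ofReal D' * volume {z ∈ Metric.ball c (2 * ρ) | u z ≤ u z₀ + 1} := by
        gcongr
        exact fun z hz => ⟨hballK (Metric.ball_subset_closedBall hz.1.1), hz.1.2⟩
    _ = _ := mul_comm _ _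

end ContactSet

/-! ### Transition maps and smooth functions in charts -/

section Transition

variable {M : Type*} [TopologicalSpace M] [ChartedSpace (Fin n → ℂ) M]
  {e e' : OpenPartialHomeomorph M (Fin n → ℂ)}

theorem contDiffOn_transition [IsManifold 𝓘(ℂ, Fin n → ℂ) ω M]
    (he : e ∈ atlas (Fin n → ℂ) M) (he' : e' ∈ atlas (Fin n → ℂ) M) :
    ContDiffOn ℂ ω (e.symm.trans e') (e.symm.trans e').source := by
  have := (StructureGroupoid.compatible (contDiffGroupoid ω 𝓘(ℂ, Fin n → ℂ)) he he').1
  simpa [contDiffPregroupoid] using this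

variable (n M) in
theorem isManifold_real [IsManifold 𝓘(ℂ, Fin n → ℂ) ω M] :
    IsManifold 𝓘(ℝ, Fin n → ℂ) ∞ M := by
  refine isManifold_of_contDiffOn _ _ _ fun e e' he he' => ?_
  have := ((contDiffOn_transition he he').restrict_scalars ℝ).of_le (n := ω) (m := ∞) le_top
  simpa using this

theorem contDiffOn_comp_symm [IsManifold 𝓘(ℂ, Fin n → ℂ) ω M] {φ : M → ℝ}
    (hφ : ContMDiff 𝓘(ℝ, Fin n → ℂ) 𝓘(ℝ, ℝ) ∞ φ) (he : e ∈ atlas (Fin n → ℂ) M) :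
    ContDiffOn ℝ ∞ (fun z => φ (e.symm z)) e.target := by
  have := isManifold_real n M
  have h1 : ContMDiffOn 𝓘(ℝ, Fin n → ℂ) 𝓘(ℝ, Fin n → ℂ) ∞ e.symm e.target :=
    contMDiffOn_symm_of_mem_maximalAtlas (IsManifold.subset_maximalAtlas he)
  exact contMDiffOn_iff_contDiffOn.1 (hφ.comp_contMDiffOn h1)

/-- The real determinant of a complex-linear map is the norm from ℂ to ℝ of its complex determinant.
-/
theorem det_restrictScalars_eq (L : (Fin n → ℂ) →L[ℂ] (Fin n → ℂ)) :
    (L.restrictScalars ℝ).det = Complex.normSq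
      (Matrix.of fun a i => L (Pi.single i 1) a : Matrix (Fin n) (Fin n) ℂ).det := by
  have h1 : (Matrix.of fun a i => L (Pi.single i 1) a : Matrix (Fin n) (Fin n) ℂ) =
      LinearMap.toMatrix' (L : (Fin n → ℂ) →ₗ[ℂ] (Fin n → ℂ)) := by
    ext a i
    simp [LinearMap.toMatrix'_apply]
  rw [h1, LinearMap.det_toMatrix', ← Algebra.norm_complex_apply, ← LinearMap.det_restrictScalars]
  rfl

end Transition

/-! ### The measure `αⁿ` in charts -/

section Volume

variable {M : Type*} [TopologicalSpace M] [ChartedSpace (Fin n → ℂ) M]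
  {e e' : OpenPartialHomeomorph M (Fin n → ℂ)}

namespace HermitianMetric

/-- The density of `αⁿ` with respect to Lebesgue measure in a chart. -/
def density (α : HermitianMetric n M) (e : OpenPartialHomeomorph M (Fin n → ℂ))
    (z : Fin n → ℂ) : ℝ := 2 ^ n * n.factorial * (α.coeff e z).det.re

theorem density_pos (α : HermitianMetric n M) (he : e ∈ atlas (Fin n → ℂ) M) {z : Fin n → ℂ}
    (hz : z ∈ e.target) : 0 < α.density e z := by
  have := (Complex.pos_iff.1 (α.posDef e he z hz).det_pos).1
  unfold density
  positivity

theorem continuousOn_density (α : HermitianMetric n M) (he : e ∈ atlas (Fin n → ℂ) M) :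
    ContinuousOn (α.density e) e.target := by
  have h1 : ContinuousOn (fun z => (α.coeff e z).det) e.target := by
    simp only [Matrix.det_apply]
    exact continuousOn_finsetSum _ fun σ _ => ContinuousOn.const_smul
      (continuousOn_finsetProd _ fun i _ => (α.smooth e he _ _).continuousOn) _
  exact continuousOn_const.mul (Complex.continuous_re.comp_continuousOn h1)

theorem density_eq (α : HermitianMetric n M) (he : e ∈ atlas (Fin n → ℂ) M)
    (he' : e' ∈ atlas (Fin n → ℂ) M) {z : Fin n → ℂ} (hz : z ∈ (e.symm.trans e').source) :
    α.density e z = Complex.normSq (jacobian (e.symm.trans e') z).det *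
      α.density e' (e' (e.symm z)) := by
  have h1 : ((jacobian (e.symm.trans e') z).map (starRingEnd ℂ)).det =
      (starRingEnd ℂ) (jacobian (e.symm.trans e') z).det := by
    rw [RingHom.map_det]; rfl
  rw [density, density, α.transform e he e' he' z hz, Matrix.det_mul, Matrix.det_mul,
    Matrix.det_transpose, h1]
  have h2 : ∀ a b : ℂ, a * b * (starRingEnd ℂ) a = (Complex.normSq a : ℂ) * b := fun a b => by
    rw [← Complex.mul_conj]; ring
  rw [h2, Complex.re_ofReal_mul]
  ring

variable [MeasurableSpace M]

theorem chartVolume_le_vol (α : HermitianMetric n M) (he : e ∈ atlas (Fin n → ℂ) M) :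
    α.chartVolume e ≤ α.vol :=
  le_iSup₂ (f := fun e (_ : e ∈ atlas (Fin n → ℂ) M) => α.chartVolume e) e he

variable [BorelSpace M]

theorem measurableSet_target_inter_preimage {S : Set M} (hS : MeasurableSet S) :
    MeasurableSet (e.target ∩ e.symm ⁻¹' S) := by
  have h1 : Measurable (e.target.domRestrict e.symm) :=
    (continuousOn_iff_continuous_domRestrict.1 e.continuousOn_symm).measurable
  have h2 := (e.open_target.measurableSet).subtype_image (h1 hS)
  convert h2 using 1
  ext z
  simp only [Set.mem_inter_iff, Set.mem_preimage, Set.mem_image, Subtype.exists]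
  exact ⟨fun h => ⟨z, h.1, h.2, rfl⟩, fun ⟨w, hw, hwS, hwz⟩ => hwz ▸ ⟨hw, hwS⟩⟩

theorem chartVolume_apply (α : HermitianMetric n M) {S : Set M} (hS : MeasurableSet S) :
    α.chartVolume e S = ∫⁻ z in e.target ∩ e.symm ⁻¹' S, ENNReal.ofReal (α.density e z) := by
  have h1 : AEMeasurable e.symm (volume.restrict e.target) :=
    e.continuousOn_symm.aemeasurable e.open_target.measurableSet
  rw [chartVolume, Measure.map_apply_of_aemeasurable
    (h1.mono_ac (withDensity_absolutelyContinuous _ _)) hS, withDensity_apply',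
    Measure.restrict_restrict' e.open_target.measurableSet, Set.inter_comm]
  rfl

/-- Change of variables: the real Jacobian |det J|² of the transition map is exactly the factor by
which det g transforms. -/
theorem chartVolume_eq [IsManifold 𝓘(ℂ, Fin n → ℂ) ω M] (α : HermitianMetric n M)
    (he : e ∈ atlas (Fin n → ℂ) M) (he' : e' ∈ atlas (Fin n → ℂ) M) {S : Set M}
    (hS : MeasurableSet S) (h : S ⊆ e.source) (h' : S ⊆ e'.source) :
    α.chartVolume e' S = α.chartVolume e S := by
  rw [α.chartVolume_apply hS, α.chartVolume_apply hS]
  set τ := e.symm.trans e' with hτ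
  set T := e.target ∩ e.symm ⁻¹' S
  have hTs : T ⊆ τ.source := fun z hz => by
    rw [hτ, OpenPartialHomeomorph.trans_source]
    exact ⟨hz.1, h' hz.2⟩
  have himg : e'.target ∩ e'.symm ⁻¹' S = τ '' T := by
    ext w
    constructor
    · rintro ⟨hw, hwS⟩
      refine ⟨e (e'.symm w), ⟨e.map_source (h hwS), ?_⟩, ?_⟩
      · rw [Set.mem_preimage, e.left_inv (h hwS)]; exact hwS
      · rw [hτ, OpenPartialHomeomorph.coe_trans, Function.comp_apply, e.left_inv (h hwS),
          e'.right_inv hw]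
    · rintro ⟨z, hz, rfl⟩
      have hz' : e.symm z ∈ e'.source := h' hz.2
      refine ⟨e'.map_source hz', ?_⟩
      rw [Set.mem_preimage, hτ, OpenPartialHomeomorph.coe_trans, Function.comp_apply,
        e'.left_inv hz']
      exact hz.2
  have hd : ∀ z ∈ T, HasFDerivAt τ (fderiv ℂ τ z) z := fun z hz =>
    (((contDiffOn_transition he he').differentiableOn (by simp)).differentiableAt
      (τ.open_source.mem_nhds (hTs hz))).hasFDerivAt
  rw [himg, lintegral_image_eq_lintegral_abs_det_fderiv_mul volume
    (measurableSet_target_inter_preimage hS)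
    (fun z hz => ((hd z hz).restrictScalars ℝ).hasFDerivWithinAt) (τ.injOn.mono hTs)]
  refine setLIntegral_congr_fun (measurableSet_target_inter_preimage hS) fun z hz => ?_
  rw [← ENNReal.ofReal_mul (abs_nonneg _), α.density_eq he he' (hTs hz), det_restrictScalars_eq,
    abs_of_nonneg (Complex.normSq_nonneg _)]
  rfl

/-- The supremum is at most any common upper bound. The measure that equals the chart volume of e
and charges every nonempty measurable set disjoint from the source with infinite mass is such a
bound, and it agrees with the chart volume inside the source. -/
theorem vol_eq_chartVolume [IsManifold 𝓘(ℂ, Fin n → ℂ) ω M] (α : HermitianMetric n M)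
    (he : e ∈ atlas (Fin n → ℂ) M) {S : Set M} (h : S ⊆ e.source) :
    α.vol S = α.chartVolume e S := by
  refine le_antisymm ?_ (α.chartVolume_le_vol he S)
  set μ : Measure M := α.chartVolume e + (⊤ : ENNReal) • Measure.count.restrict e.sourceᶜ with hμ
  have hμS : ∀ T ⊆ e.source, μ T = α.chartVolume e T := fun T hT => by
    rw [hμ, Measure.add_apply, Measure.smul_apply,
      Measure.restrict_apply' e.open_source.measurableSet.compl,
      (Set.disjoint_compl_right_iff_subset.2 hT).inter_eq]
    simp
  have hle : α.vol ≤ μ := by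
    refine iSup₂_le fun e' he' => Measure.le_iff.2 fun T hT => ?_
    by_cases hTe : T ⊆ e.source
    · rw [hμS T hTe]
      have h1 : α.chartVolume e' T = α.chartVolume e' (T ∩ e'.source) := by
        rw [α.chartVolume_apply hT, α.chartVolume_apply (hT.inter e'.open_source.measurableSet)]
        congr 2
        ext z
        simp only [Set.mem_inter_iff, Set.mem_preimage]
        exact ⟨fun hz => ⟨hz.1, hz.2, e'.map_target hz.1⟩, fun hz => ⟨hz.1, hz.2.1⟩⟩
      rw [h1, α.chartVolume_eq he he' (hT.inter e'.open_source.measurableSet)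
        (Set.inter_subset_left.trans hTe) Set.inter_subset_right]
      exact measure_mono Set.inter_subset_left
    · obtain ⟨x, hx, hxe⟩ := Set.not_subset.1 hTe
      have h1 : Measure.count.restrict e.sourceᶜ T ≠ 0 := by
        rw [Measure.restrict_apply' e.open_source.measurableSet.compl]
        exact (Measure.count_ne_zero ⟨x, hx, hxe⟩)
      have h2 : μ T = ⊤ := by
        rw [hμ, Measure.add_apply, Measure.smul_apply, smul_eq_mul, ENNReal.top_mul h1, add_top]
      rw [h2]; exact le_top
  exact (hle S).trans (hμS S h).le

/-- On a compact part of a chart, `αⁿ` is comparable with Lebesgue measure. -/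
theorem exists_vol_comparison [IsManifold 𝓘(ℂ, Fin n → ℂ) ω M] (α : HermitianMetric n M)
    (he : e ∈ atlas (Fin n → ℂ) M) {Kc : Set (Fin n → ℂ)} (hK : IsCompact Kc)
    (hKe : Kc ⊆ e.target) :
    ∃ a : ℝ, 0 < a ∧ ∃ A : ℝ, 0 < A ∧ ∀ S : Set M, MeasurableSet S → S ⊆ e.symm '' Kc →
      ENNReal.ofReal a * volume (e.target ∩ e.symm ⁻¹' S) ≤ α.vol S ∧
      α.vol S ≤ ENNReal.ofReal A * volume (e.target ∩ e.symm ⁻¹' S) := by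
  have hc := (α.continuousOn_density he).mono hKe
  obtain ⟨a, ha, hl⟩ : ∃ a : ℝ, 0 < a ∧ ∀ z ∈ Kc, a ≤ α.density e z := by
    rcases Kc.eq_empty_or_nonempty with rfl | hne
    · exact ⟨1, one_pos, by simp⟩
    · obtain ⟨z, hz, hmin⟩ := hK.exists_isMinOn hne hc
      exact ⟨_, α.density_pos he (hKe hz), fun w hw => hmin hw⟩
  obtain ⟨A, hA⟩ := hK.exists_bound_of_continuousOn hc
  refine ⟨a, ha, |A| + 1, by positivity, fun S hS hSK => ?_⟩
  have hsub : ∀ z ∈ e.target ∩ e.symm ⁻¹' S, z ∈ Kc := fun z hz => by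
    obtain ⟨w, hw, hwz⟩ := hSK hz.2
    rwa [← e.symm.injOn (hKe hw) hz.1 hwz]
  have hSe : S ⊆ e.source := fun x hx => by
    obtain ⟨w, hw, rfl⟩ := hSK hx
    exact e.map_target (hKe hw)
  have hm : MeasurableSet (e.target ∩ e.symm ⁻¹' S) := measurableSet_target_inter_preimage hS
  rw [α.vol_eq_chartVolume he hSe, α.chartVolume_apply hS]
  constructor
  · rw [← setLIntegral_const]
    exact setLIntegral_mono' hm fun z hz => ENNReal.ofReal_le_ofReal (hl z (hsub z hz))
  · rw [← setLIntegral_const]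
    refine setLIntegral_mono' hm fun z hz => ENNReal.ofReal_le_ofReal ?_
    have h1 := (le_abs_self _).trans ((hA z (hsub z hz)).trans (le_abs_self A))
    linarith

end HermitianMetric

end Volume

/-! ### The local estimates on the manifold -/

section Global

variable {M : Type*} [TopologicalSpace M]
  {e : OpenPartialHomeomorph M (Fin n → ℂ)}

/-- The preimage of a ball under a chart. -/
def coordBall (e : OpenPartialHomeomorph M (Fin n → ℂ)) (c : Fin n → ℂ) (r : ℝ) : Set M :=
  e.source ∩ e ⁻¹' Metric.ball c r

theorem isOpen_coordBall (e : OpenPartialHomeomorph M (Fin n → ℂ)) (c : Fin n → ℂ) (r : ℝ) :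
    IsOpen (coordBall e c r) :=
  e.isOpen_inter_preimage Metric.isOpen_ball

theorem coordBall_mono (e : OpenPartialHomeomorph M (Fin n → ℂ)) (c : Fin n → ℂ) {r s : ℝ}
    (h : r ≤ s) : coordBall e c r ⊆ coordBall e c s :=
  Set.inter_subset_inter_right _ (Set.preimage_mono (Metric.ball_subset_ball h))

theorem coordBall_subset_image (e : OpenPartialHomeomorph M (Fin n → ℂ)) (c : Fin n → ℂ) (r : ℝ) :
    coordBall e c r ⊆ e.symm '' Metric.closedBall c r := fun x hx =>
  ⟨e x, Metric.ball_subset_closedBall hx.2, e.left_inv hx.1⟩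

theorem target_inter_preimage_coordBall {c : Fin n → ℂ} {r : ℝ}
    (h : Metric.closedBall c r ⊆ e.target) (P : M → Prop) :
    e.target ∩ e.symm ⁻¹' (coordBall e c r ∩ {x | P x}) =
      {z ∈ Metric.ball c r | P (e.symm z)} := by
  ext z
  simp only [coordBall, Set.mem_inter_iff, Set.mem_preimage, Set.mem_ofPred_eq]
  constructor
  · rintro ⟨hz, ⟨-, h2⟩, h3⟩
    rw [e.right_inv hz] at h2
    exact ⟨h2, h3⟩
  · rintro ⟨h1, h2⟩
    have hz := h (Metric.ball_subset_closedBall h1)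
    exact ⟨hz, ⟨e.map_target hz, by rwa [e.right_inv hz]⟩, h2⟩

variable [ChartedSpace (Fin n → ℂ) M]

/-- A continuous function on `M` that solves the form-type Calabi-Yau equation in every chart. -/
structure GlobalSolution (α : HermitianMetric n M) (δ K H b : ℝ) (φ : M → ℝ) : Prop where
  continuous : Continuous φ
  locals : ∀ e ∈ atlas (Fin n → ℂ) M,
    LocalSolution e.target (α.coeff e) δ K H b (fun z => φ (e.symm z))

namespace HermitianMetric

theorem AsthenoRicciNonpos.localMetric {α : HermitianMetric n M} (hα : α.AsthenoRicciNonpos)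
    (hn : 2 ≤ n) (he : e ∈ atlas (Fin n → ℂ) M) : LocalMetric e.target (α.coeff e) where
  isOpen := e.open_target
  smooth := α.smooth e he
  posDef := α.posDef e he
  nonpos z hz ξ := by
    obtain ⟨B, hB, hneg⟩ := hα e he z hz
    exact topCoeff_mul_fundForm_nonpos_of_isHodgeStar hn rfl (α.posDef e he z hz) hB hneg ξ

end HermitianMetric

theorem SolvesFormTypeCY.globalSolution [IsManifold 𝓘(ℂ, Fin n → ℂ) ω M]
    {α ω₀ : HermitianMetric n M} {δ K H b : ℝ} {h φ : M → ℝ} (h0 : α.C0Bounds δ K ω₀)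
    (hH : ∀ x, |h x| ≤ H) (hφ : ContMDiff 𝓘(ℝ, Fin n → ℂ) 𝓘(ℝ, ℝ) ∞ φ)
    (hs : SolvesFormTypeCY α ω₀ h b φ) (h1 : ∀ x, φ x ≤ 1) : GlobalSolution α δ K H b φ where
  continuous := hφ.continuous
  locals e he :=
    { smooth := contDiffOn_comp_symm hφ he
      le_one := fun _ _ => h1 _
      eqn := fun z hz => by
        obtain ⟨ω', hω'⟩ := hs
        obtain ⟨e1, e2⟩ := hω' e he z hz
        exact ⟨ω₀.coeff e z, ω'.coeff e z, ω₀.posDef e he z hz, ω'.posDef e he z hz,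
          (h0 e he z hz).1, (h0 e he z hz).2, e1, h (e.symm z), hH _, e2⟩ }

theorem exists_const_bound_of_isMax {α : HermitianMetric n M}
    {c : Fin n → ℂ} {ρ : ℝ} (hn : 2 ≤ n) (hα : α.AsthenoRicciNonpos)
    (he : e ∈ atlas (Fin n → ℂ) M) (hc : Metric.closedBall c ρ ⊆ e.target)
    (δ K H T : ℝ) : ∃ b₀ : ℝ, ∀ (b : ℝ) (φ : M → ℝ),
      GlobalSolution α δ K H b φ → ∀ x ∈ coordBall e c ρ, (∀ y, φ y ≤ φ x) → -T ≤ φ x →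
      b ≤ b₀ := by
  obtain ⟨b₀, hb⟩ := exists_const_bound hn (hα.localMetric hn he) (isCompact_closedBall c ρ) hc
    δ K H T
  refine ⟨b₀, fun b φ hφ x hx hmax hT => ?_⟩
  have hl := hφ.locals e he
  have hz : e x ∈ e.target := e.map_source hx.1
  have hloc : IsLocalMax (fun z => φ (e.symm z)) (e x) :=
    Filter.Eventually.of_forall fun z => by
      simpa [e.left_inv hx.1] using hmax _
  exact hb b _ hl (e x) (Metric.ball_subset_closedBall hx.2) hloc.fderiv_eq_zero
    (rHess_nonpos_of_isLocalMax e.open_target hl.smooth hz hloc) (by simpa [e.left_inv hx.1])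

theorem exists_closedBall_subset_target (x : M) (k : ℝ) (hk : 0 < k) : ∃ ρ : ℝ, 0 < ρ ∧
    Metric.closedBall (chartAt (Fin n → ℂ) x x) (k * ρ) ⊆ (chartAt (Fin n → ℂ) x).target := by
  obtain ⟨r, hr, h⟩ := Metric.nhds_basis_closedBall.mem_iff.1
    ((chartAt (Fin n → ℂ) x).open_target.mem_nhds (mem_chart_target _ x))
  exact ⟨r / k, by positivity, by rwa [mul_div_cancel₀ _ hk.ne']⟩

variable [MeasurableSpace M] [BorelSpace M]

section Measure

variable [IsManifold 𝓘(ℂ, Fin n → ℂ) ω M] (α : HermitianMetric n M)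

theorem vol_coordBall_lt_top (he : e ∈ atlas (Fin n → ℂ) M) {c : Fin n → ℂ} {r : ℝ}
    (h : Metric.closedBall c r ⊆ e.target) : α.vol (coordBall e c r) < ⊤ := by
  obtain ⟨a, -, A, -, hA⟩ := α.exists_vol_comparison he (isCompact_closedBall c r) h
  refine (hA _ (isOpen_coordBall e c r).measurableSet (coordBall_subset_image e c r)).2.trans_lt
    (ENNReal.mul_lt_top ENNReal.ofReal_lt_top ?_)
  have := target_inter_preimage_coordBall h fun _ => True
  simp only [Set.ofPred_true, Set.inter_univ, and_true] at this
  rw [this]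
  exact measure_ball_lt_top

/-- With compactness this makes `αⁿ` finite; positivity on open sets, shown next, gives overlapping
balls a common part of positive mass. -/
theorem isLocallyFiniteMeasure_vol : IsLocallyFiniteMeasure α.vol := ⟨fun x => by
  obtain ⟨ρ, hρ, h⟩ := exists_closedBall_subset_target (n := n) x 1 one_pos
  refine ⟨coordBall (chartAt _ x) (chartAt _ x x) (1 * ρ), (isOpen_coordBall _ _ _).mem_nhds
    ⟨mem_chart_source _ x, Metric.mem_ball_self (by linarith)⟩,
    vol_coordBall_lt_top α (chart_mem_atlas _ x) h⟩⟩

theorem isOpenPosMeasure_vol : α.vol.IsOpenPosMeasure := ⟨fun O hO ⟨x, hx⟩ => by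
  set e := chartAt (Fin n → ℂ) x
  have he : e ∈ atlas (Fin n → ℂ) M := chart_mem_atlas _ x
  obtain ⟨ρ, hρ, h⟩ := exists_closedBall_subset_target (n := n) x 1 one_pos
  obtain ⟨a, ha, A, -, hA⟩ := α.exists_vol_comparison he (isCompact_closedBall _ _) h
  have hS : IsOpen (coordBall e (e x) (1 * ρ) ∩ O) := (isOpen_coordBall _ _ _).inter hO
  have h1 := (hA _ hS.measurableSet (Set.inter_subset_left.trans
    (coordBall_subset_image _ _ _))).1
  have hxs : x ∈ e.source := mem_chart_source _ x
  have h2 : volume (e.target ∩ e.symm ⁻¹' (coordBall e (e x) (1 * ρ) ∩ O)) ≠ 0 :=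
    ((e.symm.isOpen_inter_preimage hS).measure_ne_zero volume
      ⟨e x, e.map_source hxs, by
        rw [Set.mem_preimage, e.left_inv hxs]
        exact ⟨⟨hxs, Metric.mem_ball_self (by linarith)⟩, hx⟩⟩)
  intro h0
  have h3 : α.vol (coordBall e (e x) (1 * ρ) ∩ O) = 0 := measure_mono_null Set.inter_subset_right h0
  rw [h3, nonpos_iff_eq_zero, mul_eq_zero, ENNReal.ofReal_eq_zero] at h1
  rcases h1 with h1 | h1
  · linarith
  · exact h2 h1⟩

end Measure

section Estimates

variable [IsManifold 𝓘(ℂ, Fin n → ℂ) ω M] {α : HermitianMetric n M} {c : Fin n → ℂ} {ρ : ℝ}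

theorem exists_vol_level_bound (hn : 2 ≤ n) (hα : α.AsthenoRicciNonpos)
    (he : e ∈ atlas (Fin n → ℂ) M) (hρ : 0 < ρ) (hc : Metric.closedBall c (2 * ρ) ⊆ e.target)
    (δ K H : ℝ) : ∃ C : ℝ, ∀ (b : ℝ) (φ : M → ℝ), GlobalSolution α δ K H b φ → ∀ s t : ℝ, 0 ≤ t →
      t * (α.vol.real (coordBall e c ρ ∩ {x | Real.log (2 - φ x) ≤ s}) *
        α.vol.real (coordBall e c ρ ∩ {x | s + t ≤ Real.log (2 - φ x)})) ≤ C := by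
  obtain ⟨C, hC⟩ := exists_level_bound hn (hα.localMetric hn he) hρ hc δ K H
  have hc' : Metric.closedBall c ρ ⊆ e.target :=
    (Metric.closedBall_subset_closedBall (by linarith)).trans hc
  obtain ⟨a, -, A, hA0, hA⟩ := α.exists_vol_comparison he (isCompact_closedBall c ρ) hc'
  refine ⟨A * A * |C|, fun b φ hφ s t ht => ?_⟩
  have hm : Measurable fun x => Real.log (2 - φ x) :=
    Real.measurable_log.comp (measurable_const.sub hφ.continuous.measurable)
  have hB := (isOpen_coordBall e c ρ).measurableSet
  have key : ∀ P : M → Prop, MeasurableSet {x | P x} → α.vol.real (coordBall e c ρ ∩ {x | P x}) ≤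
      A * volume.real {z ∈ Metric.ball c ρ | P (e.symm z)} := fun P hP => by
    have h1 := (hA _ (hB.inter hP) (Set.inter_subset_left.trans
      (coordBall_subset_image _ _ _))).2
    rw [target_inter_preimage_coordBall hc'] at h1
    have hfin : volume {z ∈ Metric.ball c ρ | P (e.symm z)} ≠ ⊤ :=
      measure_ne_top_of_subset (fun z hz => hz.1) measure_ball_lt_top.ne
    have h2 := ENNReal.toReal_mono (ENNReal.mul_ne_top ENNReal.ofReal_ne_top hfin) h1
    rwa [ENNReal.toReal_mul, ENNReal.toReal_ofReal hA0.le] at h2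
  have h1 := key _ (measurableSet_le hm (measurable_const (a := s)))
  have h2 := key _ (measurableSet_le (measurable_const (a := s + t)) hm)
  have h3 := ENNReal.toReal_mono ENNReal.ofReal_ne_top (hC b _ (hφ.locals e he) s t)
  rw [ENNReal.toReal_mul, ENNReal.toReal_mul, ENNReal.toReal_ofReal ht] at h3
  have h4 : (ENNReal.ofReal C).toReal ≤ |C| := by
    rw [ENNReal.toReal_ofReal']
    exact max_le (le_abs_self _) (abs_nonneg _)
  calc _ ≤ t * ((A * volume.real {z ∈ Metric.ball c ρ | Real.log (2 - φ (e.symm z)) ≤ s}) *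
        (A * volume.real {z ∈ Metric.ball c ρ | s + t ≤ Real.log (2 - φ (e.symm z))})) :=
        mul_le_mul_of_nonneg_left (mul_le_mul h1 h2 measureReal_nonneg (by positivity)) ht
    _ = A * A * (t * (volume.real {z ∈ Metric.ball c ρ | Real.log (2 - φ (e.symm z)) ≤ s} *
        volume.real {z ∈ Metric.ball c ρ | s + t ≤ Real.log (2 - φ (e.symm z))})) := by ring
    _ ≤ A * A * |C| := mul_le_mul_of_nonneg_left (h3.trans h4) (by positivity)

theorem exists_vol_sublevel_bound (hn : 2 ≤ n) (hα : α.AsthenoRicciNonpos)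
    (he : e ∈ atlas (Fin n → ℂ) M) (hρ : 0 < ρ) (hc : Metric.closedBall c (2 * ρ) ⊆ e.target)
    {δ : ℝ} (hδ : 0 < δ) (K H b₀ : ℝ) : ∃ m : ℝ, 0 < m ∧ ∀ (b : ℝ) (φ : M → ℝ), b ≤ b₀ →
      GlobalSolution α δ K H b φ → ∀ x ∈ coordBall e c ρ, (∀ y, φ x ≤ φ y) → φ x ≤ -1 →
      m ≤ α.vol.real (coordBall e c (2 * ρ) ∩ {y | φ y ≤ φ x + 1}) := by
  obtain ⟨m, hm, hb⟩ := exists_volume_sublevel_bound hn (hα.localMetric hn he) hρ hc hδ K H b₀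
  obtain ⟨a, ha, A, -, hA⟩ := α.exists_vol_comparison he (isCompact_closedBall c (2 * ρ)) hc
  -- The bound m is an extended number and could be infinite, so it is truncated before passing to
  -- reals.
  refine ⟨(ENNReal.ofReal a * min m 1).toReal, ENNReal.toReal_pos
    (ENNReal.mul_pos (ENNReal.ofReal_pos.2 ha).ne' (lt_min hm one_pos).ne').ne'
    (ENNReal.mul_ne_top ENNReal.ofReal_ne_top (min_lt_of_right_lt ENNReal.one_lt_top).ne),
    fun b φ hbb hφ x hx hmin hle => ?_⟩
  have h1 := hb b _ hbb (hφ.locals e he) (e x) hx.2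
    (fun z _ => by simpa [e.left_inv hx.1] using hmin _) (by simpa [e.left_inv hx.1] using hle)
  simp only [e.left_inv hx.1] at h1
  have hS : MeasurableSet (coordBall e c (2 * ρ) ∩ {y | φ y ≤ φ x + 1}) :=
    (isOpen_coordBall _ _ _).measurableSet.inter
      (measurableSet_le hφ.continuous.measurable measurable_const)
  have h2 := (hA _ hS (Set.inter_subset_left.trans (coordBall_subset_image _ _ _))).1
  rw [target_inter_preimage_coordBall hc] at h2
  refine ENNReal.toReal_mono ?_ ((mul_le_mul_right ((min_le_left _ _).trans h1) _).trans h2)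
  exact measure_ne_top_of_subset Set.inter_subset_left (vol_coordBall_lt_top α he hc).ne

end Estimates

end Global

/-- The integrand is at most e where φ ≥ -T and at most e^{-T} elsewhere; so a fixed value of the
integral forces {φ ≥ -T} to have definite mass once T is large. -/
theorem integral_exp_le {X : Type*} [MeasurableSpace X] {μ : Measure X} [IsFiniteMeasure μ]
    {φ : X → ℝ} (hφ : Measurable φ) (h1 : ∀ x, φ x ≤ 1) (T : ℝ) :
    ∫ x, Real.exp (φ x) ∂μ ≤
      Real.exp 1 * μ.real {x | -T ≤ φ x} + Real.exp (-T) * μ.real Set.univ := by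
  have hm : MeasurableSet {x | -T ≤ φ x} := measurableSet_le measurable_const hφ
  have hi : Integrable (fun x => {x | -T ≤ φ x}.indicator (fun _ => Real.exp 1) x) μ :=
    (integrable_const _).indicator hm
  calc ∫ x, Real.exp (φ x) ∂μ
      ≤ ∫ x, ({x | -T ≤ φ x}.indicator (fun _ => Real.exp 1) x + Real.exp (-T)) ∂μ := by
        refine integral_mono (Integrable.of_bound (Real.measurable_exp.comp
          hφ).aestronglyMeasurable (Real.exp 1) (Filter.Eventually.of_forall fun x => ?_))
          (hi.add (integrable_const _)) fun x => ?_
        · rw [Real.norm_of_nonneg (Real.exp_pos _).le]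
          exact Real.exp_le_exp.2 (h1 x)
        · by_cases hx : -T ≤ φ x
          · simp only
            rw [Set.indicator_of_mem (by exact hx)]
            linarith [Real.exp_le_exp.2 (h1 x), Real.exp_pos (-T)]
          · simp only
            rw [Set.indicator_of_notMem (by exact hx), zero_add]
            exact Real.exp_le_exp.2 (not_le.1 hx).le
    _ = _ := by
        rw [integral_add hi (integrable_const _), integral_indicator_const _ hm, integral_const,
          smul_eq_mul, smul_eq_mul, mul_comm, mul_comm (μ.real Set.univ)]

/-! ### Passing sublevel sets through overlapping balls -/

section Propagation

variable {X : Type*} [TopologicalSpace X] [MeasurableSpace X]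
  {μ : Measure X} [IsFiniteMeasure μ] [μ.IsOpenPosMeasure] {W : X → Set X} {F : Set (X → ℝ)}

/-- A large sublevel set in W x forces a sufficiently high superlevel set to fill at most half of
the overlap. The rest of the overlap is a sublevel set inside W y. The constants do not depend on
the function w in the family. -/
theorem exists_sublevel_of_inter_nonempty (hW : ∀ x, IsOpen (W x))
    (hC : ∀ x, ∃ C : ℝ, ∀ w ∈ F, ∀ s t : ℝ, 0 ≤ t →
      t * (μ.real (W x ∩ {y | w y ≤ s}) * μ.real (W x ∩ {y | s + t ≤ w y})) ≤ C)
    {x y : X} (hxy : (W x ∩ W y).Nonempty) (s : ℝ) {κ : ℝ} (hκ : 0 < κ) :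
    ∃ s' : ℝ, ∃ κ' : ℝ, 0 < κ' ∧ ∀ w ∈ F, κ ≤ μ.real (W x ∩ {z | w z ≤ s}) →
      κ' ≤ μ.real (W y ∩ {z | w z ≤ s'}) := by
  obtain ⟨C, hC⟩ := hC x
  have hv : 0 < μ.real (W x ∩ W y) :=
    ENNReal.toReal_pos (((hW x).inter (hW y)).measure_ne_zero μ hxy) (measure_ne_top _ _)
  set v := μ.real (W x ∩ W y)
  -- Chosen so that t κ (v/2) = |C|; raising the level by t + 1 then contradicts the level set bound
  -- strictly.
  set t : ℝ := 2 * |C| / (κ * v) with ht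
  have ht0 : 0 ≤ t := by positivity
  refine ⟨s + t + 1, v / 4, by positivity, fun w hw hs => ?_⟩
  have h1 := hC w hw s (t + 1) (by positivity)
  have h2 : μ.real (W x ∩ {z | s + (t + 1) ≤ w z}) ≤ v / 2 := by
    by_contra! h
    have h3 : κ * (v / 2) ≤ μ.real (W x ∩ {y | w y ≤ s}) *
        μ.real (W x ∩ {y | s + (t + 1) ≤ w y}) :=
      mul_le_mul hs h.le (by positivity) (hκ.le.trans hs)
    have h4 : (t + 1) * (κ * (v / 2)) ≤ C := (mul_le_mul_of_nonneg_left h3 (by positivity)).trans h1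
    have h5 : t * (κ * (v / 2)) = |C| := by rw [ht]; field_simp
    have h6 : 0 < κ * (v / 2) := by positivity
    linarith [le_abs_self C, add_mul t 1 (κ * (v / 2))]
  have h3 : v ≤ μ.real (W x ∩ {z | s + (t + 1) ≤ w z}) + μ.real (W y ∩ {z | w z ≤ s + t + 1}) := by
    refine (measureReal_mono (fun z hz => ?_)).trans (measureReal_union_le _ _)
    rcases le_total (s + (t + 1)) (w z) with h | h
    · exact Or.inl ⟨hz.1, h⟩
    · exact Or.inr ⟨hz.2, by rw [Set.mem_ofPred_eq]; linarith⟩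
  linarith

theorem exists_sublevel_bound_of_preconnected [PreconnectedSpace X] (hW : ∀ x, IsOpen (W x))
    (hxW : ∀ x, x ∈ W x) (hC : ∀ x, ∃ C : ℝ, ∀ w ∈ F, ∀ s t : ℝ, 0 ≤ t →
      t * (μ.real (W x ∩ {y | w y ≤ s}) * μ.real (W x ∩ {y | s + t ≤ w y})) ≤ C)
    (x y : X) (s : ℝ) {κ : ℝ} (hκ : 0 < κ) :
    ∃ s' : ℝ, ∃ κ' : ℝ, 0 < κ' ∧ ∀ w ∈ F, κ ≤ μ.real (W x ∩ {z | w z ≤ s}) →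
      κ' ≤ μ.real (W y ∩ {z | w z ≤ s'}) := by
  set Q : Set X := {y | ∃ s' : ℝ, ∃ κ' : ℝ, 0 < κ' ∧ ∀ w ∈ F,
    κ ≤ μ.real (W x ∩ {z | w z ≤ s}) → κ' ≤ μ.real (W y ∩ {z | w z ≤ s'})}
  have step : ∀ y ∈ Q, ∀ y', (W y ∩ W y').Nonempty → y' ∈ Q := by
    rintro y ⟨s₁, κ₁, h1, hs⟩ y' hne
    obtain ⟨s₂, κ₂, h2, hs'⟩ := exists_sublevel_of_inter_nonempty hW hC hne s₁ h1
    exact ⟨s₂, κ₂, h2, fun w hw h => hs' w hw (hs w hw h)⟩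
  have hop : IsOpen Q := isOpen_iff_mem_nhds.2 fun y hy =>
    Filter.mem_of_superset ((hW y).mem_nhds (hxW y)) fun y' hy' => step y hy y' ⟨y', hy', hxW y'⟩
  have hcl : IsClosed Q := isOpen_compl_iff.1 <| isOpen_iff_mem_nhds.2 fun y hy =>
    Filter.mem_of_superset ((hW y).mem_nhds (hxW y)) fun y' hy' hy'' =>
      hy (step y' hy'' y ⟨y', hxW y', hy'⟩)
  have huniv : Q = Set.univ := IsClopen.eq_univ ⟨hcl, hop⟩ ⟨x, s, κ, hκ, fun w hw h => h⟩
  exact huniv.ge (Set.mem_univ y)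

end Propagation

end FormTypeCY

end

/-! ### The global estimate -/

theorem proposition3p3 {n : ℕ} (hn : 2 ≤ n) {M : Type*} [TopologicalSpace M] [T2Space M]
    [CompactSpace M] [ConnectedSpace M] [MeasurableSpace M] [BorelSpace M]
    [ChartedSpace (Fin n → ℂ) M] [IsManifold 𝓘(ℂ, Fin n → ℂ) ω M]
    (α : HermitianMetric n M) (hα : α.AsthenoRicciNonpos)
    (A H δ K : ℝ) (hδ : 0 < δ) :
    ∃ C : ℝ, ∀ (ω₀ : HermitianMetric n M) (h φ : M → ℝ) (b : ℝ),
      α.C0Bounds δ K ω₀ →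
      ContMDiff 𝓘(ℝ, Fin n → ℂ) 𝓘(ℝ, ℝ) ∞ h →
      (∀ x, |h x| ≤ H) →
      ContMDiff 𝓘(ℝ, Fin n → ℂ) 𝓘(ℝ, ℝ) ∞ φ →
      SolvesFormTypeCY α ω₀ h b φ →
      ∫ x, Real.exp (φ x) ∂α.vol = A →
      (∀ x, φ x ≤ 1) →
      ∀ x, -C ≤ φ x := by
  have := isLocallyFiniteMeasure_vol α
  have := isOpenPosMeasure_vol α
  set ν := α.vol
  have hV : 0 < ν.real Set.univ :=
    ENNReal.toReal_pos (isOpen_univ.measure_ne_zero ν Set.univ_nonempty) (measure_ne_top _ _)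
  set V := ν.real Set.univ
  -- the coordinate balls
  choose ρ hρ hball using fun x : M =>
    exists_closedBall_subset_target (n := n) x 4 (by norm_num)
  set e : M → OpenPartialHomeomorph M (Fin n → ℂ) := fun x => chartAt (Fin n → ℂ) x
  have he : ∀ x, e x ∈ atlas (Fin n → ℂ) M := fun x => chart_mem_atlas _ x
  have hxs : ∀ x, x ∈ (e x).source := fun x => mem_chart_source _ x
  set c : M → (Fin n → ℂ) := fun x => e x x
  have hball2 : ∀ x, Metric.closedBall (c x) (2 * ρ x) ⊆ (e x).target := fun x =>
    (Metric.closedBall_subset_closedBall (by linarith [hρ x])).trans (hball x)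
  have hball1 : ∀ x, Metric.closedBall (c x) (ρ x) ⊆ (e x).target := fun x =>
    (Metric.closedBall_subset_closedBall (by linarith [hρ x])).trans (hball x)
  -- The balls O of radius ρ cover M and locate the extrema; the measure estimates live on the
  -- doubled balls W. The level set estimate on W needs another doubling, hence the radius 4ρ inside
  -- the chart.
  set O : M → Set M := fun x => coordBall (e x) (c x) (ρ x)
  set W : M → Set M := fun x => coordBall (e x) (c x) (2 * ρ x)
  have hOW : ∀ x, O x ⊆ W x := fun x => coordBall_mono _ _ (by linarith [hρ x])
  have hxO : ∀ x, x ∈ O x := fun x => ⟨hxs x, Metric.mem_ball_self (hρ x)⟩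
  have hWo : ∀ x, IsOpen (W x) := fun x => isOpen_coordBall _ _ _
  obtain ⟨I, hI⟩ := isCompact_univ.elim_finite_subcover O (fun x => isOpen_coordBall _ _ _)
    fun x _ => Set.mem_iUnion.2 ⟨x, hxO x⟩
  have hcover : ∀ x, ∃ i ∈ I, x ∈ O i := fun x => by simpa using hI (Set.mem_univ x)
  -- the constants
  rcases le_or_gt A 0 with hA | hA
  -- No φ is admissible here, since the integral of e^φ is positive.
  · refine ⟨0, fun ω₀ h φ b _ _ _ hφ _ hint _ => ?_⟩
    exfalso
    have hi : Integrable (fun x => Real.exp (φ x)) ν :=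
      (Real.continuous_exp.comp hφ.continuous).integrable_of_hasCompactSupport
        (HasCompactSupport.of_compactSpace _)
    have : NeZero ν := ⟨fun h0 => by simp [V, h0] at hV⟩
    have := integral_exp_pos hi
    linarith
  -- With this T the set {φ < -T} carries at most half of the integral of e^φ.
  set T : ℝ := |Real.log (2 * V / A)|
  have hT0 : 0 ≤ T := abs_nonneg _
  have hT : Real.exp (-T) * V ≤ A / 2 := by
    have h1 : Real.exp (-T) ≤ A / (2 * V) := by
      rw [← Real.log_le_log_iff (Real.exp_pos _) (by positivity), Real.log_exp,
        ← inv_div (2 * V) A, Real.log_inv]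
      exact neg_le_neg (le_abs_self _)
    calc Real.exp (-T) * V ≤ A / (2 * V) * V := by gcongr
      _ = A / 2 := by field_simp
  -- κ(|I| + 1) is half of the lower bound A/(2e) for the mass of {φ ≥ -T}, so the sublevel sets in
  -- the |I| balls cannot all have mass below κ. The level s₀ defined below corresponds to φ = -T
  -- under log(2 - φ).
  set κ : ℝ := A / (4 * Real.exp 1 * (I.card + 1))
  have hκ : 0 < κ := by positivity
  set s₀ : ℝ := Real.log (2 + T)
  choose b₀ hb₀ using fun x => exists_const_bound_of_isMax hn hα (he x) (hball1 x) δ K H T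
  -- Sums of nonnegative terms over the finite cover stand in for maxima, here and in the final
  -- constant C.
  set B₀ : ℝ := ∑ i ∈ I, |b₀ i|
  choose m hm hsub using fun x => exists_vol_sublevel_bound hn hα (he x) (hρ x) (hball2 x) hδ K H B₀
  have hpos2 : ∀ x, 0 < 2 * ρ x := fun x => by linarith [hρ x]
  choose P hP using fun x => exists_vol_level_bound hn hα (he x) (hpos2 x)
    (show Metric.closedBall (c x) (2 * (2 * ρ x)) ⊆ (e x).target by
      rw [← mul_assoc]; norm_num; exact hball x) δ K H
  -- F collects all solutions with the same δ, K and H, with b unrestricted, so that the propagated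
  -- constants are chosen before φ.
  set F : Set (M → ℝ) := {w | ∃ b φ, GlobalSolution α δ K H b φ ∧ w = fun x => Real.log (2 - φ x)}
  choose s' κ' hκ' hprop using fun x y => exists_sublevel_bound_of_preconnected (μ := ν) (F := F)
    hWo (fun x => hOW x (hxO x)) (fun x => ⟨P x, by
      rintro w ⟨b, φ, hφ, rfl⟩ s t ht
      exact hP x b φ hφ s t ht⟩) x y s₀ hκ
  set C : ℝ := ∑ i ∈ I, ∑ j ∈ I, (|s' i j| + |P j| / (κ' i j * m j))
  refine ⟨Real.exp C + 1, fun ω₀ h φ b h0 _ hH hφ hs hint h1 => ?_⟩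
  have hsol := SolvesFormTypeCY.globalSolution h0 hH hφ hs h1
  have hφc := hsol.continuous
  -- `φ` is not too negative on a large set
  have hlarge : A / (2 * Real.exp 1) ≤ ν.real {x | -T ≤ φ x} := by
    have h2 := integral_exp_le (μ := ν) hφc.measurable h1 T
    rw [hint] at h2
    rw [div_le_iff₀ (by positivity)]
    linarith
  obtain ⟨i, hi, hiκ⟩ : ∃ i ∈ I, κ ≤ ν.real (W i ∩ {x | Real.log (2 - φ x) ≤ s₀}) := by
    by_contra! hcon
    have h2 : ν.real {x | -T ≤ φ x} ≤ ∑ i ∈ I, ν.real (W i ∩ {x | Real.log (2 - φ x) ≤ s₀}) := by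
      refine (measureReal_mono (fun x hx => ?_) (measure_ne_top ν _)).trans
        (measureReal_biUnion_finset_le I _)
      obtain ⟨i, hi, hx'⟩ := hcover x
      refine Set.mem_biUnion hi ⟨hOW i hx', ?_⟩
      have hx' : -T ≤ φ x := hx
      exact Real.log_le_log (by linarith [h1 x]) (by linarith)
    have h3 : ∑ i ∈ I, ν.real (W i ∩ {x | Real.log (2 - φ x) ≤ s₀}) ≤ I.card * κ := by
      rw [← nsmul_eq_mul]
      exact Finset.sum_le_card_nsmul _ _ _ fun i hi => (hcon i hi).le
    have h4 : (I.card + 1) * κ = A / (4 * Real.exp 1) := by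
      simp only [κ]; field_simp
    have h5 : A / (2 * Real.exp 1) = 2 * (A / (4 * Real.exp 1)) := by field_simp; norm_num
    have h6 : 0 < A / (4 * Real.exp 1) := by positivity
    linarith
  -- bound for `b` at a maximum point
  have hb : b ≤ B₀ := by
    obtain ⟨x, -, hx⟩ := isCompact_univ.exists_isMaxOn Set.univ_nonempty hφc.continuousOn
    have hmax : ∀ y, φ y ≤ φ x := fun y => hx (Set.mem_univ y)
    obtain ⟨j, hj, hxj⟩ := hcover x
    have hTx : -T ≤ φ x := by
      by_contra! hlt
      have h2 : {x | -T ≤ φ x} = ∅ :=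
        Set.eq_empty_of_forall_notMem fun y (hy : -T ≤ φ y) => by linarith [hmax y]
      rw [h2, measureReal_empty] at hlarge
      have : 0 < A / (2 * Real.exp 1) := by positivity
      linarith
    exact (hb₀ j b φ hsol x hxj hmax hTx).trans ((le_abs_self _).trans
      (Finset.single_le_sum (f := fun i => |b₀ i|) (fun _ _ => abs_nonneg _) hj))
  -- the minimum
  obtain ⟨z, -, hz⟩ := isCompact_univ.exists_isMinOn Set.univ_nonempty hφc.continuousOn
  have hmin : ∀ y, φ z ≤ φ y := fun y => hz (Set.mem_univ y)
  intro x
  refine le_trans ?_ (hmin x)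
  rcases le_or_gt (-1) (φ z) with hz1 | hz1
  · linarith [Real.exp_pos C]
  obtain ⟨j, hj, hzj⟩ := hcover z
  have h2 := hprop i j _ ⟨b, φ, hsol, rfl⟩ hiκ
  have h3 := hsub j b φ hb hsol z hzj hmin hz1.le
  have hterm : |s' i j| + |P j| / (κ' i j * m j) ≤ C := by
    have hnn : ∀ i j, 0 ≤ |s' i j| + |P j| / (κ' i j * m j) := fun i j => by
      have := hκ' i j
      have := hm j
      positivity
    exact (Finset.single_le_sum (f := fun j => |s' i j| + |P j| / (κ' i j * m j))
      (fun j _ => hnn i j) hj).trans (Finset.single_le_sum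
      (f := fun i => ∑ j ∈ I, (|s' i j| + |P j| / (κ' i j * m j)))
      (fun i _ => Finset.sum_nonneg fun j _ => hnn i j) hi)
  suffices hlog : Real.log (1 - φ z) ≤ C by
    rw [Real.log_le_iff_le_exp (by linarith)] at hlog
    linarith
  -- Let t be the gap between the propagated level s' and log(1 - min φ). On {φ ≤ min φ + 1} one has
  -- log(2 - φ) ≥ s' + t, so the level set estimate applies to a sublevel set of mass κ' and a
  -- superlevel set of mass m. It gives t κ' m ≤ P, against the choice of C.
  by_contra! hlt
  set t : ℝ := Real.log (1 - φ z) - s' i j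
  have hmj := hm j
  have hκij := hκ' i j
  have ht : |P j| / (κ' i j * m j) < t := by
    have := le_abs_self (s' i j)
    simp only [t]
    linarith
  have ht0 : 0 < t := lt_of_le_of_lt (by positivity) ht
  have h4 : m j ≤ ν.real (W j ∩ {x | s' i j + t ≤ Real.log (2 - φ x)}) := by
    refine h3.trans (measureReal_mono fun y hy => ⟨hy.1, ?_⟩)
    have hy2 : φ y ≤ φ z + 1 := hy.2
    simp only [Set.mem_ofPred_eq, t, add_sub_cancel]
    exact Real.log_le_log (by linarith) (by linarith)
  have h5 := hP j b φ hsol (s' i j) t ht0.le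
  have h6 : t * (κ' i j * m j) ≤ P j :=
    (mul_le_mul_of_nonneg_left (mul_le_mul h2 h4 hmj.le (hκij.le.trans h2)) ht0.le).trans h5
  rw [div_lt_iff₀ (by positivity)] at ht
  linarith [le_abs_self (P j)]
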